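/- **Conventions.** For an open subset $O$ of a Banach space and $n\in\mathbb N\cup\{\infty\}$, $C^n_b(O;Y)$ is the set of $n$ times continuously (Fréchet) differentiable maps $O\to Y$ all of whose derivatives of finite order $0\le i\le n$ are bounded; for finite $n$ its norm is $\|f\|_{C^n_b(O)}=\sup\{\|D^if(x)\| : x\in O,\ 0\le i\le n\}$. Over $\mathbb C$, $C^\omega_b(O;Y)$ is the set of bounded analytic maps with the supremum norm. $\sigma(\cdot)$ is the spectrum (of the complexification, for real spaces), and for sets $\Lambda,\Gamma\subset\mathbb C$, $\Lambda\Gamma=\{\lambda\gamma\}$, $\Lambda^n=\Lambda\cdots\Lambda$, $\Lambda^0=\{1\}$; $B_1^{\mathbb C}$ is the open unit disc. $\mathrm{Aut}$ denotes bounded linear automorphisms, and $B_R$ the open ball of radius $R$ about $0$. **Setting.** Let $X=X_0\oplus X_1$ be a Banach space split into closed subspaces. Let either $X$ be real and $r\in\mathbb N\cup\{\infty\}$, or $X$ be complex and $r=\omega$ (with $\mathbb N<\infty<\omega$). Let $f:O\to X$ be $C^r_b$ on an open neighborhood $O$ of $0$, $f(0)=0$, with $$A:=Df(0)=\begin{pmatrix}A_0&0\\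 B&A_1\end{pmatrix},\qquad 0\notin\sigma(A_0),\qquad \sigma(A)\subset B_1^{\mathbb C}.$$ Let $1\le \ell<r$ be an integer such that * (H.3) $\sigma(A_0^{-1})\,\sigma(A)^{\ell+1}\subset B_1^{\mathbb C}$; * (H.4) $\sigma(A_0)^{n-j}\sigma(A_1)^j\cap\sigma(A_0)=\emptyset$ for all integers $2\le n\le \ell$, $1\le j\le n$. For an integer $m\ge2$ consider also the optional condition * (H.5)$_m$ $\sigma(A_0)^n\cap\sigma(A_0)=\emptyset$ for all integers $n$ with $m\le n\le \ell$. A *$C^k_b$ solution* is a pair $(g,\pi)$ of $C^k_b$ maps $\pi:U\to X_0$, $g:O_0\to X_0$, with open neighborhoods $U\subset O$ of $0\in X$ and $O_0$ of $0\in X_0$, such that $f(U)\subset U$, $\pi(U)\subset O_0$, $g(O_0)\subset O_0$, $$\pi\circ f=g\circ\pi\ \text{ on }U,\qquad \pi(0)=0,\qquad D\pi(0)|_{X_0}\in\mathrm{Aut}(X_0),\qquad \ker D\pi(0)=X_1 .$$ **Theorem 2.1.** (i) There is a $C^r_b$ solution $(g,\pi)$ such that $\pi$ is a submersion on $U$ and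 $g$ is a polynomial of degree at most $\ell$. If (H.5)$_m$ holds for some $2\le m\le \ell$, there is such a solution with $g$ of degree at most $m-1$ (so $g$ is linear if $m=2$). (ii) Let $\ell+1\le k\le r$ ($k=\omega$ if $r=\omega$), and let $(g,\pi)$ on $U$ and $(\tilde g,\tilde\pi)$ on $\tilde U$ be two $C^k_b$ solutions. Then there are a local $C^k_b$ diffeomorphism $\theta$ of $X_0$ about $0$ and an open neighborhood $W\subset U\cap\tilde U$ of $0$ such that $$\tilde\pi=\theta\circ\pi\ \text{ on }W,\qquad \tilde g=\theta\circ g\circ\theta^{-1}\ \text{ on }\tilde\pi(W),$$ and $\theta$ is unique as a germ at $0$. If $g$ and $\tilde g$ are both linear and (H.5)$_2$ holds, then $\theta=D\tilde\pi(0)|_{X_0}\,(D\pi(0)|_{X_0})^{-1}\in\mathrm{Aut}(X_0)$ near $0$. Write $C=D\pi(0)|_{X_0}$, $\tilde C=D\tilde\pi(0)|_{X_0}$, and let $N=\ell+1$ in the real case, $N=\omega$ in the complex case. The size of $W$ is determined by bounds on $C^N_b$ norms, as follows. For fixed $X,X_0,X_1,A,\ell$ and all $R,M>0$ there is $\delta>0$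 such that, for all $r,k,f$ with $Df(0)=A$ and all solutions as above, one can take $$W=\{x\in U\cap\tilde U:\ |x|<\delta,\ |C^{-1}\pi(x)|<\delta,\ |\tilde C^{-1}\tilde\pi(x)|<\delta\}$$ (for a suitable $\theta$ with the properties above), provided that the four maps $$f-A,\quad C^{-1}g\circ C-A_0,\quad \tilde C^{-1}\tilde g\circ\tilde C-A_0,\quad \tilde C^{-1}\,\tilde\pi|_{U_0}\circ(\pi|_{U_0})^{-1}\circ C-\mathrm{id}_{X_0}$$ are defined and have $C^N_b$ norm at most $M$ on the balls $B_R$ (of $X$ for the first, of $X_0$ for the others), for some open neighborhood $U_0\subset X_0\cap U\cap\tilde U$ of $0$ in $X_0$ on which $\pi$ and $\tilde\pi$ are invertible. -/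

import Mathlib

open scoped Pointwise ContDiff TensorProduct

namespace InvFoliation

universe u

section Spectrum

/-- The spectrum of a bounded operator on a complex Banach space. -/
def complexSpectrum {E : Type u} [NormedAddCommGroup E] [NormedSpace ℂ E] (T : E →L[ℂ] E) :
    Set ℂ :=
  spectrum ℂ T

/-- The spectrum of a bounded operator `T` on a real Banach space `E`: the spectrum of the
complexification `id ⊗ T` acting on `ℂ ⊗ E`. (On a Banach space a bijective bounded operator
has a bounded inverse, so that invertibility as a linear map and as a bounded operator agree.) -/
def realSpectrum {E : Type u} [NormedAddCommGroup E] [NormedSpace ℝ E] (T : E →L[ℝ] E) :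
    Set ℂ :=
  spectrum ℂ
    (LinearMap.baseChange ℂ (T : E →ₗ[ℝ] E) : (ℂ ⊗[ℝ] E) →ₗ[ℂ] (ℂ ⊗[ℝ] E))

end Spectrum

section Smoothness

/-- `f` is of class `C^n_b` on the open set `S`. For `n ∈ ℕ ∪ {∞}`: it is `n` times continuously
differentiable, and each derivative of (finite) order at most `n` is bounded on `S`.
For `n = ω`: it is analytic and bounded on `S`. -/
def IsCb (𝕜 : Type*) [NontriviallyNormedField 𝕜] {E : Type*} [NormedAddCommGroup E]
    [NormedSpace 𝕜 E] {F : Type*} [NormedAddCommGroup F] [NormedSpace 𝕜 F]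
    (n : WithTop ℕ∞) (f : E → F) (S : Set E) : Prop :=
  ContDiffOn 𝕜 n f S ∧
    ∀ i : ℕ, (i : WithTop ℕ∞) ≤ n → (n = ω → i = 0) →
      ∃ M : ℝ, ∀ x ∈ S, ‖iteratedFDeriv 𝕜 i f x‖ ≤ M

/-- `f` is of class `C^n_b` on the open set `S`, with norm `‖f‖_{C^n_b(S)} ≤ M`
(the norm is the supremum norm if `n = ω`). It is used for `n ∈ ℕ ∪ {ω}` only. -/
def CbNormLE (𝕜 : Type*) [NontriviallyNormedField 𝕜] {E : Type*} [NormedAddCommGroup E]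
    [NormedSpace 𝕜 E] {F : Type*} [NormedAddCommGroup F] [NormedSpace 𝕜 F]
    (n : WithTop ℕ∞) (f : E → F) (S : Set E) (M : ℝ) : Prop :=
  ContDiffOn 𝕜 n f S ∧
    ∀ i : ℕ, (i : WithTop ℕ∞) ≤ n → (n = ω → i = 0) →
      ∀ x ∈ S, ‖iteratedFDeriv 𝕜 i f x‖ ≤ M

/-- `g` is a (continuous) polynomial of degree at most `d`: `g y = ∑_{i ≤ d} p_i (y, …, y)` with
bounded `i`-linear maps `p_i`. -/
def IsPolynomialOfDegreeLE (𝕜 : Type*) [NontriviallyNormedField 𝕜] {E : Type*}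
    [NormedAddCommGroup E] [NormedSpace 𝕜 E] {F : Type*} [NormedAddCommGroup F] [NormedSpace 𝕜 F]
    (d : ℕ) (g : E → F) : Prop :=
  ∃ p : FormalMultilinearSeries 𝕜 E F, ∀ y, g y = ∑ i ∈ Finset.range (d + 1), p i fun _ => y

/-- `π` is a submersion at every point of the open set `S`: the derivative is onto and its kernel
is complemented. -/
def IsSubmersionOn (𝕜 : Type*) [NontriviallyNormedField 𝕜] {E : Type*} [NormedAddCommGroup E]
    [NormedSpace 𝕜 E] {F : Type*} [NormedAddCommGroup F] [NormedSpace 𝕜 F]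
    (π : E → F) (S : Set E) : Prop :=
  ∀ x ∈ S, DifferentiableAt 𝕜 π x ∧ Function.Surjective (fderiv 𝕜 π x) ∧
    (LinearMap.ker (fderiv 𝕜 π x : E →ₗ[𝕜] F)).ClosedComplemented

end Smoothness

section Blocks

variable {𝕜 : Type*} [NontriviallyNormedField 𝕜]
  {X : Type*} [NormedAddCommGroup X] [NormedSpace 𝕜 X] {X₀ X₁ : Submodule 𝕜 X}

/-- The diagonal block `A₀ = P̃₀ A ι₀ : X₀ → X₀` of `A` with respect to `X = X₀ ⊕ X₁`. -/
noncomputable def block₀ (hX : X₀.IsTopCompl X₁) (A : X →L[𝕜] X) : X₀ →L[𝕜] X₀ :=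
  (X₀.projectionOntoL X₁ hX).comp (A.comp X₀.subtypeL)

/-- The diagonal block `A₁ = P̃₁ A ι₁ : X₁ → X₁` of `A` with respect to `X = X₀ ⊕ X₁`. -/
noncomputable def block₁ (hX : X₀.IsTopCompl X₁) (A : X →L[𝕜] X) : X₁ →L[𝕜] X₁ :=
  (X₁.projectionOntoL X₀ hX.symm).comp (A.comp X₁.subtypeL)

/-- `A` is block lower triangular with respect to `X = X₀ ⊕ X₁`: the upper right block
`P̃₀ A ι₁ : X₁ → X₀` vanishes. -/
def IsLowerTriangular (hX : X₀.IsTopCompl X₁) (A : X →L[𝕜] X) : Prop :=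
  (X₀.projectionOntoL X₁ hX).comp (A.comp X₁.subtypeL) = 0

end Blocks

/-- The spectral assumptions, in terms of `σA = σ(A)`, `σA₀ = σ(A₀)`, `σA₀inv = σ(A₀⁻¹)`,
`σA₁ = σ(A₁)`. Products and powers of sets are the pointwise ones, with `S ^ 0 = {1}`. -/
structure SpectralAssumptions (σA σA₀ σA₀inv σA₁ : Set ℂ) (ℓ : ℕ) : Prop where
  zero_notMem : (0 : ℂ) ∉ σA₀
  stable : σA ⊆ Metric.ball 0 1
  gap : σA₀inv * σA ^ (ℓ + 1) ⊆ Metric.ball 0 1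
  nonresonance : ∀ n j : ℕ, 2 ≤ n → n ≤ ℓ → 1 ≤ j → j ≤ n →
    (σA₀ ^ (n - j) * σA₁ ^ j) ∩ σA₀ = ∅

/-- The internal nonresonance condition in the orders `m, …, ℓ`. -/
def InternalNonresonance (σA₀ : Set ℂ) (m ℓ : ℕ) : Prop :=
  ∀ n : ℕ, m ≤ n → n ≤ ℓ → σA₀ ^ n ∩ σA₀ = ∅

section Solutions

variable {𝕜 : Type*} [NontriviallyNormedField 𝕜]
  {X : Type*} [NormedAddCommGroup X] [NormedSpace 𝕜 X]

/-- `f : O → X` is a `C^r_b` map on the open neighborhood `O` of the fixed point `0`, with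
derivative `A` there. -/
structure IsMapWithFixedPoint (r : WithTop ℕ∞) (O : Set X) (f : X → X) (A : X →L[𝕜] X) :
    Prop where
  isOpen : IsOpen O
  zero_mem : (0 : X) ∈ O
  isCb : IsCb 𝕜 r f O
  map_zero : f 0 = 0
  hasFDerivAt : HasFDerivAt f A 0

/-- `(g, π)`, with `π : U → X₀` and `g : O₀ → O₀` of class `C^n_b`, solves `π ∘ f = g ∘ π` on the
`f`-invariant open neighborhood `U ⊆ O` of `0`, with `π 0 = 0`, with `Dπ(0)|_{X₀} = C` an
automorphism of `X₀`, and with `π` tangent to `X₁`, that is, `ker Dπ(0) = X₁`. -/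
structure IsSolution (X₀ X₁ : Submodule 𝕜 X) (n : WithTop ℕ∞) (O : Set X) (f : X → X)
    (U : Set X) (π : X → X₀) (O₀ : Set X₀) (g : X₀ → X₀) (C : X₀ ≃L[𝕜] X₀) : Prop where
  isOpen : IsOpen U
  zero_mem : (0 : X) ∈ U
  subset : U ⊆ O
  isCb : IsCb 𝕜 n π U
  map_zero : π 0 = 0
  fderiv_eq : ∀ v : X₀, fderiv 𝕜 π 0 (v : X) = C v
  ker_eq : LinearMap.ker (fderiv 𝕜 π 0 : X →ₗ[𝕜] X₀) = X₁
  isOpen₀ : IsOpen O₀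
  isCb₀ : IsCb 𝕜 n g O₀
  mapsTo_f : Set.MapsTo f U U
  mapsTo_π : Set.MapsTo π U O₀
  mapsTo_g : Set.MapsTo g O₀ O₀
  semiconj : ∀ x ∈ U, π (f x) = g (π x)

/-- There is a `C^r_b` solution `(g, π)`, with `π` a submersion and `g` a polynomial of degree at
most `d` (a linear map if `d = 1`). -/
def ExistsSolution (X₀ X₁ : Submodule 𝕜 X) (r : WithTop ℕ∞) (O : Set X) (f : X → X) (d : ℕ) :
    Prop :=
  ∃ (U : Set X) (π : X → X₀) (O₀ : Set X₀) (g : X₀ → X₀) (C : X₀ ≃L[𝕜] X₀),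
    IsSolution X₀ X₁ r O f U π O₀ g C ∧ IsSubmersionOn 𝕜 π U ∧
      IsPolynomialOfDegreeLE 𝕜 d g ∧ (d = 1 → ∃ L : X₀ →L[𝕜] X₀, ∀ y, g y = L y)

/-- `θ` is a local `C^k_b` diffeomorphism of `X₀` about `0`, `W ⊆ U ∩ U'` is an open neighborhood
of `0`, `π' = θ ∘ π` on `W`, and `g' = θ ∘ g ∘ θ⁻¹` on `π'(W)` (all compositions being
defined there). -/
structure IsTransition {X₀ : Submodule 𝕜 X} (k : WithTop ℕ∞) (U : Set X) (π : X → X₀)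
    (g : X₀ → X₀) (U' : Set X) (π' : X → X₀) (g' : X₀ → X₀)
    (θ : OpenPartialHomeomorph X₀ X₀) (W : Set X) : Prop where
  zero_mem_source : (0 : X₀) ∈ θ.source
  isCb : IsCb 𝕜 k θ θ.source
  isCb_symm : IsCb 𝕜 k θ.symm θ.target
  isOpen : IsOpen W
  zero_mem : (0 : X) ∈ W
  subset : W ⊆ U ∩ U'
  mapsTo : Set.MapsTo π W θ.source
  semiconj : ∀ x ∈ W, π' x = θ (π x)
  conj : ∀ y ∈ π' '' W, g (θ.symm y) ∈ θ.source ∧ g' y = θ (g (θ.symm y))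

/-- Uniqueness of `C^k_b` solutions up to a transition `θ`, which is itself unique as a germ at
`0`, and is the linear map `Dπ'(0)|_{X₀} (Dπ(0)|_{X₀})⁻¹` if `g` and `g'` are linear and the
internal nonresonance condition holds in all orders `2, …, ℓ`. -/
def UniqueUpToTransition (X₀ X₁ : Submodule 𝕜 X) (k : WithTop ℕ∞) (O : Set X) (f : X → X)
    (σA₀ : Set ℂ) (ℓ : ℕ) : Prop :=
  ∀ (U : Set X) (π : X → X₀) (O₀ : Set X₀) (g : X₀ → X₀) (C : X₀ ≃L[𝕜] X₀)
    (U' : Set X) (π' : X → X₀) (O₀' : Set X₀) (g' : X₀ → X₀) (C' : X₀ ≃L[𝕜] X₀),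
    IsSolution X₀ X₁ k O f U π O₀ g C → IsSolution X₀ X₁ k O f U' π' O₀' g' C' →
    ∃ (θ : OpenPartialHomeomorph X₀ X₀) (W : Set X),
      IsTransition (𝕜 := 𝕜) k U π g U' π' g' θ W ∧
      (∀ (θ' : OpenPartialHomeomorph X₀ X₀) (W' : Set X),
        IsTransition (𝕜 := 𝕜) k U π g U' π' g' θ' W' → ∀ᶠ y in nhds (0 : X₀), θ' y = θ y) ∧
      (InternalNonresonance σA₀ 2 ℓ →
        (∃ L : X₀ →L[𝕜] X₀, ∀ y ∈ O₀, g y = L y) →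
        (∃ L : X₀ →L[𝕜] X₀, ∀ y ∈ O₀', g' y = L y) →
        ∀ᶠ y in nhds (0 : X₀), θ y = C' (C.symm y))

/-- The size of the neighborhood on which `π' = θ ∘ π` holds depends only on `A` and on bounds `M`
for the `C^N_b` norms, on balls of radius `R`, of `f - A`, of `C⁻¹ g C - A₀`, of
`C'⁻¹ g' C' - A₀`, and of `τ - id`, where `C = Dπ(0)|_{X₀}`, `C' = Dπ'(0)|_{X₀}` and
`τ = C'⁻¹ ∘ π'|_{U₀} ∘ (π|_{U₀})⁻¹ ∘ C`, for an open neighborhood `U₀` of `0` in `X₀` on which `π`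
and `π'` are invertible. Here `r` ranges over the set `ℛ` of classes, and `N ≤ k ≤ r`. -/
def UniformNeighborhood (X₀ X₁ : Submodule 𝕜 X) (A : X →L[𝕜] X) (A₀ : X₀ →L[𝕜] X₀)
    (N : WithTop ℕ∞) (ℛ : Set (WithTop ℕ∞)) : Prop :=
  ∀ R M : ℝ, 0 < R → 0 < M → ∃ δ : ℝ, 0 < δ ∧
    ∀ r ∈ ℛ, ∀ k : WithTop ℕ∞, N ≤ k → k ≤ r →
    ∀ (O : Set X) (f : X → X), IsMapWithFixedPoint r O f A →
    Metric.ball 0 R ⊆ O → CbNormLE 𝕜 N (fun x => f x - A x) (Metric.ball 0 R) M →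
    ∀ (U : Set X) (π : X → X₀) (O₀ : Set X₀) (g : X₀ → X₀) (C : X₀ ≃L[𝕜] X₀)
      (U' : Set X) (π' : X → X₀) (O₀' : Set X₀) (g' : X₀ → X₀) (C' : X₀ ≃L[𝕜] X₀),
    IsSolution X₀ X₁ k O f U π O₀ g C → IsSolution X₀ X₁ k O f U' π' O₀' g' C' →
    (∀ y ∈ Metric.ball (0 : X₀) R, C y ∈ O₀) →
    CbNormLE 𝕜 N (fun y => C.symm (g (C y)) - A₀ y) (Metric.ball 0 R) M →
    (∀ y ∈ Metric.ball (0 : X₀) R, C' y ∈ O₀') →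
    CbNormLE 𝕜 N (fun y => C'.symm (g' (C' y)) - A₀ y) (Metric.ball 0 R) M →
    ∀ (U₀ : Set X₀) (τ : X₀ → X₀), IsOpen U₀ → 0 ∈ U₀ → (∀ u ∈ U₀, (u : X) ∈ U ∩ U') →
    Set.InjOn (fun u : X₀ => π u) U₀ → Set.InjOn (fun u : X₀ => π' u) U₀ →
    (∀ u ∈ U₀, τ (C.symm (π u)) = C'.symm (π' u)) →
    Metric.ball (0 : X₀) R ⊆ (fun u : X₀ => C.symm (π u)) '' U₀ →
    CbNormLE 𝕜 N (fun y => τ y - y) (Metric.ball 0 R) M →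
    ∃ θ : OpenPartialHomeomorph X₀ X₀,
      IsTransition (𝕜 := 𝕜) k U π g U' π' g' θ
        {x | x ∈ U ∩ U' ∧ ‖x‖ < δ ∧ ‖C.symm (π x)‖ < δ ∧ ‖C'.symm (π' x)‖ < δ}

/-- All assertions, for the classes `r ∈ ℛ` of maps with linear part `A` and the classes `k` with
`N ≤ k ≤ r` of solutions. -/
def FoliationAssertions (X₀ X₁ : Submodule 𝕜 X) (A : X →L[𝕜] X) (A₀ : X₀ →L[𝕜] X₀)
    (σA₀ : Set ℂ) (ℓ : ℕ) (N : WithTop ℕ∞) (ℛ : Set (WithTop ℕ∞)) : Prop :=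
  (∀ r ∈ ℛ, ∀ (O : Set X) (f : X → X), IsMapWithFixedPoint r O f A →
    ExistsSolution X₀ X₁ (𝕜 := 𝕜) r O f ℓ ∧
    (∀ m : ℕ, 2 ≤ m → m ≤ ℓ → InternalNonresonance σA₀ m ℓ →
      ExistsSolution X₀ X₁ (𝕜 := 𝕜) r O f (m - 1)) ∧
    (∀ k : WithTop ℕ∞, N ≤ k → k ≤ r →
      UniqueUpToTransition X₀ X₁ (𝕜 := 𝕜) k O f σA₀ ℓ)) ∧
  UniformNeighborhood X₀ X₁ A A₀ N ℛ

end Solutions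

end InvFoliation

/-!
Let `P : X → X₀` be the projection with kernel `X₁`. Triangularity of `A` means `P A = A₀ P`, so
that `P` solves the semiconjugacy equation `π ∘ f = g ∘ π` to first order, with `g = A₀`. The
conditions `σ(A₀)^(n-j) σ(A₁)^j ∩ σ(A₀) = ∅` and `σ(A₀)^n ∩ σ(A₀) = ∅` are nonresonance conditions
under which `P` can be corrected up to order `ℓ`, and the condition on `σ(A₀⁻¹) σ(A)^(ℓ+1)` is a
spectral gap which makes terms of order `ℓ + 1` harmless.

**Formal solution.** A term `p` of order `n` in `π` and a term `γ` in `g` change the equation by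
`A₀ p - p ∘ A + γ ∘ P` in this order. With `γ` equal to `p ∘ A` on `X₀` (`κ = 1`), or `γ = 0`
(`κ = 0`), this is the homological operator `p ↦ A₀ p - p ∘ A + κ p ∘ A ∘ P` on `n`-linear maps. If
`A` is block diagonal, it is a polynomial expression in commuting operators, whose characters take
values in the spectra of the blocks, and the nonresonance conditions exclude that a character
vanishes on it (`isUnit_sub_of_nonresonance`). The off-diagonal block can be scaled down by
conjugation, so that it does not matter (`isUnit_homological`). For real spaces the characters live
on operators of the complex Banach space of complex valued functionals; this avoids complexifying
norms. The terms are then found order by order (`exists_formal_solution`).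

**Existence.** For the polynomial `g` so obtained, the correction `ρ` of the formal solution
satisfies an equation `ρ (f x) = q x + H (x, ρ x) (ρ x)` with `q = O(‖x‖ ^ (ℓ + 1))`. The iterates
`fʲ x` decay like `‖a‖ ^ j`, and the values `ρ (fʲ x)` are sought with decay `‖a‖ ^ ((ℓ + 1) j)`.
The rescaled sequences of both are bounded, and they are the zeros of a smooth map on spaces of
bounded sequences, whose linearization is invertible by the spectral gap
(`exists_solution_functional_equation`). Smoothness of `ρ` comes from that of superposition
operators (`contDiffAt_superpose`). The germ extends to a forward invariant neighborhood on which
all derivatives are bounded (`exists_solution_on_nhds`).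

**Uniqueness.** Let `(g, π)` and `(g', π')` be solutions with `Dπ(0) = Dπ'(0) = P`, and let `w` be
a right inverse of `π`. The difference of `π'` and `π' ∘ w ∘ π` vanishes to order `ℓ + 1`, since
its leading term would be in the kernel of the homological operator
(`isBigO_of_difference_equation`). Along orbits such a difference decays faster than the
contraction rate of `g'` permits, so it is `0` (`exists_nhds_eq_of_isBigO`), and `θ = π' ∘ w` is
the transition map (`IsSolutionGerm.eventually_eq_comp`).

**Uniform neighborhoods.** On a ball on which the derivatives of `f`, `g`, `g'` are close to those
at `0`, the maps `g` and `g'` are diffeomorphisms, and `g'⁻¹ ∘ θ ∘ g` extends `θ` to the points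
which `g` maps to its domain. As `g` contracts, finitely many such steps cover the ball
(`exists_uniform_transition`). The radius of the ball follows from bounds of the second
derivatives: directly in the real case, as `ℓ + 1 ≥ 2`, and by Cauchy estimates in the complex case
(`HasUniformDerivBound`).
-/

namespace InvFoliation
open Set Filter Topology

/-! ### Calculus of maps of class `C^n_b` -/

section CbCalculus

variable {𝕜 : Type*} [NontriviallyNormedField 𝕜]
  {E : Type*} [NormedAddCommGroup E] [NormedSpace 𝕜 E]
  {F : Type*} [NormedAddCommGroup F] [NormedSpace 𝕜 F]
  {G : Type*} [NormedAddCommGroup G] [NormedSpace 𝕜 G]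
  {D : Type*} [NormedAddCommGroup D] [NormedSpace 𝕜 D]
  {n : WithTop ℕ∞} {S : Set E} {T : Set F}

lemma isCb_order_le {i j : ℕ} (h : n = ω → j = 0) (hij : i ≤ j) : n = ω → i = 0 :=
  fun hn => by have := h hn; omega

lemma IsCb.bound {f : E → F} (hf : IsCb 𝕜 n f S) {j : ℕ} (hj : (j : WithTop ℕ∞) ≤ n)
    (hω : n = ω → j = 0) : ∃ M : ℝ, 0 ≤ M ∧ ∀ i ≤ j, ∀ x ∈ S, ‖iteratedFDeriv 𝕜 i f x‖ ≤ M := by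
  have key : ∀ i : ℕ, ∃ M : ℝ, i ≤ j → ∀ x ∈ S, ‖iteratedFDeriv 𝕜 i f x‖ ≤ M := fun i => by
    by_cases hij : i ≤ j
    · obtain ⟨M, hM⟩ := hf.2 i ((by exact_mod_cast hij : (i : WithTop ℕ∞) ≤ j).trans hj)
        (isCb_order_le hω hij)
      exact ⟨M, fun _ => hM⟩
    · exact ⟨0, fun h => absurd h hij⟩
  choose M hM using key
  refine ⟨∑ i ∈ Finset.range (j + 1), |M i|, Finset.sum_nonneg fun _ _ => abs_nonneg _,
    fun i hi x hx => (hM i hi x hx).trans ((le_abs_self _).trans ?_)⟩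
  exact Finset.single_le_sum (f := fun i => |M i|) (fun _ _ => abs_nonneg _)
    (Finset.mem_range.2 (Nat.lt_succ_of_le hi))

lemma IsCb.bounded {f : E → F} (hf : IsCb 𝕜 n f S) : ∃ M : ℝ, ∀ x ∈ S, ‖f x‖ ≤ M := by
  obtain ⟨M, hM⟩ := hf.2 0 (by simp) (fun _ => rfl)
  exact ⟨M, fun x hx => by simpa using hM x hx⟩

lemma IsCb.mono {f : E → F} (hf : IsCb 𝕜 n f S) {S' : Set E} (h : S' ⊆ S) : IsCb 𝕜 n f S' :=
  ⟨hf.1.mono h, fun i hi hω => (hf.2 i hi hω).imp fun _ hM x hx => hM x (h hx)⟩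

lemma IsCb.of_le {f : E → F} {m : WithTop ℕ∞} (hf : IsCb 𝕜 n f S) (hmn : m ≤ n)
    (hω : n = ω → m = ω) : IsCb 𝕜 m f S :=
  ⟨hf.1.of_le hmn, fun i hi hi' => hf.2 i (hi.trans hmn) fun h => hi' (hω h)⟩

lemma IsCb.congr {f g : E → F} (hf : IsCb 𝕜 n f S) (hS : IsOpen S) (h : EqOn g f S) :
    IsCb 𝕜 n g S := by
  refine ⟨hf.1.congr h, fun i hi hω => (hf.2 i hi hω).imp fun M hM x hx => ?_⟩
  rw [(h.eventuallyEq_of_mem (hS.mem_nhds hx)).iteratedFDeriv 𝕜 i |>.eq_of_nhds]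
  exact hM x hx

lemma isCb_of_forall_nat {f : E → F} (hn : n ≠ ω) (h : ∀ j : ℕ, (j : WithTop ℕ∞) ≤ n →
    IsCb 𝕜 j f S) : IsCb 𝕜 n f S := by
  refine ⟨?_, fun i hi _ => (h i hi).2 i le_rfl fun h => absurd h (by simp)⟩
  intro x hx
  lift n to ℕ∞ using hn
  exact contDiffWithinAt_iff_forall_nat_le.2 fun m hm =>
    (h m (by exact_mod_cast hm)).1 x hx

lemma IsCb.comp {g : F → G} {f : E → F} (hg : IsCb 𝕜 n g T) (hT : IsOpen T)
    (hf : IsCb 𝕜 n f S) (hS : IsOpen S) (hfS : MapsTo f S T) : IsCb 𝕜 n (g ∘ f) S := by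
  refine ⟨hg.1.comp hf.1 hfS, fun i hi hω => ?_⟩
  obtain ⟨C, hC0, hC⟩ := hg.bound hi hω
  obtain ⟨M, hM0, hM⟩ := hf.bound hi hω
  refine ⟨i.factorial * C * (max M 1) ^ i, fun x hx => ?_⟩
  rw [← iteratedFDerivWithin_of_isOpen i hS hx]
  refine norm_iteratedFDerivWithin_comp_le hg.1 hf.1 hi hT.uniqueDiffOn hS.uniqueDiffOn hfS hx
    (fun j hj => ?_) (fun j hj1 hj => ?_)
  · rw [iteratedFDerivWithin_of_isOpen j hT (hfS hx)]
    exact hC j hj _ (hfS hx)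
  · rw [iteratedFDerivWithin_of_isOpen j hS hx]
    refine (hM j hj x hx).trans ((le_max_left M 1).trans ?_)
    exact le_self_pow₀ (le_max_right M 1) (by omega)

lemma IsCb.clm_comp {f : E → F} (hf : IsCb 𝕜 n f S) (hS : IsOpen S) (L : F →L[𝕜] G) :
    IsCb 𝕜 n (fun x => L (f x)) S := by
  refine ⟨L.contDiff.comp_contDiffOn hf.1, fun i hi hω => ?_⟩
  obtain ⟨M, hM⟩ := hf.2 i hi hω
  refine ⟨‖L‖ * M, fun x hx => ?_⟩
  exact (L.norm_iteratedFDeriv_comp_left (hf.1.contDiffAt (hS.mem_nhds hx)) hi).trans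
    (by gcongr; exact hM x hx)

lemma IsCb.bilinear {f : D → E} {g : D → F} {S : Set D} (B : E →L[𝕜] F →L[𝕜] G)
    (hf : IsCb 𝕜 n f S) (hg : IsCb 𝕜 n g S) (hS : IsOpen S) :
    IsCb 𝕜 n (fun x => B (f x) (g x)) S := by
  refine ⟨B.isBoundedBilinearMap.contDiff.comp_contDiffOn (hf.1.prodMk hg.1), fun i hi hω => ?_⟩
  obtain ⟨C, hC0, hC⟩ := hg.bound hi hω
  obtain ⟨M, hM0, hM⟩ := hf.bound hi hω
  refine ⟨‖B‖ * ∑ j ∈ Finset.range (i + 1), (i.choose j : ℝ) * M * C, fun x hx => ?_⟩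
  rw [← iteratedFDerivWithin_of_isOpen i hS hx]
  refine (B.norm_iteratedFDerivWithin_le_of_bilinear hf.1 hg.1 hS.uniqueDiffOn hx hi).trans ?_
  gcongr with j hj
  · rw [iteratedFDerivWithin_of_isOpen j hS hx]
    exact hM j (by simpa [Nat.lt_succ_iff] using hj) x hx
  · rw [iteratedFDerivWithin_of_isOpen (i - j) hS hx]
    exact hC (i - j) (by omega) x hx

lemma IsCb.isCb_fderiv {f : E → F} {j : ℕ} (hf : IsCb 𝕜 (j + 1 : ℕ) f S) (hS : IsOpen S) :
    IsCb 𝕜 j (fderiv 𝕜 f) S := by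
  refine ⟨((contDiffOn_succ_iff_fderiv_of_isOpen hS).1 (by simpa using hf.1)).2.2,
    fun i hi _ => ?_⟩
  have hi' : i ≤ j := by exact_mod_cast hi
  obtain ⟨M, hM⟩ := hf.2 (i + 1) (by exact_mod_cast Nat.succ_le_succ hi')
    fun h => absurd h (by exact_mod_cast WithTop.natCast_ne_top (j + 1))
  exact ⟨M, fun x hx => by rw [norm_iteratedFDeriv_fderiv]; exact hM x hx⟩

lemma isCb_succ {f : E → F} {j : ℕ} (hS : IsOpen S) (hf : DifferentiableOn 𝕜 f S)
    (hb : ∃ M : ℝ, ∀ x ∈ S, ‖f x‖ ≤ M) (hd : IsCb 𝕜 j (fderiv 𝕜 f) S) :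
    IsCb 𝕜 (j + 1 : ℕ) f S := by
  refine ⟨?_, fun i hi _ => ?_⟩
  · rw [Nat.cast_add, Nat.cast_one, contDiffOn_succ_iff_fderiv_of_isOpen hS]
    exact ⟨hf, fun h => absurd h (by simp), hd.1⟩
  · have hi' : i ≤ j + 1 := by exact_mod_cast hi
    rcases i with _ | i
    · simpa using hb
    · obtain ⟨M, hM⟩ := hd.2 i (by exact_mod_cast Nat.le_of_succ_le_succ hi')
        fun h => absurd h (by simp)
      exact ⟨M, fun x hx => by rw [← norm_iteratedFDeriv_fderiv]; exact hM x hx⟩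

lemma isCb_const (c : F) : IsCb 𝕜 n (fun _ : E => c) S := by
  refine ⟨contDiffOn_const, fun i _ _ => ?_⟩
  rcases i with _ | i
  · exact ⟨‖c‖, fun x _ => by simp⟩
  · exact ⟨0, fun x _ => by simp [iteratedFDeriv_const_of_ne (Nat.succ_ne_zero i)]⟩

lemma isCb_clm (L : E →L[𝕜] F) (hb : Bornology.IsBounded S) :
    IsCb 𝕜 n L S := by
  obtain ⟨R, hR⟩ := hb.exists_norm_le
  have hb' : ∃ M : ℝ, ∀ x ∈ S, ‖L x‖ ≤ M :=
    ⟨‖L‖ * R, fun x hx => (L.le_opNorm x).trans (by gcongr; exact hR x hx)⟩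
  refine ⟨L.contDiff.contDiffOn, fun i _ _ => ?_⟩
  rcases i with _ | i
  · simpa using hb'
  · obtain ⟨M, hM⟩ := (isCb_const (𝕜 := 𝕜) (n := (i : WithTop ℕ∞)) (E := E) (S := S) L).2 i le_rfl
      fun h => absurd h (by simp)
    refine ⟨M, fun x hx => ?_⟩
    rw [← norm_iteratedFDeriv_fderiv, show fderiv 𝕜 (L : E → F) = fun _ => L from
      funext fun y => L.fderiv]
    exact hM x hx

lemma IsCb.add {f g : E → F} (hf : IsCb 𝕜 n f S) (hg : IsCb 𝕜 n g S) (hS : IsOpen S) :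
    IsCb 𝕜 n (fun x => f x + g x) S := by
  refine ⟨hf.1.add hg.1, fun i hi hω => ?_⟩
  obtain ⟨M, hM⟩ := hf.2 i hi hω
  obtain ⟨C, hC⟩ := hg.2 i hi hω
  refine ⟨M + C, fun x hx => ?_⟩
  have h1 := (hf.1.contDiffAt (hS.mem_nhds hx)).of_le hi
  have h2 := (hg.1.contDiffAt (hS.mem_nhds hx)).of_le hi
  rw [fun_iteratedFDeriv_add_apply h1 h2]
  exact (norm_add_le _ _).trans (add_le_add (hM x hx) (hC x hx))

/-- A map that is `C^n` at a point is `C^n_b` near that point, for finite `n` or `n = ω`. -/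
lemma exists_isCb_of_contDiffAt {f : E → F} {x : E} (hn : n ≠ ∞)
    (hf : ContDiffAt 𝕜 n f x) : ∃ V : Set E, IsOpen V ∧ x ∈ V ∧ IsCb 𝕜 n f V := by
  obtain ⟨V, hV, hfV⟩ := hf.contDiffOn le_rfl (fun h => absurd h hn)
  have hb : ∀ i : ℕ, (i : WithTop ℕ∞) ≤ n → ∀ᶠ y in 𝓝 x,
      ‖iteratedFDeriv 𝕜 i f y‖ ≤ ‖iteratedFDeriv 𝕜 i f x‖ + 1 := fun i hi => by
    have : ContinuousAt (fun y => ‖iteratedFDeriv 𝕜 i f y‖) x :=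
      ((hf.iteratedFDeriv_right (m := 0) (i := i) (by simpa using hi)).continuousAt).norm
    exact (this.eventually (ge_mem_nhds (lt_add_one _)))
  have hfin : ∃ j : ℕ, ∀ i : ℕ, (i : WithTop ℕ∞) ≤ n → (n = ω → i = 0) → i < j := by
    rcases eq_or_ne n ω with rfl | hω
    · exact ⟨1, fun i _ h => by have := h rfl; omega⟩
    · lift n to ℕ∞ using hω
      have hn' : n ≠ ⊤ := fun h => hn (by rw [h])
      lift n to ℕ using hn'
      exact ⟨n + 1, fun i hi _ => by have : i ≤ n := by exact_mod_cast hi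
                                     omega⟩
  obtain ⟨j, hj⟩ := hfin
  have hall : ∀ᶠ y in 𝓝 x, ∀ i ∈ Finset.range j, (i : WithTop ℕ∞) ≤ n →
      ‖iteratedFDeriv 𝕜 i f y‖ ≤ ‖iteratedFDeriv 𝕜 i f x‖ + 1 := by
    rw [Filter.eventually_all_finset]
    intro i _
    by_cases hi : (i : WithTop ℕ∞) ≤ n
    · exact (hb i hi).mono fun _ h _ => h
    · exact Eventually.of_forall fun _ h => absurd h hi
  obtain ⟨W, hW, hWo, hxW⟩ := mem_nhds_iff.1 (inter_mem hV hall)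
  refine ⟨W, hWo, hxW, hfV.mono fun y hy => (hW hy).1, fun i hi hω => ⟨_, fun y hy =>
    (hW hy).2 i (Finset.mem_range.2 (hj i hi hω)) hi⟩⟩

end CbCalculus

section Inverse

variable {𝕜 : Type*} [NontriviallyNormedField 𝕜] {R : Type*} [NormedRing R] [NormedAlgebra 𝕜 R]
  [HasSummableGeomSeries R]

/-- The elements whose inverse exists and has norm less than `c`. -/
def boundedUnits (R : Type*) [NormedRing R] (c : ℝ) : Set R := {T | IsUnit T ∧ ‖Ring.inverse T‖ < c}

lemma isOpen_boundedUnits (c : ℝ) : IsOpen (boundedUnits R c) := by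
  rw [isOpen_iff_mem_nhds]
  rintro T ⟨⟨u, rfl⟩, h⟩
  have h1 : ∀ᶠ T in 𝓝 (u : R), IsUnit T := Units.isOpen.mem_nhds u.isUnit
  have h2 := (NormedRing.inverse_continuousAt u).norm.eventually (gt_mem_nhds h)
  exact h1.and h2

variable (𝕜) in
/-- Inversion has bounded derivatives of all orders where the inverses are bounded: its derivative
is a quadratic expression in the inverse. -/
lemma isCb_ringInverse (c : ℝ) (j : ℕ) : IsCb 𝕜 j (Ring.inverse : R → R) (boundedUnits R c) := by
  have ho := isOpen_boundedUnits (R := R) c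
  have hb : ∃ M : ℝ, ∀ x ∈ boundedUnits R c, ‖Ring.inverse x‖ ≤ M := ⟨c, fun x hx => hx.2.le⟩
  have hd : DifferentiableOn 𝕜 (Ring.inverse : R → R) (boundedUnits R c) := by
    rintro T ⟨⟨u, rfl⟩, -⟩
    exact (hasFDerivAt_ringInverse (𝕜 := 𝕜) u).differentiableAt.differentiableWithinAt
  induction j with
  | zero =>
    refine ⟨by simpa [contDiffOn_zero] using hd.continuousOn, fun i hi _ => ?_⟩
    obtain rfl : i = 0 := by simpa using hi
    simpa using hb
  | succ j ih =>
    refine isCb_succ ho hd hb ?_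
    have := ih.bilinear (-ContinuousLinearMap.mulLeftRight 𝕜 R) ih ho
    refine this.congr ho ?_
    rintro T ⟨⟨u, rfl⟩, -⟩
    rw [(hasFDerivAt_ringInverse (𝕜 := 𝕜) u).fderiv]
    simp

end Inverse

section InverseMap

variable {𝕜 : Type*} [RCLike 𝕜]
  {E : Type*} [NormedAddCommGroup E] [NormedSpace 𝕜 E] {n : WithTop ℕ∞}

lemma hasFDerivAt_symm_of_boundedUnits (θ : OpenPartialHomeomorph E E) {y : E} {c : ℝ}
    (hd : DifferentiableAt 𝕜 θ (θ.symm y)) (hy : y ∈ θ.target)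
    (hc : fderiv 𝕜 θ (θ.symm y) ∈ boundedUnits (E →L[𝕜] E) c) :
    HasFDerivAt θ.symm (Ring.inverse (fderiv 𝕜 θ (θ.symm y))) y := by
  obtain ⟨u, hu⟩ := hc.1
  have : HasFDerivAt θ ((ContinuousLinearEquiv.unitsEquiv 𝕜 E u : E ≃L[𝕜] E) : E →L[𝕜] E)
      (θ.symm y) := by
    have h : ((ContinuousLinearEquiv.unitsEquiv 𝕜 E u : E ≃L[𝕜] E) : E →L[𝕜] E) = u := by
      ext; rfl
    rw [h, hu]
    exact hd.hasFDerivAt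
  have h2 := θ.hasFDerivAt_symm hy this
  rw [← hu, Ring.inverse_unit]
  convert h2 using 1
  ext; rfl

/-- The inverse of a local `C^n_b` diffeomorphism with bounded inverse derivatives and bounded
source is `C^n_b`: the derivative of the inverse is `y ↦ (Dθ (θ⁻¹ y))⁻¹`, which transports bounds
of order `j` to bounds of order `j + 1`. -/
lemma IsCb.symm [CompleteSpace E] {θ : OpenPartialHomeomorph E E}
    (hθ : IsCb 𝕜 n θ θ.source) (hn : 1 ≤ n) {c : ℝ} (hb : Bornology.IsBounded θ.source)
    (hc : ∀ x ∈ θ.source, fderiv 𝕜 θ x ∈ boundedUnits (E →L[𝕜] E) c) :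
    IsCb 𝕜 n θ.symm θ.target := by
  have hn0 : n ≠ 0 := fun h => by simp [h] at hn
  have hdiff : ∀ y ∈ θ.target, DifferentiableAt 𝕜 θ (θ.symm y) := fun y hy =>
    (hθ.1.contDiffAt (θ.open_source.mem_nhds (θ.map_target hy))).differentiableAt hn0
  have hder : ∀ y ∈ θ.target, HasFDerivAt θ.symm (Ring.inverse (fderiv 𝕜 θ (θ.symm y))) y :=
    fun y hy => hasFDerivAt_symm_of_boundedUnits θ (hdiff y hy) hy (hc _ (θ.map_target hy))
  have hb' : ∃ M : ℝ, ∀ y ∈ θ.target, ‖θ.symm y‖ ≤ M := by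
    obtain ⟨R, hR⟩ := hb.exists_norm_le
    exact ⟨R, fun y hy => hR _ (θ.map_target hy)⟩
  have hfin : ∀ j : ℕ, (j : WithTop ℕ∞) ≤ n → n ≠ ω → IsCb 𝕜 j θ.symm θ.target := by
    intro j
    induction j with
    | zero =>
      intro _ _
      refine ⟨by simpa [contDiffOn_zero] using θ.continuousOn_symm, fun i hi _ => ?_⟩
      obtain rfl : i = 0 := by simpa using hi
      simpa using hb'
    | succ j ih =>
      intro hj hω
      have hj' : (j : WithTop ℕ∞) ≤ n := le_trans (by exact_mod_cast Nat.le_succ j) hj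
      refine isCb_succ θ.open_target
        (fun y hy => (hder y hy).differentiableAt.differentiableWithinAt) hb' ?_
      have h1 : IsCb 𝕜 j (fderiv 𝕜 θ) θ.source :=
        (hθ.of_le hj fun h => absurd h hω).isCb_fderiv θ.open_source
      have h2 := h1.comp θ.open_source (ih hj' hω) θ.open_target fun y hy => θ.map_target hy
      have h3 := (isCb_ringInverse 𝕜 (R := E →L[𝕜] E) c j).comp (isOpen_boundedUnits c) h2
        θ.open_target fun y hy => hc _ (θ.map_target hy)
      exact h3.congr θ.open_target fun y hy => (hder y hy).fderiv
  rcases eq_or_ne n ω with rfl | hω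
  · refine ⟨fun y hy => ContDiffAt.contDiffWithinAt ?_, fun i _ hi => ?_⟩
    · obtain ⟨u, hu⟩ := (hc _ (θ.map_target hy)).1
      refine θ.contDiffAt_symm (f₀' := ContinuousLinearEquiv.unitsEquiv 𝕜 E u) hy ?_
        (hθ.1.contDiffAt (θ.open_source.mem_nhds (θ.map_target hy)))
      have h : ((ContinuousLinearEquiv.unitsEquiv 𝕜 E u : E ≃L[𝕜] E) : E →L[𝕜] E) = u := by
        ext; rfl
      rw [h, hu]
      exact (hdiff y hy).hasFDerivAt
    · obtain rfl := hi rfl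
      simpa using hb'
  · exact isCb_of_forall_nat hω fun j hj => hfin j hj hω

end InverseMap

end InvFoliation

namespace InvFoliation
open Set Filter Topology Asymptotics

universe v

/-! ### Taylor expansions -/

section Taylor

variable {𝕜 : Type*} [RCLike 𝕜] {E : Type v} [NormedAddCommGroup E] [NormedSpace 𝕜 E]

lemma isBigO_diag {F : Type*} [NormedAddCommGroup F] [NormedSpace 𝕜 F] {n : ℕ}
    (R : E [×n]→L[𝕜] F) (l : Filter E) : (fun x => R fun _ => x) =O[l] fun x => ‖x‖ ^ n := by
  refine IsBigO.of_bound ‖R‖ (Eventually.of_forall fun x => ?_)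
  simpa using R.le_opNorm fun _ => x

lemma isBigO_norm_pow {m n : ℕ} (h : m ≤ n) :
    (fun x : E => ‖x‖ ^ n) =O[𝓝 0] fun x => ‖x‖ ^ m := by
  refine IsBigO.of_bound 1 ?_
  filter_upwards [Metric.ball_mem_nhds (0 : E) one_pos] with x hx
  rw [mem_ball_zero_iff] at hx
  simpa using pow_le_pow_of_le_one (norm_nonneg x) hx.le h

lemma isLittleO_norm_pow {m n : ℕ} (h : m < n) :
    (fun x : E => ‖x‖ ^ n) =o[𝓝 0] fun x => ‖x‖ ^ m := by
  have h1 : (fun x : E => ‖x‖) =o[𝓝 0] fun _ => (1 : ℝ) := by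
    rw [isLittleO_one_iff]
    exact tendsto_norm_zero
  have h2 : (fun x : E => ‖x‖ ^ (m + 1)) =o[𝓝 0] fun x => ‖x‖ ^ m := by
    simpa [pow_succ] using (isBigO_refl (fun x : E => ‖x‖ ^ m) (𝓝 0)).mul_isLittleO h1
  exact (isBigO_norm_pow h).trans_isLittleO h2

/-- A map that is homogeneous of degree `n` and `o(‖x‖ ^ n)` vanishes. -/
lemma eq_zero_of_homogeneous_isLittleO {F : Type*} [NormedAddCommGroup F] [NormedSpace 𝕜 F]
    {n : ℕ} {h : E → F} (hh : ∀ (t : 𝕜) x, h (t • x) = t ^ n • h x)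
    (ho : h =o[𝓝 0] fun x => ‖x‖ ^ n) (x : E) : h x = 0 := by
  rw [← norm_le_zero_iff]
  refine le_of_forall_pos_le_add fun ε hε => ?_
  have hc : 0 < ε / (‖x‖ ^ n + 1) := by positivity
  have h1 := isLittleO_iff.1 ho hc
  have h2 : Tendsto (fun t : 𝕜 => t • x) (𝓝[≠] 0) (𝓝 0) := by
    have : Tendsto (fun t : 𝕜 => t • x) (𝓝 0) (𝓝 ((0 : 𝕜) • x)) :=
      (continuous_id.smul continuous_const).tendsto 0
    rw [zero_smul] at this
    exact this.mono_left nhdsWithin_le_nhds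
  obtain ⟨t, ht, ht0⟩ := ((h2.eventually h1).and self_mem_nhdsWithin).exists
  have ht0 : 0 < ‖t‖ ^ n := by
    have : t ≠ 0 := ht0
    positivity
  rw [hh, norm_smul, norm_pow, norm_smul, norm_pow, Real.norm_eq_abs] at ht
  have h3 : ‖h x‖ ≤ ε / (‖x‖ ^ n + 1) * ‖x‖ ^ n := by
    refine le_of_mul_le_mul_left ?_ ht0
    rw [abs_of_nonneg (by positivity), mul_pow] at ht
    linarith [ht]
  refine h3.trans ?_
  rw [zero_add, div_mul_eq_mul_div, div_le_iff₀ (by positivity)]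
  nlinarith

lemma diag_smul {F : Type*} [NormedAddCommGroup F] [NormedSpace 𝕜 F] {n : ℕ}
    (R : E [×n]→L[𝕜] F) (t : 𝕜) (x : E) : (R fun _ => t • x) = t ^ n • R fun _ => x := by
  have := R.map_smul_univ (fun _ => t) (fun _ => x)
  simpa using this

/-- The homogeneous components of a polynomial of degree `n` that is `o(‖x‖ ^ n)` vanish. -/
lemma diag_eq_zero_of_sum_isLittleO {F : Type*} [NormedAddCommGroup F] [NormedSpace 𝕜 F]
    (R : FormalMultilinearSeries 𝕜 E F) (n : ℕ)
    (h : (fun x => ∑ i ∈ Finset.range (n + 1), R i fun _ => x) =o[𝓝 0] fun x => ‖x‖ ^ n) :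
    ∀ i ≤ n, ∀ x, (R i fun _ => x) = 0 := by
  induction n with
  | zero =>
    intro i hi x
    obtain rfl : i = 0 := by omega
    refine eq_zero_of_homogeneous_isLittleO (h := fun x => R 0 fun _ => x) (n := 0)
      (fun t x => diag_smul (R 0) t x) ?_ x
    simpa using h
  | succ n ih =>
    have h1 : (fun x => ∑ i ∈ Finset.range (n + 1), R i fun _ => x) =o[𝓝 0] fun x => ‖x‖ ^ n := by
      have h2 := h.trans (isLittleO_norm_pow (E := E) (Nat.lt_succ_self n))
      have h3 := (isBigO_diag (R (n + 1)) (𝓝 0)).trans_isLittleO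
        (isLittleO_norm_pow (E := E) (Nat.lt_succ_self n))
      refine (h2.sub h3).congr_left fun x => ?_
      rw [Finset.sum_range_succ _ (n + 1), add_sub_cancel_right]
    have h4 := ih h1
    have h5 : ∀ x, (R (n + 1) fun _ => x) = 0 := by
      refine eq_zero_of_homogeneous_isLittleO (n := n + 1) (fun t x => diag_smul (R (n + 1)) t x) ?_
      refine h.congr_left fun x => ?_
      rw [Finset.sum_range_succ, Finset.sum_eq_zero, zero_add]
      exact fun i hi => h4 i (by simpa [Nat.lt_succ_iff] using hi) x
    intro i hi x
    rcases Nat.lt_or_ge n i with hni | hni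
    · obtain rfl : i = n + 1 := by omega
      exact h5 x
    · exact h4 i hni x

/-- Taylor's theorem with Peano remainder for a map of class `C^n`. -/
lemma exists_taylor (n : ℕ) : ∀ {F : Type v} [NormedAddCommGroup F] [NormedSpace 𝕜 F] {q : E → F},
    ContDiffAt 𝕜 n q 0 → ∃ R : FormalMultilinearSeries 𝕜 E F,
      (fun x => q x - ∑ i ∈ Finset.range (n + 1), R i fun _ => x) =o[𝓝 0] fun x => ‖x‖ ^ n := by
  induction n with
  | zero =>
    intro F _ _ q hq
    refine ⟨fun i => if h : i = 0 then
      ContinuousMultilinearMap.constOfIsEmpty 𝕜 (fun _ => E) (q 0) |>.domDomCongr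
        (Equiv.equivOfIsEmpty (Fin 0) (Fin 0)) |> fun R => h ▸ R else 0, ?_⟩
    simp only [zero_add, Finset.range_one, Finset.sum_singleton, dite_true, pow_zero,
      isLittleO_one_iff]
    have := hq.continuousAt.tendsto.sub_const (q 0)
    simpa using this
  | succ n ih =>
    intro F _ _ q hq
    have hd : ∀ᶠ x in 𝓝 (0 : E), DifferentiableAt 𝕜 q x := by
      have := hq.eventually (by simp)
      exact this.mono fun x hx => hx.differentiableAt (by simp)
    obtain ⟨R', hR'⟩ := ih (q := fderiv 𝕜 q) (hq.fderiv_right (m := n) (by simp))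
    let R : FormalMultilinearSeries 𝕜 E F := fun i => match i with
      | 0 => ContinuousMultilinearMap.constOfIsEmpty 𝕜 (fun _ => E) (q 0)
      | i + 1 => ((i + 1 : ℕ) : 𝕜)⁻¹ • (R' i).uncurryRight
    have hRs : ∀ i x, (R (i + 1) fun _ => x) = ((i + 1 : ℕ) : 𝕜)⁻¹ • (R' i fun _ => x) x := by
      intro i x
      simp only [R, _root_.smul_apply, ContinuousMultilinearMap.uncurryRight_apply]
      rfl
    refine ⟨R, isLittleO_iff.2 fun ε hε => ?_⟩
    have h1 := isLittleO_iff.1 hR' hε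
    obtain ⟨δ, hδ, hball⟩ := Metric.eventually_nhds_iff_ball.1 (hd.and h1)
    filter_upwards [Metric.ball_mem_nhds (0 : E) hδ] with x hx
    rw [mem_ball_zero_iff] at hx
    set φ : 𝕜 → F := fun t => q (t • x) - ∑ i ∈ Finset.range (n + 1),
      t ^ (i + 1) • R (i + 1) fun _ => x with hφ
    set φ' : 𝕜 → F := fun t => (fderiv 𝕜 q (t • x) - ∑ i ∈ Finset.range (n + 1),
      R' i fun _ => t • x) x with hφ'
    have htx : ∀ t ∈ Metric.closedBall (0 : 𝕜) 1, ‖t • x‖ ≤ ‖x‖ := fun t ht => by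
      rw [norm_smul]
      exact mul_le_of_le_one_left (norm_nonneg _) (by simpa using ht)
    have hder : ∀ t ∈ Metric.closedBall (0 : 𝕜) 1,
        HasDerivWithinAt φ (φ' t) (Metric.closedBall 0 1) t := by
      intro t ht
      have hb := (hball (t • x) (by simpa using (htx t ht).trans_lt hx)).1
      have e1 : HasDerivAt (fun t : 𝕜 => q (t • x)) (fderiv 𝕜 q (t • x) x) t := by
        have h2 : HasDerivAt (fun t : 𝕜 => t • x) ((1 : 𝕜) • x) t :=
          (hasDerivAt_id t).smul_const x
        rw [one_smul] at h2
        exact hb.hasFDerivAt.comp_hasDerivAt t h2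
      have e2 : HasDerivAt (fun t : 𝕜 => ∑ i ∈ Finset.range (n + 1),
          t ^ (i + 1) • R (i + 1) fun _ => x)
          (∑ i ∈ Finset.range (n + 1), (((i + 1 : ℕ) : 𝕜) * t ^ i) • R (i + 1) fun _ => x) t := by
        refine HasDerivAt.fun_sum fun i _ => ?_
        have := (hasDerivAt_pow (i + 1) t).smul_const (R (i + 1) fun _ => x)
        simpa using this
      have e3 := (e1.sub e2).hasDerivWithinAt (s := Metric.closedBall (0 : 𝕜) 1)
      convert e3 using 1
      · rfl
      simp only [hφ', _root_.sub_apply, _root_.sum_apply]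
      congr 1
      refine Finset.sum_congr rfl fun i _ => ?_
      have hi : ((i + 1 : ℕ) : 𝕜) ≠ 0 := Nat.cast_ne_zero.2 (Nat.succ_ne_zero i)
      rw [hRs, smul_smul, mul_right_comm, mul_inv_cancel₀ hi, one_mul, diag_smul]
      rfl
    have hbd : ∀ t ∈ Metric.closedBall (0 : 𝕜) 1, ‖φ' t‖ ≤ ε * ‖x‖ ^ (n + 1) := by
      intro t ht
      have hb := (hball (t • x) (by simpa using (htx t ht).trans_lt hx)).2
      rw [norm_pow, norm_norm] at hb
      calc ‖φ' t‖ ≤ _ * ‖x‖ := ContinuousLinearMap.le_opNorm _ _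
        _ ≤ (ε * ‖t • x‖ ^ n) * ‖x‖ := by gcongr
        _ ≤ (ε * ‖x‖ ^ n) * ‖x‖ := by gcongr; exact htx t ht
        _ = ε * ‖x‖ ^ (n + 1) := by ring
    have hmv := Convex.norm_image_sub_le_of_norm_hasDerivWithin_le hder hbd
      (convex_closedBall (0 : 𝕜) 1) (by simp : (0 : 𝕜) ∈ Metric.closedBall (0 : 𝕜) 1)
      (by simp : (1 : 𝕜) ∈ Metric.closedBall (0 : 𝕜) 1)
    have h0 : (R 0 fun _ => x) = q 0 := rfl
    have e0 : φ 1 - φ 0 = q x - ∑ i ∈ Finset.range (n + 1 + 1), R i fun _ => x := by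
      rw [Finset.sum_range_succ', h0]
      simp only [hφ, one_smul, one_pow, zero_smul, zero_pow (Nat.succ_ne_zero _),
        Finset.sum_const_zero, sub_zero]
      abel
    rw [e0] at hmv
    simpa using hmv

variable {F : Type v} [NormedAddCommGroup F] [NormedSpace 𝕜 F]

/-- The leading Taylor term of a `C^{n+1}` map that is `o(‖x‖ ^ n)`. -/
lemma exists_leading_term {n : ℕ} {q : E → F} (hq : ContDiffAt 𝕜 (n + 1 : ℕ) q 0)
    (ho : q =o[𝓝 0] fun x => ‖x‖ ^ n) : ∃ R : E [×(n + 1)]→L[𝕜] F,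
      (fun x => q x - R fun _ => x) =o[𝓝 0] fun x => ‖x‖ ^ (n + 1) := by
  obtain ⟨R, hR⟩ := exists_taylor (n + 1) hq
  have h1 := hR.trans (isLittleO_norm_pow (E := E) (Nat.lt_succ_self n))
  have h2 := (isBigO_diag (R (n + 1)) (𝓝 0)).trans_isLittleO
    (isLittleO_norm_pow (E := E) (Nat.lt_succ_self n))
  have h3 : (fun x => ∑ i ∈ Finset.range (n + 1), R i fun _ => x) =o[𝓝 0] fun x => ‖x‖ ^ n := by
    refine ((ho.sub h1).sub h2).congr_left fun x => ?_
    rw [Finset.sum_range_succ _ (n + 1)]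
    abel
  have h4 := diag_eq_zero_of_sum_isLittleO R n h3
  refine ⟨R (n + 1), hR.congr_left fun x => ?_⟩
  rw [Finset.sum_range_succ, Finset.sum_eq_zero, zero_add]
  exact fun i hi => h4 i (by simpa [Nat.lt_succ_iff] using hi) x

lemma isBigO_of_isLittleO_pow {n : ℕ} {q : E → F} (hq : ContDiffAt 𝕜 (n + 1 : ℕ) q 0)
    (ho : q =o[𝓝 0] fun x => ‖x‖ ^ n) : q =O[𝓝 0] fun x => ‖x‖ ^ (n + 1) := by
  obtain ⟨R, hR⟩ := exists_leading_term hq ho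
  simpa using hR.isBigO.add (isBigO_diag R (𝓝 0))

/-- The order of vanishing drops by one under differentiation. If `Dq = R(x, …, x) + o(‖x‖^m)`,
then the rescalings `y ↦ t^{-m-1} q(t y)` tend to `0`, and their derivatives tend locally uniformly
to `R(y, …, y)`, which therefore vanishes. -/
lemma fderiv_isLittleO {m : ℕ} {q : E → F} (hq : ContDiffAt 𝕜 (m + 1 : ℕ) q 0)
    (ho : q =o[𝓝 0] fun x => ‖x‖ ^ (m + 1)) : fderiv 𝕜 q =o[𝓝 0] fun x => ‖x‖ ^ m := by
  induction m with
  | zero =>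
    have h0 : HasFDerivAt q (0 : E →L[𝕜] F) 0 := by
      have hq0 : q 0 = 0 := by
        have := (isLittleO_iff.1 ho one_pos).self_of_nhds
        simpa using this
      rw [hasFDerivAt_iff_isLittleO_nhds_zero]
      simpa [hq0] using (ho.congr_right (g₂ := fun x : E => ‖x‖) (by simp)).of_norm_right
    have hc : ContinuousAt (fderiv 𝕜 q) 0 :=
      (hq.fderiv_right (m := 0) (by simp)).continuousAt
    simp only [pow_zero, isLittleO_one_iff]
    have := hc.tendsto
    rwa [h0.fderiv] at this
  | succ k ih =>
    have h1 := ih (hq.of_le (by exact_mod_cast Nat.le_succ _))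
      (ho.trans (isLittleO_norm_pow (Nat.lt_succ_self _)))
    obtain ⟨R, hR⟩ := exists_leading_term (n := k) (q := fderiv 𝕜 q)
      (hq.fderiv_right (by simp)) h1
    have hd : ∀ᶠ x in 𝓝 (0 : E), DifferentiableAt 𝕜 q x := by
      have := hq.eventually (by simp)
      exact this.mono fun x hx => hx.differentiableAt (by simp)
    have hRz : ∀ x, (R fun _ => x) = 0 := by
      intro x
      set l : Filter 𝕜 := 𝓝[≠] 0
      have hsc : ∀ y : E, Tendsto (fun t : 𝕜 => t • y) l (𝓝 0) := fun y => by
        have : Tendsto (fun t : 𝕜 => t • y) (𝓝 0) (𝓝 ((0 : 𝕜) • y)) :=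
          (continuous_id.smul continuous_const).tendsto 0
        rw [zero_smul] at this
        exact this.mono_left nhdsWithin_le_nhds
      have hsc2 : Tendsto (fun p : 𝕜 × E => p.1 • p.2) (l ×ˢ 𝓝 x) (𝓝 0) := by
        have : Tendsto (fun p : 𝕜 × E => p.1 • p.2) (𝓝 ((0 : 𝕜), x)) (𝓝 ((0 : 𝕜) • x)) :=
          (continuous_fst.smul continuous_snd).tendsto _
        rw [zero_smul, nhds_prod_eq] at this
        exact this.mono_left (Filter.prod_mono nhdsWithin_le_nhds le_rfl)
      have hne : ∀ᶠ p : 𝕜 × E in l ×ˢ 𝓝 x, p.1 ≠ 0 :=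
        (tendsto_fst (f := l) (g := 𝓝 x)).eventually self_mem_nhdsWithin
      have hder : HasFDerivAt (fun _ : E => (0 : F)) (R fun _ => x) x := by
        refine hasFDerivAt_of_tendstoUniformlyOnFilter (𝕜 := 𝕜) (l := l)
          (f := fun t y => (t ^ (k + 2))⁻¹ • q (t • y))
          (f' := fun t y => (t ^ (k + 1))⁻¹ • fderiv 𝕜 q (t • y))
          (g' := fun y => R fun _ => y) ?_ ?_ ?_
        · rw [Metric.tendstoUniformlyOnFilter_iff]
          intro ε hε
          have hb : ∀ᶠ p : 𝕜 × E in l ×ˢ 𝓝 x, ‖p.2‖ < ‖x‖ + 1 :=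
            (tendsto_snd (f := l) (g := 𝓝 x)).eventually
              (continuous_norm.continuousAt.eventually (gt_mem_nhds (lt_add_one _)))
          have hc : 0 < ε / (2 * (‖x‖ + 1) ^ (k + 1)) := by positivity
          filter_upwards [hsc2.eventually (isLittleO_iff.1 hR hc), hne, hb] with p hp hp0 hpb
          have hp0' : p.1 ^ (k + 1) ≠ 0 := pow_ne_zero _ hp0
          rw [diag_smul, norm_pow, norm_norm, norm_smul, mul_pow] at hp
          have e1 : (p.1 ^ (k + 1))⁻¹ • fderiv 𝕜 q (p.1 • p.2) - (R fun _ => p.2) =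
              (p.1 ^ (k + 1))⁻¹ • (fderiv 𝕜 q (p.1 • p.2) - p.1 ^ (k + 1) • R fun _ => p.2) := by
            rw [smul_sub, smul_smul, inv_mul_cancel₀ hp0', one_smul]
          rw [dist_comm, dist_eq_norm, e1, norm_smul, norm_inv, norm_pow]
          have hpos : 0 < ‖p.1‖ ^ (k + 1) := by positivity
          calc (‖p.1‖ ^ (k + 1))⁻¹ * ‖fderiv 𝕜 q (p.1 • p.2) - p.1 ^ (k + 1) • R fun _ => p.2‖
              ≤ (‖p.1‖ ^ (k + 1))⁻¹ * (ε / (2 * (‖x‖ + 1) ^ (k + 1)) *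
                (‖p.1‖ ^ (k + 1) * ‖p.2‖ ^ (k + 1))) := by gcongr
            _ = ε / (2 * (‖x‖ + 1) ^ (k + 1)) * ‖p.2‖ ^ (k + 1) := by field_simp
            _ ≤ ε / (2 * (‖x‖ + 1) ^ (k + 1)) * (‖x‖ + 1) ^ (k + 1) := by gcongr
            _ = ε / 2 := by field_simp
            _ < ε := half_lt_self hε
        · filter_upwards [hsc2.eventually hd, hne] with p hp hp0
          have h2 : HasFDerivAt (fun y : E => p.1 • y) (p.1 • ContinuousLinearMap.id 𝕜 E) p.2 :=
            (hasFDerivAt_id p.2).const_smul p.1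
          have h3 := (hp.hasFDerivAt.comp p.2 h2).const_smul ((p.1 ^ (k + 2))⁻¹)
          convert h3 using 1
          · rfl
          ext v
          simp only [_root_.smul_apply, ContinuousLinearMap.comp_apply,
            ContinuousLinearMap.id_apply, map_smul, smul_smul]
          congr 1
          field_simp
          ring
        · refine Eventually.of_forall fun y => ?_
          rw [Metric.tendsto_nhds]
          intro ε hε
          have hc : 0 < ε / (2 * (‖y‖ + 1) ^ (k + 2)) := by positivity
          filter_upwards [(hsc y).eventually (isLittleO_iff.1 ho hc), self_mem_nhdsWithin]
            with t ht ht0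
          have ht0' : t ≠ 0 := ht0
          rw [norm_pow, norm_norm, norm_smul, mul_pow] at ht
          rw [dist_zero_right, norm_smul, norm_inv, norm_pow]
          have hpos : 0 < ‖t‖ ^ (k + 2) := by positivity
          calc (‖t‖ ^ (k + 2))⁻¹ * ‖q (t • y)‖
              ≤ (‖t‖ ^ (k + 2))⁻¹ * (ε / (2 * (‖y‖ + 1) ^ (k + 2)) *
                (‖t‖ ^ (k + 2) * ‖y‖ ^ (k + 2))) := by gcongr
            _ = ε / (2 * (‖y‖ + 1) ^ (k + 2)) * ‖y‖ ^ (k + 2) := by field_simp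
            _ ≤ ε / (2 * (‖y‖ + 1) ^ (k + 2)) * (‖y‖ + 1) ^ (k + 2) := by gcongr; linarith
            _ = ε / 2 := by field_simp
            _ < ε := half_lt_self hε
      exact hder.unique (hasFDerivAt_const _ _)
    simpa [hRz] using hR

lemma fderiv_isBigO {m : ℕ} {q : E → F} (hq : ContDiffAt 𝕜 (m + 1 : ℕ) q 0)
    (ho : q =O[𝓝 0] fun x => ‖x‖ ^ (m + 1)) : fderiv 𝕜 q =O[𝓝 0] fun x => ‖x‖ ^ m := by
  rcases m with _ | m
  · simp only [pow_zero]
    exact ((hq.fderiv_right (m := 0) (by simp)).continuousAt.norm).isBoundedUnder_le.isBigO_one ℝ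
  · refine isBigO_of_isLittleO_pow (hq.fderiv_right (by simp)) ?_
    exact fderiv_isLittleO (hq.of_le (by exact_mod_cast Nat.le_succ _))
      (ho.trans_isLittleO (isLittleO_norm_pow (Nat.lt_succ_self _)))

/-- Polarization: the symmetrization of a multilinear map is determined by its diagonal. -/
lemma sum_perm_eq_zero_of_diag_eq_zero {n : ℕ} (R : E [×n]→L[𝕜] F)
    (h : ∀ x, (R fun _ => x) = 0) (v : Fin n → E) :
    ∑ σ : Equiv.Perm (Fin n), R (fun i => v (σ i)) = 0 := by
  let p : FormalMultilinearSeries 𝕜 E F := fun i => if h : i = n then h ▸ R else 0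
  have hpn : p n = R := by simp [p]
  have hp0 : ∀ i, i ≠ n → p i = 0 := fun i hi => by simp [p, hi]
  have hp : HasFPowerSeriesOnBall (fun _ : E => (0 : F)) p 0 ⊤ := by
    refine ⟨?_, by simp, fun {y} _ => ?_⟩
    · rw [p.radius_eq_top_of_forall_image_add_eq_zero (n + 1) fun m => hp0 _ (by omega)]
    · have : (fun i => p i fun _ => y) = fun _ => 0 := by
        funext i
        rcases eq_or_ne i n with rfl | hi
        · rw [hpn, h]
        · rw [hp0 i hi]; rfl
      rw [this]
      exact hasSum_zero
  have h1 := hp.iteratedFDeriv_eq_sum analyticOn_const v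
  rw [hpn] at h1
  rw [← h1]
  rcases n with _ | n
  · simp
  · rw [iteratedFDeriv_const_of_ne (Nat.succ_ne_zero n)]; simp

end Taylor

end InvFoliation

namespace InvFoliation
open Set Filter Topology Asymptotics
open scoped BoundedContinuousFunction

universe v

/-! ### Superposition operators on bounded sequences -/

section Sequences

variable {𝕜 : Type*} [RCLike 𝕜] {E : Type v} [NormedAddCommGroup E] [NormedSpace 𝕜 E]
  {F : Type v} [NormedAddCommGroup F] [NormedSpace 𝕜 F]
  {G : Type v} [NormedAddCommGroup G] [NormedSpace 𝕜 G]

open Classical in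
/-- The bounded sequence with terms `s j`, as an element of `ℓ^∞` (which is modelled by the bounded
continuous functions on `ℕ`). The value is `0` if `s` is not bounded. -/
noncomputable def boundedSeq (s : ℕ → F) : ℕ →ᵇ F :=
  if h : ∃ C, ∀ j, ‖s j‖ ≤ C then
    BoundedContinuousFunction.ofNormedAddCommGroupDiscrete s h.choose h.choose_spec
  else 0

omit [NormedSpace 𝕜 F] in
lemma boundedSeq_apply {s : ℕ → F} (h : ∃ C, ∀ j, ‖s j‖ ≤ C) (j : ℕ) : boundedSeq s j = s j := by
  rw [boundedSeq, dif_pos h]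
  rfl

lemma norm_boundedSeq_le {s : ℕ → F} {C : ℝ} (hC : 0 ≤ C) (h : ∀ j, ‖s j‖ ≤ C) :
    ‖boundedSeq s‖ ≤ C :=
  (BoundedContinuousFunction.norm_le hC).2 fun j => by rw [boundedSeq_apply ⟨C, h⟩]; exact h j

lemma exists_bound_of_eventually {s : ℕ → F} {C : ℝ} (h : ∀ᶠ j in atTop, ‖s j‖ ≤ C) :
    ∃ C, ∀ j, ‖s j‖ ≤ C := by
  obtain ⟨J, hJ⟩ := eventually_atTop.1 h
  refine ⟨|C| + ∑ i ∈ Finset.range J, ‖s i‖, fun j => ?_⟩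
  have h0 : 0 ≤ ∑ i ∈ Finset.range J, ‖s i‖ := Finset.sum_nonneg fun _ _ => norm_nonneg _
  rcases lt_or_ge j J with hj | hj
  · have := Finset.single_le_sum (f := fun i => ‖s i‖) (fun _ _ => norm_nonneg _)
      (Finset.mem_range.2 hj)
    linarith [abs_nonneg C]
  · linarith [hJ j hj, le_abs_self C]

variable (𝕜 E F) in
/-- A bounded sequence of operators acts on bounded sequences term by term. -/
noncomputable def seqApply : (ℕ →ᵇ (E →L[𝕜] F)) →L[𝕜] (ℕ →ᵇ E) →L[𝕜] (ℕ →ᵇ F) := by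
  have hb : ∀ (T : ℕ →ᵇ (E →L[𝕜] F)) (z : ℕ →ᵇ E) j, ‖T j (z j)‖ ≤ 1 * ‖T‖ * ‖z‖ := fun T z j => by
    rw [one_mul]
    exact (T j).le_opNorm_of_le (z.norm_coe_le_norm j) |>.trans
      (by gcongr; exact T.norm_coe_le_norm j)
  have ha : ∀ (T : ℕ →ᵇ (E →L[𝕜] F)) (z : ℕ →ᵇ E) j,
      boundedSeq (fun j => T j (z j)) j = T j (z j) := fun T z j => boundedSeq_apply ⟨_, hb T z⟩ j
  exact LinearMap.mkContinuous₂ (LinearMap.mk₂ 𝕜 (fun T z => boundedSeq fun j => T j (z j))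
    (fun T T' z => by ext j; exact (ha _ _ j).trans (by simp [ha]))
    (fun c T z => by ext j; exact (ha _ _ j).trans (by simp [ha]))
    (fun T z z' => by ext j; exact (ha _ _ j).trans (by simp [ha]))
    (fun c T z => by ext j; exact (ha _ _ j).trans (by simp [ha]))) 1
    fun T z => norm_boundedSeq_le (by positivity) (hb T z)

lemma seqApply_apply (T : ℕ →ᵇ (E →L[𝕜] F)) (z : ℕ →ᵇ E) (j : ℕ) :
    seqApply 𝕜 E F T z j = T j (z j) := by
  refine boundedSeq_apply ⟨‖T‖ * ‖z‖, fun j => ?_⟩ j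
  exact (T j).le_opNorm_of_le (z.norm_coe_le_norm j) |>.trans
      (by gcongr; exact T.norm_coe_le_norm j)

lemma contDiff_seqApply {n : WithTop ℕ∞} :
    ContDiff 𝕜 n (seqApply 𝕜 E F : (ℕ →ᵇ (E →L[𝕜] F)) → (ℕ →ᵇ E) →L[𝕜] (ℕ →ᵇ F)) := by
  exact ContinuousLinearMap.contDiff (𝕜 := 𝕜) (n := n) (E := ℕ →ᵇ (E →L[𝕜] F))
    (F := (ℕ →ᵇ E) →L[𝕜] (ℕ →ᵇ F))
    (seqApply 𝕜 E F)

/-- The weighted superposition operator `z ↦ (c j • q (a ^ j • z j))_j`. -/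
noncomputable def superpose (a : 𝕜) (c : ℕ → 𝕜) (q : E → F) (z : ℕ →ᵇ E) : ℕ →ᵇ F :=
  boundedSeq fun j => c j • q (a ^ j • z j)

lemma norm_pow_smul_lt {a : 𝕜} (ha : ‖a‖ < 1) {x : E} {ε : ℝ} (hx : ‖x‖ < ε) (j : ℕ) :
    ‖a ^ j • x‖ < ε := by
  rw [norm_smul, norm_pow]
  exact (mul_le_of_le_one_left (norm_nonneg _) (pow_le_one₀ (norm_nonneg _) ha.le)).trans_lt hx

lemma tendsto_pow_smul {a : 𝕜} (ha : ‖a‖ < 1) (z : ℕ →ᵇ E) :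
    Tendsto (fun j => a ^ j • z j) atTop (𝓝 0) := by
  refine squeeze_zero_norm (a := fun j => ‖a‖ ^ j * ‖z‖) (fun j => ?_) ?_
  · rw [norm_smul, norm_pow]
    gcongr
    exact z.norm_coe_le_norm j
  · simpa using (tendsto_pow_atTop_nhds_zero_of_lt_one (norm_nonneg a) ha).mul_const ‖z‖

lemma superpose_apply {a : 𝕜} (ha : ‖a‖ < 1) {c : ℕ → 𝕜} {m : ℕ}
    (hc : ∀ j, ‖c j‖ * ‖a‖ ^ (m * j) ≤ 1) {q : E → F} (hq : q =O[𝓝 0] fun x => ‖x‖ ^ m)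
    (z : ℕ →ᵇ E) (j : ℕ) : superpose a c q z j = c j • q (a ^ j • z j) := by
  refine boundedSeq_apply ?_ j
  obtain ⟨K, hK0, hK⟩ := hq.exists_nonneg
  refine exists_bound_of_eventually (C := K * ‖z‖ ^ m) ?_
  filter_upwards [(tendsto_pow_smul ha z).eventually hK.bound] with j hj
  rw [norm_pow, norm_norm, norm_smul, norm_pow, mul_pow, ← pow_mul] at hj
  calc ‖c j • q (a ^ j • z j)‖ ≤ ‖c j‖ * (K * (‖a‖ ^ (j * m) * ‖z j‖ ^ m)) := by
        rw [norm_smul]; gcongr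
    _ = (‖c j‖ * ‖a‖ ^ (m * j)) * (K * ‖z j‖ ^ m) := by rw [mul_comm j m]; ring
    _ ≤ 1 * (K * ‖z j‖ ^ m) := by gcongr; exact hc j
    _ ≤ K * ‖z‖ ^ m := by rw [one_mul]; gcongr; exact z.norm_coe_le_norm j

lemma norm_le_one_of_weight {a : 𝕜} {c : ℕ → 𝕜} (hc : ∀ j, ‖c j‖ * ‖a‖ ^ (0 * j) ≤ 1) (j : ℕ) :
    ‖c j‖ ≤ 1 := by simpa using hc j

lemma continuousOn_superpose {a : 𝕜} (ha : ‖a‖ < 1) {c : ℕ → 𝕜}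
    (hc : ∀ j, ‖c j‖ * ‖a‖ ^ (0 * j) ≤ 1) {q : E → F} {ε : ℝ} (hε : 0 < ε)
    (hq : ContinuousOn q (Metric.ball 0 ε)) :
    ContinuousOn (superpose a c q) (Metric.ball 0 ε) := by
  have hq0 : ContinuousAt q 0 := hq.continuousAt (Metric.ball_mem_nhds 0 hε)
  have hO : q =O[𝓝 0] fun x => ‖x‖ ^ 0 := by
    simp only [pow_zero]
    exact hq0.norm.isBoundedUnder_le.isBigO_one ℝ
  refine fun z hz => ContinuousAt.continuousWithinAt ?_
  rw [ContinuousAt, Metric.tendsto_nhds]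
  intro η hη
  have hq1 : ∀ᶠ x in 𝓝 (0 : E), ‖q x - q 0‖ < η / 4 := by
    have := Metric.tendsto_nhds.1 hq0 (η / 4) (by positivity)
    simpa [dist_eq_norm] using this
  obtain ⟨ρ, hρ, hball⟩ := Metric.eventually_nhds_iff_ball.1 hq1
  have hJ : ∀ᶠ j in atTop, ‖a‖ ^ j * ε < ρ := by
    have := (tendsto_pow_atTop_nhds_zero_of_lt_one (norm_nonneg a) ha).mul_const ε
    rw [zero_mul] at this
    exact this.eventually (gt_mem_nhds hρ)
  obtain ⟨J, hJ⟩ := eventually_atTop.1 hJ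
  have hfin : ∀ᶠ z' in 𝓝 z, ∀ j ∈ Finset.range J,
      ‖q (a ^ j • z' j) - q (a ^ j • z j)‖ < η / 2 := by
    rw [Filter.eventually_all_finset]
    intro j _
    have h1 : ContinuousAt q (a ^ j • z j) := by
      refine hq.continuousAt (Metric.isOpen_ball.mem_nhds ?_)
      rw [mem_ball_zero_iff] at hz ⊢
      exact norm_pow_smul_lt ha ((z.norm_coe_le_norm j).trans_lt hz) j
    have h2 : ContinuousAt (fun z' : ℕ →ᵇ E => a ^ j • z' j) z :=
      ((BoundedContinuousFunction.evalCLM 𝕜 j).continuous.const_smul _).continuousAt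
    have h3 : ContinuousAt (fun z' : ℕ →ᵇ E => q (a ^ j • z' j)) z :=
      ContinuousAt.comp (f := fun z' : ℕ →ᵇ E => a ^ j • z' j) h1 h2
    have := Metric.tendsto_nhds.1 h3 (η / 2) (by positivity)
    simpa [dist_eq_norm] using this
  filter_upwards [hfin, Metric.isOpen_ball.mem_nhds hz] with z' hz' hzb
  have hz2 : ∀ y : ℕ →ᵇ E, y ∈ Metric.ball 0 ε → ∀ j ≥ J, ‖q (a ^ j • y j) - q 0‖ < η / 4 := by
    intro y hy j hj
    refine hball _ ?_
    rw [mem_ball_zero_iff] at hy ⊢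
    rw [norm_smul, norm_pow]
    refine lt_of_le_of_lt ?_ (hJ j hj)
    gcongr
    exact (y.norm_coe_le_norm j).trans hy.le
  refine lt_of_le_of_lt ?_ (half_lt_self hη)
  rw [dist_eq_norm, BoundedContinuousFunction.norm_le (by positivity)]
  intro j
  rw [BoundedContinuousFunction.coe_sub, Pi.sub_apply, superpose_apply ha hc hO,
    superpose_apply ha hc hO, ← smul_sub, norm_smul]
  refine (mul_le_of_le_one_left (norm_nonneg _) (norm_le_one_of_weight hc j)).trans ?_
  rcases lt_or_ge j J with hj | hj
  · exact (hz' j (Finset.mem_range.2 hj)).le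
  · have e1 := hz2 z hz j hj
    have e2 := hz2 z' hzb j hj
    have : q (a ^ j • z' j) - q (a ^ j • z j) =
      (q (a ^ j • z' j) - q 0) - (q (a ^ j • z j) - q 0) := by abel
    rw [this]
    refine (norm_sub_le _ _).trans ?_
    linarith

lemma weight_pred {a : 𝕜} (ha : ‖a‖ < 1) {c : ℕ → 𝕜} {m : ℕ}
    (hc : ∀ j, ‖c j‖ * ‖a‖ ^ (m * j) ≤ 1) (j : ℕ) :
    ‖c j * a ^ j‖ * ‖a‖ ^ ((m - 1) * j) ≤ 1 := by
  rcases m with _ | m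
  · have h1 : ‖c j‖ ≤ 1 := norm_le_one_of_weight hc j
    have h2 : ‖a‖ ^ j ≤ 1 := pow_le_one₀ (norm_nonneg _) ha.le
    simpa using mul_le_one₀ h1 (by positivity) h2
  · refine le_trans (le_of_eq ?_) (hc j)
    rw [norm_mul, norm_pow, Nat.add_sub_cancel, mul_assoc, ← pow_add]
    ring_nf

lemma fderiv_isBigO_pred {k m : ℕ} {q : E → F} (hmk : m ≤ k + 1)
    (hq : ContDiffAt 𝕜 (k + 1 : ℕ) q 0) (ho : q =O[𝓝 0] fun x => ‖x‖ ^ m) :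
    fderiv 𝕜 q =O[𝓝 0] fun x => ‖x‖ ^ (m - 1) := by
  rcases m with _ | m
  · simp only [Nat.zero_sub, pow_zero]
    exact ((hq.fderiv_right (m := 0) (by simp)).continuousAt.norm).isBoundedUnder_le.isBigO_one ℝ
  · exact fderiv_isBigO (hq.of_le (by exact_mod_cast hmk)) ho

/-- The derivative of a superposition operator, if the superposition operator of the derivative is
continuous. -/
lemma hasFDerivAt_superpose {a : 𝕜} (ha : ‖a‖ < 1) {c : ℕ → 𝕜} {m : ℕ}
    (hc : ∀ j, ‖c j‖ * ‖a‖ ^ (m * j) ≤ 1) {q : E → F} {ε : ℝ}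
    (hqd : DifferentiableOn 𝕜 q (Metric.ball 0 ε)) (hO : q =O[𝓝 0] fun x => ‖x‖ ^ m)
    (hO' : fderiv 𝕜 q =O[𝓝 0] fun x => ‖x‖ ^ (m - 1)) {z : ℕ →ᵇ E} (hz : z ∈ Metric.ball 0 ε)
    (hcont : ContinuousAt (superpose a (fun j => c j * a ^ j) (fderiv 𝕜 q)) z) :
    HasFDerivAt (superpose a c q)
      (seqApply 𝕜 E F (superpose a (fun j => c j * a ^ j) (fderiv 𝕜 q) z)) z := by
  let _ : NormedSpace ℝ E := NormedSpace.restrictScalars ℝ 𝕜 E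
  have hc' := weight_pred ha hc
  set S' := superpose a (fun j => c j * a ^ j) (fderiv 𝕜 q) with hS'
  rw [hasFDerivAt_iff_isLittleO, isLittleO_iff]
  intro η hη
  obtain ⟨δ, hδ, hball⟩ := Metric.eventually_nhds_iff_ball.1
    ((Metric.tendsto_nhds.1 hcont η hη).and (Metric.isOpen_ball.mem_nhds hz))
  filter_upwards [Metric.ball_mem_nhds z hδ] with z' hz'
  rw [BoundedContinuousFunction.norm_le (by positivity)]
  intro j
  simp only [BoundedContinuousFunction.coe_sub, Pi.sub_apply, seqApply_apply,
    superpose_apply ha hc hO]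
  -- Move the `j`-th term of `z` only, and apply the mean value inequality to it.
  set φ : E → F := fun y => c j • q (a ^ j • y) - (S' z j) y with hφ
  have hmove : ∀ y ∈ Metric.ball (z j) δ, ∃ y' : ℕ →ᵇ E, y' j = y ∧ y' ∈ Metric.ball z δ := by
    intro y hy
    have hbd : ∀ i, ‖Function.update (0 : ℕ → E) j (y - z j) i‖ ≤ ‖y - z j‖ := fun i => by
      rcases eq_or_ne i j with rfl | hij
      · simp
      · simp [Function.update_of_ne hij]
    refine ⟨z + boundedSeq (Function.update (0 : ℕ → E) j (y - z j)), ?_, ?_⟩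
    · simp [boundedSeq_apply ⟨_, hbd⟩]
    · rw [mem_ball_iff_norm, add_sub_cancel_left]
      exact (norm_boundedSeq_le (norm_nonneg _) hbd).trans_lt (mem_ball_iff_norm.1 hy)
  have hder : ∀ y ∈ Metric.ball (z j) δ, HasFDerivWithinAt φ
      ((c j * a ^ j) • fderiv 𝕜 q (a ^ j • y) - S' z j) (Metric.ball (z j) δ) y := by
    intro y hy
    obtain ⟨y', rfl, hy'⟩ := hmove y hy
    have hmem : a ^ j • y' j ∈ Metric.ball (0 : E) ε := by
      have := mem_ball_zero_iff.1 (hball y' hy').2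
      rw [mem_ball_zero_iff]
      exact norm_pow_smul_lt ha ((y'.norm_coe_le_norm j).trans_lt this) j
    have h1 := (hqd.differentiableAt (Metric.isOpen_ball.mem_nhds hmem)).hasFDerivAt
    have h2 : HasFDerivAt (fun y : E => a ^ j • y) (a ^ j • ContinuousLinearMap.id 𝕜 E) (y' j) :=
      (hasFDerivAt_id (y' j)).const_smul (a ^ j)
    have h3 := ((h1.comp (y' j) h2).const_smul (c j)).sub (S' z j).hasFDerivAt (x := y' j)
    refine HasFDerivAt.hasFDerivWithinAt ?_
    convert h3 using 1
    · rfl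
    ext v
    simp [mul_smul]
  have hbd : ∀ y ∈ Metric.ball (z j) δ,
      ‖(c j * a ^ j) • fderiv 𝕜 q (a ^ j • y) - S' z j‖ ≤ η := by
    intro y hy
    obtain ⟨y', rfl, hy'⟩ := hmove y hy
    have h1 := (hball y' hy').1.le
    rw [dist_eq_norm] at h1
    have h2 := ((S' y' - S' z).norm_coe_le_norm j).trans h1
    rwa [BoundedContinuousFunction.coe_sub, Pi.sub_apply, hS', superpose_apply ha hc' hO'] at h2
  have hzj : z' j ∈ Metric.ball (z j) δ := by
    rw [mem_ball_iff_norm] at hz' ⊢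
    exact ((z' - z).norm_coe_le_norm j).trans_lt hz'
  have hmv := Convex.norm_image_sub_le_of_norm_hasFDerivWithin_le hder hbd
    (convex_ball (z j) δ) (Metric.mem_ball_self hδ) hzj
  have e : φ (z' j) - φ (z j) = c j • q (a ^ j • z' j) - c j • q (a ^ j • z j) -
      (S' z j) (z' j - z j) := by
    simp only [hφ, map_sub]
    abel
  rw [e] at hmv
  refine hmv.trans ?_
  gcongr
  exact (z' - z).norm_coe_le_norm j

/-- Superposition operators with decaying weights are as smooth as the function they come from,
although the derivatives of that function are not assumed to be uniformly continuous: the terms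
`a ^ j • z j` tend to `0`. -/
lemma contDiffOn_superpose {a : 𝕜} (ha : ‖a‖ < 1) (k : ℕ) :
    ∀ {F : Type v} [NormedAddCommGroup F] [NormedSpace 𝕜 F] {c : ℕ → 𝕜} {m : ℕ} {q : E → F} {ε : ℝ},
    0 < ε → m ≤ k → (∀ j, ‖c j‖ * ‖a‖ ^ (m * j) ≤ 1) → (q =O[𝓝 0] fun x => ‖x‖ ^ m) →
    ContDiffOn 𝕜 k q (Metric.ball 0 ε) →
    ContDiffOn 𝕜 k (superpose a c q) (Metric.ball 0 ε) := by
  induction k with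
  | zero =>
    intro F _ _ c m q ε hε hm hc hO hq
    obtain rfl : m = 0 := by omega
    simp only [Nat.cast_zero, contDiffOn_zero] at hq ⊢
    exact continuousOn_superpose ha hc hε hq
  | succ k ih =>
    intro F _ _ c m q ε hε hm hc hO hq
    have hq0 : ContDiffAt 𝕜 (k + 1 : ℕ) q 0 := hq.contDiffAt (Metric.ball_mem_nhds 0 hε)
    have hO' := fderiv_isBigO_pred hm hq0 hO
    have hq' : ContDiffOn 𝕜 k (fderiv 𝕜 q) (Metric.ball 0 ε) :=
      ((contDiffOn_succ_iff_fderiv_of_isOpen Metric.isOpen_ball).1 (by simpa using hq)).2.2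
    have hS' := ih hε (by omega) (weight_pred ha hc) hO' hq'
    have hder : ∀ z ∈ Metric.ball (0 : ℕ →ᵇ E) ε, HasFDerivAt (superpose a c q)
        (seqApply 𝕜 E F (superpose a (fun j => c j * a ^ j) (fderiv 𝕜 q) z)) z := fun z hz =>
      hasFDerivAt_superpose ha hc (hq.differentiableOn (by simp)) hO hO' hz
        (hS'.continuousOn.continuousAt (Metric.isOpen_ball.mem_nhds hz))
    rw [Nat.cast_add, Nat.cast_one, contDiffOn_succ_iff_fderiv_of_isOpen Metric.isOpen_ball]
    refine ⟨fun z hz => (hder z hz).differentiableAt.differentiableWithinAt,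
      fun h => absurd h (by simp), ?_⟩
    have h1 : ContDiffOn 𝕜 k (fun z => seqApply 𝕜 E F
        (superpose a (fun j => c j * a ^ j) (fderiv 𝕜 q) z)) (Metric.ball 0 ε) :=
      (contDiff_seqApply (n := k)).comp_contDiffOn hS'
    exact h1.congr fun z hz => (hder z hz).fderiv

/-- The superposition operator of an analytic map is given by the power series whose coefficients
are the termwise multilinear superpositions. -/
lemma analyticAt_superpose [CompleteSpace F] {a : 𝕜} (ha : ‖a‖ < 1) {c : ℕ → 𝕜} {m : ℕ}
    (hc : ∀ j, ‖c j‖ * ‖a‖ ^ (m * j) ≤ 1) {q : E → F} (hO : q =O[𝓝 0] fun x => ‖x‖ ^ m)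
    (hq : AnalyticAt 𝕜 q 0) : AnalyticAt 𝕜 (superpose a c q) 0 := by
  obtain ⟨p, r, hp⟩ := hq
  have hdiag : ∀ n < m, ∀ x, (p n fun _ => x) = 0 := by
    rcases m with _ | m
    · exact fun n hn => absurd hn (Nat.not_lt_zero n)
    · have h1 : (fun x => p.partialSum (m + 1) x) =O[𝓝 0] fun x => ‖x‖ ^ (m + 1) := by
        have h2 := (HasFPowerSeriesOnBall.hasFPowerSeriesAt hp).isBigO_sub_partialSum_pow (m + 1)
        simp only [zero_add] at h2
        exact (hO.sub h2).congr_left fun x => by abel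
      have h3 := diag_eq_zero_of_sum_isLittleO p m
        (h1.trans_isLittleO (isLittleO_norm_pow (Nat.lt_succ_self m)))
      exact fun n hn => h3 n (by omega)
  have hbd : ∀ (n : ℕ), m ≤ n → ∀ (v : Fin n → ℕ →ᵇ E) (j : ℕ),
      ‖(c j * a ^ (n * j)) • p n fun i => v i j‖ ≤ ‖p n‖ * ∏ i, ‖v i‖ := by
    intro n hn v j
    have h1 : ‖c j * a ^ (n * j)‖ ≤ 1 := by
      refine le_trans ?_ (hc j)
      rw [norm_mul, norm_pow]
      exact mul_le_mul_of_nonneg_left (pow_le_pow_of_le_one (norm_nonneg _) ha.le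
        (Nat.mul_le_mul_right j hn)) (norm_nonneg _)
    rw [norm_smul]
    refine (mul_le_of_le_one_left (norm_nonneg _) h1).trans (((p n).le_opNorm _).trans ?_)
    gcongr with i
    exact (v i).norm_coe_le_norm j
  have happ : ∀ (n : ℕ) (hn : m ≤ n) (v : Fin n → ℕ →ᵇ E) (j : ℕ),
      boundedSeq (fun j => (c j * a ^ (n * j)) • p n fun i => v i j) j =
        (c j * a ^ (n * j)) • p n fun i => v i j :=
    fun n hn v j => boundedSeq_apply ⟨_, hbd n hn v⟩ j
  have hupd : ∀ (n : ℕ) [DecidableEq (Fin n)] (v : Fin n → ℕ →ᵇ E) (i : Fin n) (x : ℕ →ᵇ E)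
      (j : ℕ), (fun i' => Function.update v i x i' j) =
        Function.update (fun i' => v i' j) i (x j) := by
    intro n _ v i x j
    funext i'
    rcases eq_or_ne i' i with rfl | h
    · simp
    · simp [Function.update_of_ne h]
  let P : FormalMultilinearSeries 𝕜 (ℕ →ᵇ E) (ℕ →ᵇ F) := fun n =>
    if hn : m ≤ n then
      MultilinearMap.mkContinuous
        { toFun := fun v => boundedSeq fun j => (c j * a ^ (n * j)) • p n fun i => v i j
          map_update_add' := fun v i x y => by
            ext j
            have e : (x + y) j = x j + y j := rfl
            rw [BoundedContinuousFunction.coe_add, Pi.add_apply, happ n hn, happ n hn, happ n hn,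
              hupd, hupd, hupd, e, ContinuousMultilinearMap.map_update_add, smul_add]
          map_update_smul' := fun v i t x => by
            ext j
            have e : (t • x) j = t • x j := rfl
            rw [BoundedContinuousFunction.smul_apply, happ n hn, happ n hn, hupd, hupd, e,
              ContinuousMultilinearMap.map_update_smul, smul_comm] } ‖p n‖
        fun v => norm_boundedSeq_le (by positivity) (hbd n hn v)
    else 0
  have hPnorm : ∀ n, ‖P n‖ ≤ ‖p n‖ := by
    intro n
    by_cases hn : m ≤ n
    · simp only [P, dif_pos hn]
      exact MultilinearMap.mkContinuous_norm_le _ (norm_nonneg _) _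
    · simp only [P, dif_neg hn]
      simp
  have hPapp : ∀ n (z : ℕ →ᵇ E) j,
      (P n fun _ => z) j = c j • p n fun _ => a ^ j • z j := by
    intro n z j
    rw [diag_smul, smul_smul, ← pow_mul, mul_comm j n]
    by_cases hn : m ≤ n
    · simp only [P, dif_pos hn]
      exact happ n hn (fun _ => z) j
    · rw [hdiag n (by omega), smul_zero]
      simp only [P, dif_neg hn]
      rfl
  have hr : r ≤ P.radius := hp.r_le.trans (FormalMultilinearSeries.radius_le_of_le hPnorm)
  refine ⟨P, r, hr, hp.r_pos, fun {z} hz => ?_⟩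
  have hs := P.hasSum (x := z) (Metric.eball_subset_eball hr hz)
  convert hs using 1
  ext j
  rw [zero_add, superpose_apply ha hc hO]
  have h1 := hs.mapL (BoundedContinuousFunction.evalCLM 𝕜 j)
  have h2 : a ^ j • z j ∈ Metric.eball (0 : E) r := by
    rw [Metric.mem_eball, edist_zero_right] at hz ⊢
    refine lt_of_le_of_lt ?_ hz
    rw [enorm_le_iff_norm_le]
    refine le_trans ?_ (z.norm_coe_le_norm j)
    rw [norm_smul, norm_pow]
    exact mul_le_of_le_one_left (norm_nonneg _) (pow_le_one₀ (norm_nonneg _) ha.le)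
  have h3 := (hp.hasSum h2).const_smul (c j)
  rw [zero_add] at h3
  refine h3.unique ?_
  have h4 : (fun n => c j • p n fun _ => a ^ j • z j) = fun n =>
      BoundedContinuousFunction.evalCLM 𝕜 j (P n fun _ => z) := funext fun n => (hPapp n z j).symm
  rw [h4]
  exact h1

lemma contDiffAt_superpose [CompleteSpace F] {a : 𝕜} (ha : ‖a‖ < 1) {c : ℕ → 𝕜} {m : ℕ}
    (hc : ∀ j, ‖c j‖ * ‖a‖ ^ (m * j) ≤ 1) {q : E → F} (hO : q =O[𝓝 0] fun x => ‖x‖ ^ m)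
    {k : WithTop ℕ∞} (hk : k ≠ ∞) (hmk : (m : WithTop ℕ∞) ≤ k) (hq : ContDiffAt 𝕜 k q 0) :
    ContDiffAt 𝕜 k (superpose a c q) 0 := by
  rcases eq_or_ne k ω with rfl | hω
  · exact (analyticAt_superpose ha hc hO hq.analyticAt).contDiffAt
  · lift k to ℕ∞ using hω
    have hk' : k ≠ ⊤ := fun h => hk (by rw [h])
    lift k to ℕ using hk'
    obtain ⟨u, hu, hqu⟩ := hq.contDiffOn le_rfl (by simp)
    obtain ⟨ε, hε, hball⟩ := Metric.mem_nhds_iff.1 hu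
    exact (contDiffOn_superpose ha k hε (by exact_mod_cast hmk) hc hO
      (hqu.mono hball)).contDiffAt (Metric.ball_mem_nhds 0 hε)

end Sequences

end InvFoliation

namespace InvFoliation
open Set Filter Topology Asymptotics
open scoped BoundedContinuousFunction

universe v

/-! ### A functional equation solved along orbits -/

section SequenceOperators

variable {𝕜 : Type*} [RCLike 𝕜] {E : Type v} [NormedAddCommGroup E] [NormedSpace 𝕜 E]
  {F : Type v} [NormedAddCommGroup F] [NormedSpace 𝕜 F]
  {G : Type v} [NormedAddCommGroup G] [NormedSpace 𝕜 G]

/-- The bounded operator between spaces of bounded sequences whose terms are given by linear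
maps that satisfy a common bound. -/
noncomputable def seqOp (T : (ℕ →ᵇ E) → ℕ → F) (hadd : ∀ z z' j, T (z + z') j = T z j + T z' j)
    (hsmul : ∀ (c : 𝕜) z j, T (c • z) j = c • T z j) (C : ℝ) (hC : 0 ≤ C)
    (hb : ∀ z j, ‖T z j‖ ≤ C * ‖z‖) : (ℕ →ᵇ E) →L[𝕜] (ℕ →ᵇ F) :=
  LinearMap.mkContinuous
    { toFun := fun z => boundedSeq (T z)
      map_add' := fun z z' => by
        ext j
        rw [BoundedContinuousFunction.coe_add, Pi.add_apply, boundedSeq_apply ⟨_, hb z⟩,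
          boundedSeq_apply ⟨_, hb z'⟩, boundedSeq_apply ⟨_, hb (z + z')⟩, hadd]
      map_smul' := fun c z => by
        ext j
        rw [RingHom.id_apply, BoundedContinuousFunction.smul_apply, boundedSeq_apply ⟨_, hb z⟩,
          boundedSeq_apply ⟨_, hb (c • z)⟩, hsmul] } C
    fun z => norm_boundedSeq_le (by positivity) (hb z)

lemma seqOp_apply {T : (ℕ →ᵇ E) → ℕ → F} (hadd : ∀ z z' j, T (z + z') j = T z j + T z' j)
    (hsmul : ∀ (c : 𝕜) z j, T (c • z) j = c • T z j) {C : ℝ} (hC : 0 ≤ C)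
    (hb : ∀ z j, ‖T z j‖ ≤ C * ‖z‖) (z : ℕ →ᵇ E) (j : ℕ) :
    seqOp T hadd hsmul C hC hb z j = T z j :=
  boundedSeq_apply ⟨_, hb z⟩ j

lemma norm_seqOp_le {T : (ℕ →ᵇ E) → ℕ → F} (hadd : ∀ z z' j, T (z + z') j = T z j + T z' j)
    (hsmul : ∀ (c : 𝕜) z j, T (c • z) j = c • T z j) {C : ℝ} (hC : 0 ≤ C)
    (hb : ∀ z j, ‖T z j‖ ≤ C * ‖z‖) : ‖seqOp T hadd hsmul C hC hb‖ ≤ C :=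
  LinearMap.mkContinuous_norm_le _ hC _

/-- The termwise action of an operator on bounded sequences. -/
noncomputable def seqMap (T : E →L[𝕜] F) : (ℕ →ᵇ E) →L[𝕜] (ℕ →ᵇ F) :=
  seqOp (fun z j => T (z j)) (by simp) (by simp) ‖T‖ (norm_nonneg _)
    fun z j => T.le_opNorm_of_le (z.norm_coe_le_norm j)

@[simp] lemma seqMap_apply (T : E →L[𝕜] F) (z : ℕ →ᵇ E) (j : ℕ) : seqMap T z j = T (z j) :=
  seqOp_apply _ _ _ _ z j

lemma norm_seqMap_le (T : E →L[𝕜] F) : ‖seqMap T‖ ≤ ‖T‖ := norm_seqOp_le _ _ _ _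

variable (𝕜 E) in
/-- The right shift of bounded sequences. -/
noncomputable def shiftRight : (ℕ →ᵇ E) →L[𝕜] (ℕ →ᵇ E) :=
  seqOp (fun z j => Nat.casesOn j 0 fun i => z i) (fun z z' j => by cases j <;> simp)
    (fun c z j => by cases j <;> simp) 1 zero_le_one fun z j => by
      cases j with
      | zero => simp
      | succ i => simpa using z.norm_coe_le_norm i

@[simp] lemma shiftRight_zero (z : ℕ →ᵇ E) : shiftRight 𝕜 E z 0 = 0 := seqOp_apply _ _ _ _ z 0

@[simp] lemma shiftRight_succ (z : ℕ →ᵇ E) (j : ℕ) : shiftRight 𝕜 E z (j + 1) = z j :=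
  seqOp_apply _ _ _ _ z (j + 1)

variable (𝕜 E) in
lemma norm_shiftRight_le : ‖shiftRight 𝕜 E‖ ≤ 1 := norm_seqOp_le _ _ _ _

variable (𝕜 E) in
/-- The left shift of bounded sequences. -/
noncomputable def shiftLeft : (ℕ →ᵇ E) →L[𝕜] (ℕ →ᵇ E) :=
  seqOp (fun z j => z (j + 1)) (by simp) (by simp) 1 zero_le_one fun z j => by
    simpa using z.norm_coe_le_norm (j + 1)

@[simp] lemma shiftLeft_apply (z : ℕ →ᵇ E) (j : ℕ) : shiftLeft 𝕜 E z j = z (j + 1) :=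
  seqOp_apply _ _ _ _ z j

variable (𝕜 E) in
lemma norm_shiftLeft_le : ‖shiftLeft 𝕜 E‖ ≤ 1 := norm_seqOp_le _ _ _ _

variable (𝕜 E) in
/-- The sequences which vanish except for their first term. -/
noncomputable def seqSingle : E →L[𝕜] (ℕ →ᵇ E) :=
  have hb : ∀ (x : E) j, ‖(Nat.casesOn j x fun _ => 0 : E)‖ ≤ 1 * ‖x‖ := fun x j => by
    cases j <;> simp
  LinearMap.mkContinuous
    { toFun := fun x => boundedSeq fun j => Nat.casesOn j x fun _ => 0
      map_add' := fun x y => by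
        ext j
        rw [BoundedContinuousFunction.coe_add, Pi.add_apply, boundedSeq_apply ⟨_, hb x⟩,
          boundedSeq_apply ⟨_, hb y⟩, boundedSeq_apply ⟨_, hb _⟩]
        cases j <;> simp
      map_smul' := fun c x => by
        ext j
        rw [RingHom.id_apply, BoundedContinuousFunction.smul_apply, boundedSeq_apply ⟨_, hb x⟩,
          boundedSeq_apply ⟨_, hb _⟩]
        cases j <;> simp } 1
    fun x => norm_boundedSeq_le (by positivity) (hb x)

lemma seqSingle_apply (x : E) (j : ℕ) :
    seqSingle 𝕜 E x j = (Nat.casesOn j x fun _ => 0 : E) :=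
  boundedSeq_apply ⟨‖x‖, fun j => by cases j <;> simp⟩ j

@[simp] lemma seqSingle_zero (x : E) : seqSingle 𝕜 E x 0 = x := seqSingle_apply x 0

@[simp] lemma seqSingle_succ (x : E) (j : ℕ) : seqSingle 𝕜 E x (j + 1) = 0 :=
  seqSingle_apply x (j + 1)

/-- The Neumann series converges if some power is small. -/
lemma isUnit_one_sub_of_norm_pow_lt_one {R : Type*} [NormedRing R] [HasSummableGeomSeries R]
    {x : R} {N : ℕ} (h : ‖x ^ N‖ < 1) : IsUnit (1 - x) := by
  have h1 : IsUnit (1 - x ^ N) := isUnit_one_sub_of_norm_lt_one h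
  rw [← mul_neg_geom_sum] at h1
  refine ((Commute.isUnit_mul_iff ?_).1 h1).1
  refine Commute.sum_right _ _ _ fun i _ => ?_
  exact (Commute.one_left _).sub_left (Commute.self_pow x i)

lemma isUnit_one_sub_smul_comp_seqMap [CompleteSpace E] {S : (ℕ →ᵇ E) →L[𝕜] (ℕ →ᵇ E)}
    (hS : ‖S‖ ≤ 1) {T : E →L[𝕜] E} (hST : Commute S (seqMap T)) {c : 𝕜} {N : ℕ}
    (hN : ‖c‖ ^ N * ‖T ^ N‖ < 1) : IsUnit (1 - c • (S * seqMap T)) := by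
  refine isUnit_one_sub_of_norm_pow_lt_one (N := N) ?_
  have h1 : ∀ n, (seqMap T) ^ n = seqMap (T ^ n) := by
    intro n
    induction n with
    | zero => ext z j; simp
    | succ n ih => rw [pow_succ, ih]; ext z j; simp [pow_succ]
  have h2 : ‖S ^ N‖ ≤ 1 := by
    clear hN
    induction N with
    | zero => exact (pow_zero S).symm ▸ ContinuousLinearMap.norm_id_le
    | succ n ih =>
      rw [pow_succ]
      exact (norm_mul_le _ _).trans (mul_le_one₀ ih (norm_nonneg _) hS)
  rw [smul_pow, hST.mul_pow, h1, norm_smul, norm_pow]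
  refine lt_of_le_of_lt ?_ hN
  gcongr
  refine (norm_mul_le _ _).trans ?_
  refine (mul_le_of_le_one_left (norm_nonneg _) h2).trans (norm_seqMap_le _)

/-- The derivative of a superposition operator at `0`. -/
lemma hasFDerivAt_superpose_zero {a : 𝕜} (ha : ‖a‖ < 1) {c : ℕ → 𝕜} {m k : ℕ}
    (hc : ∀ j, ‖c j‖ * ‖a‖ ^ (m * j) ≤ 1) {q : E → F} (hO : q =O[𝓝 0] fun x => ‖x‖ ^ m)
    (hm : m ≤ k + 1) (hq : ContDiffAt 𝕜 (k + 1 : ℕ) q 0) :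
    HasFDerivAt (superpose a c q)
      (seqApply 𝕜 E F (superpose a (fun j => c j * a ^ j) (fderiv 𝕜 q) 0)) 0 := by
  have hO' := fderiv_isBigO_pred hm hq hO
  obtain ⟨u, hu, hqu⟩ := hq.contDiffOn le_rfl (by simp)
  obtain ⟨ε, hε, hball⟩ := Metric.mem_nhds_iff.1 hu
  have hqb : ContDiffOn 𝕜 (k + 1 : ℕ) q (Metric.ball 0 ε) := hqu.mono hball
  refine hasFDerivAt_superpose ha hc (hqb.differentiableOn (by simp)) hO hO'
    (Metric.mem_ball_self hε) ?_
  have hq' : ContDiffOn 𝕜 k (fderiv 𝕜 q) (Metric.ball 0 ε) :=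
      ((contDiffOn_succ_iff_fderiv_of_isOpen Metric.isOpen_ball).1 (by simpa using hqb)).2.2
  exact (contDiffOn_superpose ha k hε (by omega) (weight_pred ha hc) hO'
    hq').continuousOn.continuousAt (Metric.ball_mem_nhds 0 hε)

end SequenceOperators

section InvariantSection

variable {𝕜 : Type*} [RCLike 𝕜] {X : Type v} [NormedAddCommGroup X] [NormedSpace 𝕜 X]
  [CompleteSpace X] {F : Type v} [NormedAddCommGroup F] [NormedSpace 𝕜 F] [CompleteSpace F]

/-- For each `x`, the sequence `z` of rescaled iterates `a⁻ʲ fʲ(x)` and the sequence `w` of values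
`a⁻ᴸʲ ρ(fʲ(x))` are characterized by an equation in spaces of bounded sequences, which the inverse
function theorem solves near `0`: the linearization is invertible by the bounds on the powers of
`A` and `A₀⁻¹`. The shifted sequences solve the equation for `f x`, and this is the functional
equation for `ρ`. -/
lemma exists_solution_functional_equation {a : 𝕜} (ha0 : a ≠ 0) (ha1 : ‖a‖ < 1) {L : ℕ} (hL : 2 ≤ L)
    {f : X → X} {q : X → F} {H : X × F → F →L[𝕜] F} {A : X →L[𝕜] X} {A₀ : F ≃L[𝕜] F}
    (hf0 : f 0 = 0) (hfA : HasFDerivAt f A 0) (hf : ContDiffAt 𝕜 L f 0)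
    (hq : ContDiffAt 𝕜 L q 0) (hqO : q =O[𝓝 0] fun x => ‖x‖ ^ L)
    (hH : ContDiffAt 𝕜 L H 0) (hH0 : H 0 = A₀) {N N' : ℕ}
    (hA : ‖A ^ N‖ < ‖a‖ ^ N)
    (hA₀ : ‖(A₀.symm : F →L[𝕜] F) ^ N'‖ * ‖a‖ ^ (L * N') < 1) :
    ∃ ρ : X → F, (∀ k : WithTop ℕ∞, k ≠ ∞ → L ≤ k → ContDiffAt 𝕜 k f 0 → ContDiffAt 𝕜 k q 0 →
        ContDiffAt 𝕜 k H 0 → ContDiffAt 𝕜 k ρ 0) ∧ ρ 0 = 0 ∧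
      HasFDerivAt ρ (0 : X →L[𝕜] F) 0 ∧ ∀ᶠ x in 𝓝 0, ρ (f x) = q x + H (x, ρ x) (ρ x) := by
  have ha' : 0 < ‖a‖ := norm_pos_iff.2 ha0
  have hL1 : ((1 : ℕ) : WithTop ℕ∞) ≤ L := by exact_mod_cast (by omega : 1 ≤ L)
  have hc1 : ∀ j, ‖(a ^ j)⁻¹‖ * ‖a‖ ^ (1 * j) ≤ 1 := fun j => by
    rw [norm_inv, norm_pow, one_mul, inv_mul_cancel₀ (by positivity)]
  have hcL : ∀ j, ‖(a ^ (L * j))⁻¹‖ * ‖a‖ ^ (L * j) ≤ 1 := fun j => by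
    rw [norm_inv, norm_pow, inv_mul_cancel₀ (by positivity)]
  have hc0 : ∀ j, ‖(fun _ => 1 : ℕ → 𝕜) j‖ * ‖a‖ ^ (0 * j) ≤ 1 := fun j => by simp
  have hfO : f =O[𝓝 0] fun x => ‖x‖ ^ 1 := by
    have := hfA.isBigO_sub
    simpa [hf0] using this.norm_right
  have hHO : H =O[𝓝 0] fun x => ‖x‖ ^ 0 := by
    simp only [pow_zero]
    exact hH.continuousAt.norm.isBoundedUnder_le.isBigO_one ℝ
  have hqO2 : fderiv 𝕜 q 0 = 0 := by
    have h1 : q =O[𝓝 0] fun x => ‖x - 0‖ ^ L := by simpa using hqO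
    exact (h1.hasFDerivAt (n := L) (by omega)).fderiv
  -- The linearization in `z` is `1 - a⁻¹ • shiftRight ∘ A`, that in `w` is
  -- `1 - a ^ L • shiftLeft ∘ A₀⁻¹`; the weights make a power of either perturbation small.
  set SR := shiftRight 𝕜 X with hSR
  set SL := shiftLeft 𝕜 F with hSL
  set A₀' : F →L[𝕜] F := (A₀.symm : F →L[𝕜] F) with hA₀'
  have hu1 : IsUnit (1 - a⁻¹ • (SR * seqMap A)) := by
    refine isUnit_one_sub_smul_comp_seqMap (norm_shiftRight_le 𝕜 X) ?_ (N := N) ?_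
    · ext z j
      cases j <;> simp
    · rw [norm_inv, inv_pow, inv_mul_lt_iff₀ (by positivity), mul_one]
      exact hA
  have hu2 : IsUnit (1 - a ^ L • (SL * seqMap A₀')) := by
    refine isUnit_one_sub_smul_comp_seqMap (norm_shiftLeft_le 𝕜 F) ?_ (N := N') ?_
    · ext z j
      simp
    · rw [norm_pow, ← pow_mul, mul_comm]
      exact hA₀
  set e₁ := ContinuousLinearEquiv.unitsEquiv 𝕜 (ℕ →ᵇ X) hu1.unit with he₁
  set e₂ := ContinuousLinearEquiv.unitsEquiv 𝕜 (ℕ →ᵇ F) hu2.unit with he₂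
  -- The second component is scaled by `a ^ ((L - 1) j)`, so that the superposition operator of `H`
  -- is evaluated at `(aʲ z j, a ^ (L j) w j) = (fʲ x, ρ (fʲ x))`.
  have hbw : ∀ (w : ℕ →ᵇ F) j, ‖a ^ ((L - 1) * j) • w j‖ ≤ 1 * ‖w‖ := fun w j => by
    rw [norm_smul, norm_pow]
    exact mul_le_mul (pow_le_one₀ (norm_nonneg _) ha1.le) (w.norm_coe_le_norm j) (norm_nonneg _)
      zero_le_one
  set D : (ℕ →ᵇ F) →L[𝕜] (ℕ →ᵇ F) := seqOp (fun w j => a ^ ((L - 1) * j) • w j) (by simp)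
    (fun c z j => by simp [smul_comm c]) 1 zero_le_one hbw with hD
  set J : (ℕ →ᵇ X) × (ℕ →ᵇ F) →L[𝕜] (ℕ →ᵇ (X × F)) :=
    (seqMap (ContinuousLinearMap.inl 𝕜 X F)).comp (ContinuousLinearMap.fst 𝕜 _ _) +
    (seqMap (ContinuousLinearMap.inr 𝕜 X F)).comp (D.comp (ContinuousLinearMap.snd 𝕜 _ _)) with hJ
  have hJapp : ∀ u j, J u j = (u.1 j, a ^ ((L - 1) * j) • u.2 j) := by
    intro u j
    have h1 : D u.2 j = a ^ ((L - 1) * j) • u.2 j := seqOp_apply _ _ _ _ _ _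
    simp [hJ, h1]
  set Ψ₁ : (ℕ →ᵇ X) × (ℕ →ᵇ F) → (ℕ →ᵇ X) := fun u =>
    u.1 - a⁻¹ • SR (superpose a (fun j => (a ^ j)⁻¹) f u.1) with hΨ₁
  set Ψ₂ : (ℕ →ᵇ X) × (ℕ →ᵇ F) → (ℕ →ᵇ F) := fun u =>
    seqMap A₀' (superpose a (fun j => (a ^ (L * j))⁻¹) q u.1 +
      seqApply 𝕜 F F (superpose a (fun _ => 1) H (J u)) u.2 - a ^ L • SL u.2) with hΨ₂
  have hΨ₁0 : ∀ u, Ψ₁ u 0 = u.1 0 := fun u => by simp [hΨ₁, hSR]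
  have hΨ₁s : ∀ u j, Ψ₁ u (j + 1) = u.1 (j + 1) - (a ^ (j + 1))⁻¹ • f (a ^ j • u.1 j) := by
    intro u j
    simp only [hΨ₁, hSR, BoundedContinuousFunction.coe_sub, Pi.sub_apply,
      BoundedContinuousFunction.smul_apply, shiftRight_succ, superpose_apply ha1 hc1 hfO, smul_smul,
      pow_succ, mul_inv]
    rw [mul_comm]
  have hΨ₂app : ∀ u j, Ψ₂ u j = A₀.symm ((a ^ (L * j))⁻¹ • q (a ^ j • u.1 j) +
      H (a ^ j • u.1 j, a ^ (L * j) • u.2 j) (u.2 j) - a ^ L • u.2 (j + 1)) := by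
    intro u j
    have h1 : j + (L - 1) * j = L * j := by
      obtain ⟨l, rfl⟩ : ∃ l, L = l + 1 := ⟨L - 1, by omega⟩
      simp; ring
    simp only [hΨ₂, hSL, seqMap_apply, BoundedContinuousFunction.coe_sub, Pi.sub_apply,
      BoundedContinuousFunction.coe_add, Pi.add_apply, seqApply_apply,
      BoundedContinuousFunction.smul_apply, shiftLeft_apply, superpose_apply ha1 hcL hqO,
      superpose_apply ha1 hc0 hHO, hJapp, Prod.smul_mk, smul_smul, ← pow_add, h1, one_smul, hA₀']
    rfl
  have hΨH : ∀ k : WithTop ℕ∞, k ≠ ∞ → ContDiffAt 𝕜 k H 0 →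
      ContDiffAt 𝕜 k (fun u => seqApply 𝕜 F F (superpose a (fun _ => 1) H (J u))) 0 := by
    intro k hk hHk
    have h3 : ContDiffAt 𝕜 k (superpose a (fun _ => 1) H) 0 :=
      contDiffAt_superpose ha1 hc0 hHO hk (by simp) hHk
    have h3' : ContDiffAt 𝕜 k (fun u => superpose a (fun _ => 1) H (J u)) 0 := by
      refine ContDiffAt.comp (g := superpose a (fun _ => 1) H)
        (0 : (ℕ →ᵇ X) × (ℕ →ᵇ F)) ?_ J.contDiff.contDiffAt
      rwa [map_zero]
    exact ContDiffAt.comp (g := seqApply 𝕜 F F) _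
      (contDiff_seqApply (𝕜 := 𝕜) (E := F) (F := F) (n := k)).contDiffAt h3'
  have hΨc : ∀ k : WithTop ℕ∞, k ≠ ∞ → L ≤ k → ContDiffAt 𝕜 k f 0 → ContDiffAt 𝕜 k q 0 →
        ContDiffAt 𝕜 k H 0 → ContDiffAt 𝕜 k (fun u => (Ψ₁ u, Ψ₂ u)) 0 := by
    intro k hk hLk hfk hqk hHk
    have h1 : ContDiffAt 𝕜 k (superpose a (fun j => (a ^ j)⁻¹) f) 0 :=
      contDiffAt_superpose ha1 hc1 hfO hk (hL1.trans hLk) hfk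
    have h2 : ContDiffAt 𝕜 k (superpose a (fun j => (a ^ (L * j))⁻¹) q) 0 :=
      contDiffAt_superpose ha1 hcL hqO hk hLk hqk
    have h1' : ContDiffAt 𝕜 k (fun u : (ℕ →ᵇ X) × (ℕ →ᵇ F) =>
        superpose a (fun j => (a ^ j)⁻¹) f u.1) 0 :=
      ContDiffAt.comp (g := superpose a (fun j => (a ^ j)⁻¹) f)
        (0 : (ℕ →ᵇ X) × (ℕ →ᵇ F)) h1 contDiffAt_fst
    have h2' : ContDiffAt 𝕜 k (fun u : (ℕ →ᵇ X) × (ℕ →ᵇ F) =>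
        superpose a (fun j => (a ^ (L * j))⁻¹) q u.1) 0 :=
      ContDiffAt.comp (g := superpose a (fun j => (a ^ (L * j))⁻¹) q)
        (0 : (ℕ →ᵇ X) × (ℕ →ᵇ F)) h2 contDiffAt_fst
    have h4 := hΨH k hk hHk
    refine ContDiffAt.prodMk ?_ ?_
    · exact contDiffAt_fst.sub ((SR.contDiff.contDiffAt.comp _ h1').const_smul _)
    · refine (seqMap A₀').contDiff.contDiffAt.comp _ ?_
      refine (h2'.add (h4.clm_apply contDiffAt_snd)).sub ?_
      exact (SL.contDiff.contDiffAt.comp _ contDiffAt_snd).const_smul _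
  have hΨL := hΨc L (by simp) le_rfl hf hq hH
  have hΨd : HasFDerivAt (fun u => (Ψ₁ u, Ψ₂ u))
      (e₁.prodCongr e₂ : ((ℕ →ᵇ X) × (ℕ →ᵇ F)) ≃L[𝕜] _).toContinuousLinearMap 0 := by
    have h1 := hasFDerivAt_superpose_zero (k := 0) ha1 hc1 hfO le_rfl (hf.of_le hL1)
    have h2 := hasFDerivAt_superpose_zero (k := L - 1) ha1 hcL hqO (by omega)
      (by rwa [Nat.sub_add_cancel (by omega)])
    have h3 := hasFDerivAt_superpose_zero (k := 0) ha1 hc0 hHO (by omega) (hH.of_le hL1)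
    rw [show seqApply 𝕜 X X (superpose a (fun j => (a ^ j)⁻¹ * a ^ j) (fderiv 𝕜 f) 0) =
      seqMap A from ?_] at h1
    rw [show seqApply 𝕜 X F (superpose a (fun j => (a ^ (L * j))⁻¹ * a ^ j) (fderiv 𝕜 q) 0) =
      0 from ?_] at h2
    · have h1' : HasFDerivAt (fun u : (ℕ →ᵇ X) × (ℕ →ᵇ F) =>
        superpose a (fun j => (a ^ j)⁻¹) f u.1) _ 0 :=
        HasFDerivAt.comp (g := superpose a (fun j => (a ^ j)⁻¹) f)
          (0 : (ℕ →ᵇ X) × (ℕ →ᵇ F)) h1 hasFDerivAt_fst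
      have h2' : HasFDerivAt (fun u : (ℕ →ᵇ X) × (ℕ →ᵇ F) =>
        superpose a (fun j => (a ^ (L * j))⁻¹) q u.1) _ 0 :=
        HasFDerivAt.comp (g := superpose a (fun j => (a ^ (L * j))⁻¹) q)
          (0 : (ℕ →ᵇ X) × (ℕ →ᵇ F)) h2 hasFDerivAt_fst
      have h4 : DifferentiableAt 𝕜 (fun u => seqApply 𝕜 F F (superpose a (fun _ => 1) H (J u)))
          0 := (hΨH (1 : ℕ) (by simp) (hH.of_le hL1)).differentiableAt (by simp)
      have h5 := h4.hasFDerivAt.clm_apply (hasFDerivAt_snd (𝕜 := 𝕜))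
      have h6 : HasFDerivAt Ψ₁ _ 0 :=
        hasFDerivAt_fst.sub ((SR.hasFDerivAt.comp (0 : (ℕ →ᵇ X) × (ℕ →ᵇ F)) h1').const_smul a⁻¹)
      have h7 : HasFDerivAt Ψ₂ _ 0 := (seqMap A₀').hasFDerivAt.comp (0 : (ℕ →ᵇ X) × (ℕ →ᵇ F))
        ((h2'.add h5).sub ((SL.hasFDerivAt.comp (0 : (ℕ →ᵇ X) × (ℕ →ᵇ F))
          hasFDerivAt_snd).const_smul (a ^ L)))
      have e2 : ∀ w, seqApply 𝕜 F F (superpose a (fun _ => 1) H 0) w =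
          seqMap (A₀ : F →L[𝕜] F) w := by
        intro w
        ext j
        rw [seqApply_apply, superpose_apply ha1 hc0 hHO]
        simp [hH0]
      refine (h6.prodMk h7).congr_fderiv ?_
      refine ContinuousLinearMap.ext fun u => Prod.ext ?_ ?_
      · simp [he₁, ContinuousLinearEquiv.unitsEquiv_apply]
      · have e3 : ∀ w : ℕ →ᵇ F, seqMap A₀' (seqMap (A₀ : F →L[𝕜] F) w) = w := fun w => by
          ext j; simp [hA₀']
        have e4 : ∀ w : ℕ →ᵇ F, seqMap A₀' (SL w) = SL (seqMap A₀' w) := fun w => by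
          ext j; simp [hSL]
        simp [he₂, ContinuousLinearEquiv.unitsEquiv_apply, e2, e3, e4]
    · refine ContinuousLinearMap.ext fun w => ?_
      ext j
      rw [seqApply_apply, superpose_apply ha1 (weight_pred ha1 hcL)
        (fderiv_isBigO_pred (k := L - 1) (by omega) (by rwa [Nat.sub_add_cancel (by omega)]) hqO)]
      simp [hqO2]
    · refine ContinuousLinearMap.ext fun w => ?_
      ext j
      rw [seqApply_apply, superpose_apply ha1 (weight_pred ha1 hc1)
        (fderiv_isBigO_pred (k := 0) (by omega) (hf.of_le hL1) hfO)]
      simp [hfA.fderiv, ha0]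
  have hΨ0 : (fun u => (Ψ₁ u, Ψ₂ u)) 0 = 0 := by
    refine Prod.ext ?_ ?_
    · ext j
      cases j with
      | zero => simp [hΨ₁0]
      | succ j => simp [hΨ₁s, hf0]
    · ext j
      have : q 0 = 0 := by
        obtain ⟨C, hC⟩ := hqO.bound
        have := hC.self_of_nhds
        simpa [show L ≠ 0 by omega] using this
      simp [hΨ₂app, this]
  set Θ := hΨL.toOpenPartialHomeomorph _ hΨd (by simp; omega) with hΘ
  have hΘc : ∀ u, Θ u = (Ψ₁ u, Ψ₂ u) := fun u => rfl
  have h0s : (0 : (ℕ →ᵇ X) × (ℕ →ᵇ F)) ∈ Θ.source :=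
    hΨL.mem_toOpenPartialHomeomorph_source hΨd (by simp; omega)
  have hΘ0 : Θ 0 = 0 := hΨ0
  have h0t : (0 : (ℕ →ᵇ X) × (ℕ →ᵇ F)) ∈ Θ.target := hΘ0 ▸ Θ.map_source h0s
  have hΘs0 : Θ.symm 0 = 0 := by
    have := Θ.left_inv h0s
    rwa [hΘ0] at this
  set ι : X →L[𝕜] (ℕ →ᵇ X) × (ℕ →ᵇ F) :=
    (ContinuousLinearMap.inl 𝕜 (ℕ →ᵇ X) (ℕ →ᵇ F)).comp (seqSingle 𝕜 X) with hι
  set p : (ℕ →ᵇ X) × (ℕ →ᵇ F) →L[𝕜] F :=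
    (BoundedContinuousFunction.evalCLM 𝕜 0).comp (ContinuousLinearMap.snd 𝕜 _ _) with hp
  have hpapp : ∀ u, p u = u.2 0 := fun u => rfl
  refine ⟨fun x => p (Θ.symm (ι x)), ?_, by simp [hΘs0], ?_, ?_⟩
  · intro k hk hLk hfk hqk hHk
    have h1 : ContDiffAt 𝕜 k Θ.symm 0 := by
      refine Θ.contDiffAt_symm h0t (f₀' := e₁.prodCongr e₂) ?_ ?_
      · rw [hΘs0]; exact hΨd
      · rw [hΘs0]; exact hΨc k hk hLk hfk hqk hHk
    refine p.contDiff.contDiffAt.comp _ (ContDiffAt.comp (g := Θ.symm) _ ?_ ι.contDiff.contDiffAt)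
    rwa [map_zero]
  · have h1 : HasFDerivAt Θ.symm ((e₁.prodCongr e₂).symm : _ →L[𝕜] (ℕ →ᵇ X) × (ℕ →ᵇ F)) (ι 0) := by
      rw [map_zero]
      refine Θ.hasFDerivAt_symm h0t ?_
      rw [hΘs0]; exact hΨd
    have h2 := p.hasFDerivAt.comp _ (h1.comp _ ι.hasFDerivAt)
    refine h2.congr_fderiv ?_
    ext x
    simp [hι, hp]
  · obtain ⟨ε, hε, hball⟩ := Metric.isOpen_iff.1 Θ.open_source 0 h0s
    have h1 : ContinuousAt (fun x => Θ.symm (ι x)) 0 := by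
      refine ContinuousAt.comp (g := Θ.symm) ?_ ι.continuous.continuousAt
      rw [map_zero]
      exact Θ.symm.continuousAt h0t
    have h2 : ∀ᶠ x in 𝓝 (0 : X), Θ.symm (ι x) ∈ Metric.ball 0 ε :=
      h1.eventually (by beta_reduce; rw [map_zero, hΘs0]; exact Metric.ball_mem_nhds _ hε)
    have h3 : ∀ᶠ x in 𝓝 (0 : X), ι x ∈ Θ.target :=
      ι.continuous.continuousAt.eventually
        (by simpa using Θ.open_target.mem_nhds h0t)
    filter_upwards [h2, h3] with x hx hxt
    set u := Θ.symm (ι x) with hu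
    have hΘu : Θ u = ι x := Θ.right_inv hxt
    have hu₁ : Ψ₁ u = seqSingle 𝕜 X x := congrArg Prod.fst hΘu
    have hu₂ : Ψ₂ u = 0 := congrArg Prod.snd hΘu
    have hx0 : u.1 0 = x := by rw [← hΨ₁0, hu₁, seqSingle_zero]
    have hz : ∀ j, u.1 (j + 1) = (a ^ (j + 1))⁻¹ • f (a ^ j • u.1 j) := fun j => by
      have := hΨ₁s u j
      rw [hu₁, seqSingle_succ] at this
      exact (sub_eq_zero.1 this.symm)
    have hw : ∀ j, (a ^ (L * j))⁻¹ • q (a ^ j • u.1 j) +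
      H (a ^ j • u.1 j, a ^ (L * j) • u.2 j) (u.2 j) = a ^ L • u.2 (j + 1) := fun j => by
      have := hΨ₂app u j
      rw [hu₂] at this
      exact sub_eq_zero.1 ((map_eq_zero_iff _ A₀.symm.injective).1 this.symm)
    -- The shifted orbit is the orbit of `f x`.
    set u' : (ℕ →ᵇ X) × (ℕ →ᵇ F) := (a • shiftLeft 𝕜 X u.1, a ^ L • SL u.2) with hu'
    have hu's : u' ∈ Θ.source := by
      refine hball ?_
      rw [mem_ball_zero_iff] at hx ⊢
      refine lt_of_le_of_lt ?_ hx
      refine max_le ?_ ?_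
      · refine le_trans ?_ (norm_fst_le u)
        rw [norm_smul]
        exact (mul_le_of_le_one_left (norm_nonneg _) ha1.le).trans
          ((shiftLeft 𝕜 X).le_of_opNorm_le (norm_shiftLeft_le 𝕜 X) _ |>.trans_eq (one_mul _))
      · refine le_trans ?_ (norm_snd_le u)
        rw [norm_smul, norm_pow]
        exact (mul_le_of_le_one_left (norm_nonneg _) (pow_le_one₀ (norm_nonneg _) ha1.le)).trans
          (SL.le_of_opNorm_le (norm_shiftLeft_le 𝕜 F) _ |>.trans_eq (one_mul _))
    have hz' : ∀ j, u'.1 j = a • u.1 (j + 1) := fun j => by simp [hu']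
    have hw' : ∀ j, u'.2 j = a ^ L • u.2 (j + 1) := fun j => by simp [hu', hSL]
    have hΘu' : Θ u' = ι (f x) := by
      refine Prod.ext ?_ ?_
      · ext j
        cases j with
        | zero =>
          have : Ψ₁ u' 0 = f x := by
            rw [hΨ₁0, hz', hz, hx0]
            simp [smul_smul, ha0]
          simpa [hι, hΘc] using this
        | succ j =>
          have : Ψ₁ u' (j + 1) = 0 := by
            rw [hΨ₁s, hz', hz', hz (j + 1), smul_smul, smul_smul, sub_eq_zero, ← pow_succ]
            congr 1
            rw [pow_succ' a (j + 1), mul_inv, mul_inv_cancel_left₀ ha0]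
          simpa [hι, hΘc] using this
      · ext j
        have : Ψ₂ u' j = 0 := by
          have h5 := hw (j + 1)
          rw [hΨ₂app, hz', hw', hw' (j + 1), smul_smul, smul_smul, ← pow_succ, ← pow_add,
            show L * j + L = L * (j + 1) by ring, ← h5, smul_add, map_smul, smul_smul]
          rw [show a ^ L * (a ^ (L * (j + 1)))⁻¹ = (a ^ (L * j))⁻¹ by
            rw [show L * (j + 1) = L * j + L by ring, pow_add, mul_inv, mul_comm, mul_assoc,
              inv_mul_cancel₀ (pow_ne_zero _ ha0), mul_one], sub_self, map_zero]
        simpa [hι, hΘc] using this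
    have hfx : Θ.symm (ι (f x)) = u' := by
      rw [← hΘu', Θ.left_inv hu's]
    rw [hfx, hpapp, hpapp, hw']
    have := hw 0
    simp only [mul_zero, pow_zero, inv_one, one_smul, hx0] at this
    exact this.symm

end InvariantSection

end InvFoliation

namespace InvFoliation
open Set Filter Topology Asymptotics Polynomial

universe v

/-! ### Gelfand theory and nonresonance -/

section Commuting

/-- Gelfand theory for commuting elements: in the double centralizer of a commuting family, each
element which is not invertible is a zero of a character, and a character has no zeros among the
elements which are invertible in the full algebra. -/
lemma exists_character {C : Type*} [NormedRing C] [NormedAlgebra ℂ C] [CompleteSpace C] {S : Set C}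
    (hS : ∀ x ∈ S, ∀ y ∈ S, Commute x y) :
    ∃ 𝒜 : Subalgebra ℂ C, S ⊆ 𝒜 ∧ (∀ x y : 𝒜, x * y = y * x) ∧ ∀ K : 𝒜, ¬ IsUnit (K : C) →
      ∃ φ : 𝒜 →ₐ[ℂ] ℂ, φ K = 0 ∧ ∀ x : 𝒜, IsUnit (x : C) → φ x ≠ 0 := by
  set 𝒜 : Subalgebra ℂ C := Subalgebra.centralizer ℂ (Set.centralizer S) with h𝒜
  have hSc : S ⊆ Set.centralizer S := fun x hx y hy => (hS y hy x hx).eq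
  have hcomm : ∀ x y : 𝒜, x * y = y * x := by
    rintro ⟨x, hx⟩ ⟨y, hy⟩
    have hx' : x ∈ Set.centralizer S := Set.centralizer_subset hSc hx
    exact Subtype.ext (hy x hx')
  have hinv : ∀ x : 𝒜, IsUnit (x : C) → IsUnit x := by
    rintro ⟨x, hx⟩ ⟨u, rfl⟩
    have hmem : (↑u⁻¹ : C) ∈ 𝒜 := by
      intro g hg
      have : Commute g (u : C) := hx g hg
      exact (this.units_inv_right).eq
    exact ⟨⟨⟨u, hx⟩, ⟨↑u⁻¹, hmem⟩, Subtype.ext (by simp), Subtype.ext (by simp)⟩, rfl⟩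
  have hclosed : IsClosed (𝒜 : Set C) := Set.isClosed_centralizer _
  have : CompleteSpace 𝒜 := hclosed.completeSpace_coe
  let _ : NormedCommRing 𝒜 := { (inferInstance : NormedRing 𝒜) with mul_comm := hcomm }
  let _ : NormedAlgebra ℂ 𝒜 := { (inferInstance : Algebra ℂ 𝒜) with
    norm_smul_le := fun c x => (norm_smul_le c (x : C)) }
  refine ⟨𝒜, Set.subset_centralizer_centralizer, hcomm, fun K hK => ?_⟩
  have hK' : ¬ IsUnit K := fun h => hK (h.map 𝒜.val)
  obtain ⟨φ, hφ⟩ := WeakDual.CharacterSpace.exists_apply_eq_zero hK'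
  refine ⟨WeakDual.CharacterSpace.toAlgHom φ, hφ, fun x hx => ?_⟩
  exact ((hinv x hx).map (WeakDual.CharacterSpace.toAlgHom φ)).ne_zero

/-- `s` contains the spectrum of `T`, an element of an algebra over `𝕜 ⊆ ℂ`: each `z ∉ s` is a root
of a polynomial `Q` over `𝕜` such that `Q(T)` is invertible. -/
def ContainsSpectrum {𝕜 B : Type*} [Field 𝕜] [Algebra 𝕜 ℂ] [Ring B] [Algebra 𝕜 B] (s : Set ℂ)
    (T : B) : Prop :=
  ∀ z ∉ s, ∃ Q : 𝕜[X], aeval z Q = 0 ∧ IsUnit (aeval T Q)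

/-- Invertibility under a nonresonance condition, for commuting elements `L`, `d i` and idempotents
`p i`, where `d i` is spectrally located in `s` on the range of `p i` and in `s'` on the range of
`1 - p i`. -/
lemma isUnit_sub_of_nonresonance {𝕜 B C : Type*} [Field 𝕜] [Algebra 𝕜 ℂ] [Ring B] [Algebra 𝕜 B]
    [NormedRing C] [NormedAlgebra ℂ C] [CompleteSpace C] (t : B →+* C)
    (ht : ∀ c : 𝕜, t (algebraMap 𝕜 B c) = algebraMap 𝕜 ℂ c • (1 : C))
    (hrefl : ∀ x, IsUnit (t x) → IsUnit x) {n : ℕ} {L : B} {d p : Fin n → B}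
    (hp : ∀ i, p i * p i = p i)
    (hLd : ∀ i, Commute L (d i)) (hLp : ∀ i, Commute L (p i)) (hdd : ∀ i j, Commute (d i) (d j))
    (hdp : ∀ i j, Commute (d i) (p j)) (hpp : ∀ i j, Commute (p i) (p j)) {s s' : Set ℂ}
    (hL : ContainsSpectrum (𝕜 := 𝕜) s L)
    (hs : ∀ i, ∀ z ∉ s, ∃ Q : 𝕜[X], aeval z Q = 0 ∧ IsUnit (aeval (d i) Q * p i + (1 - p i)))
    (hs' : ∀ i, ∀ z ∉ s', ∃ Q : 𝕜[X], aeval z Q = 0 ∧ IsUnit (aeval (d i) Q * (1 - p i) + p i))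
    (h0 : (0 : ℂ) ∉ s) {κ : 𝕜}
    (hκ : κ = 1 ∨ s ^ n ∩ s = ∅)
    (hres : ∀ j, 1 ≤ j → j ≤ n → (s ^ (n - j) * s' ^ j) ∩ s = ∅) (hκ01 : κ = 0 ∨ κ = 1) :
    IsUnit (L - (1 - algebraMap 𝕜 B κ * (List.ofFn p).prod) * (List.ofFn d).prod) := by
  replace ht : ∀ c : 𝕜, t (algebraMap 𝕜 B c) = algebraMap ℂ C (algebraMap 𝕜 ℂ c) := fun c =>
    (ht c).trans (Algebra.algebraMap_eq_smul_one _).symm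
  apply hrefl
  by_contra hK
  set S : Set C := {t L} ∪ (range (fun i => t (d i)) ∪ range fun i => t (p i)) with hS
  have hScomm : ∀ x ∈ S, ∀ y ∈ S, Commute x y := by
    rintro x (rfl | ⟨i, rfl⟩ | ⟨i, rfl⟩) y (rfl | ⟨j, rfl⟩ | ⟨j, rfl⟩)
    · exact Commute.refl _
    · exact (hLd j).map t
    · exact (hLp j).map t
    · exact ((hLd i).map t).symm
    · exact (hdd i j).map t
    · exact (hdp i j).map t
    · exact ((hLp i).map t).symm
    · exact ((hdp j i).map t).symm
    · exact (hpp i j).map t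
  obtain ⟨𝒜, hS𝒜, hcomm, hchar⟩ := exists_character hScomm
  have hLm : t L ∈ 𝒜 := hS𝒜 (Or.inl rfl)
  have hdm : ∀ i, t (d i) ∈ 𝒜 := fun i => hS𝒜 (Or.inr (Or.inl ⟨i, rfl⟩))
  have hpm : ∀ i, t (p i) ∈ 𝒜 := fun i => hS𝒜 (Or.inr (Or.inr ⟨i, rfl⟩))
  set L' : 𝒜 := ⟨t L, hLm⟩
  set d' : Fin n → 𝒜 := fun i => ⟨t (d i), hdm i⟩ with hd'
  set p' : Fin n → 𝒜 := fun i => ⟨t (p i), hpm i⟩ with hp'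
  have hlist : ∀ (x : Fin n → B) (x' : Fin n → 𝒜), (∀ i, (x' i : C) = t (x i)) →
      ((List.ofFn x').map Subtype.val).prod = t (List.ofFn x).prod := by
    intro x x' h
    rw [map_list_prod, List.map_ofFn, List.map_ofFn]
    congr 2
    funext i
    exact h i
  have hpoly : ∀ (Q : 𝕜[X]) (x : B),
      aeval (t x) (Q.map (algebraMap 𝕜 ℂ)) = t (aeval x Q) := by
    intro Q x
    rw [aeval_def, aeval_def, hom_eval₂, eval₂_map]
    congr 1
    ext c
    simp [ht]
  obtain ⟨φ, hφ0, hφ⟩ := hchar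
    (L' - (1 - algebraMap ℂ 𝒜 (algebraMap 𝕜 ℂ κ) * (List.ofFn p').prod) * (List.ofFn d').prod) (by
      convert hK using 1
      push_cast
      rw [map_sub, map_mul, map_sub, map_one, map_mul, ht, hlist p p' fun i => rfl,
        hlist d d' fun i => rfl])
  have hφp : ∀ (Q : 𝕜[X]) (x : 𝒜), φ (aeval x (Q.map (algebraMap 𝕜 ℂ))) = aeval (φ x) Q := by
    intro Q x
    rw [← Polynomial.aeval_algHom_apply, aeval_map_algebraMap]
  simp only [map_sub, map_mul, map_one, map_list_prod, List.map_ofFn, List.prod_ofFn,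
    Function.comp_apply, AlgHom.commutes, Algebra.algebraMap_self, RingHom.id_apply] at hφ0
  have hφL : φ L' ∈ s := by
    by_contra h
    obtain ⟨Q, hQ, hu⟩ := hL _ h
    refine hφ (aeval L' (Q.map (algebraMap 𝕜 ℂ))) ?_ ((hφp Q L').trans hQ)
    push_cast
    rw [show (L' : C) = t L from rfl, hpoly Q L]
    exact hu.map t
  have hp01 : ∀ i, φ (p' i) = 0 ∨ φ (p' i) = 1 := by
    intro i
    have h1 : p' i * p' i = p' i := Subtype.ext (by
      show t (p i) * t (p i) = t (p i)
      rw [← map_mul, hp])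
    have h2 : φ (p' i) * φ (p' i) = φ (p' i) := by rw [← map_mul, h1]
    have h3 : φ (p' i) * (φ (p' i) - 1) = 0 := by rw [mul_sub, h2, mul_one, sub_self]
    rcases mul_eq_zero.1 h3 with h | h
    · exact Or.inl h
    · exact Or.inr (sub_eq_zero.1 h)
  have hd1 : ∀ i, φ (p' i) = 1 → φ (d' i) ∈ s := by
    intro i hi
    by_contra h
    obtain ⟨Q, hQ, hu⟩ := hs i _ h
    refine hφ (aeval (d' i) (Q.map (algebraMap 𝕜 ℂ)) * p' i + (1 - p' i)) ?_ ?_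
    · convert hu.map t using 1
      push_cast
      simp [hp', hd', hpoly]
    · rw [map_add, map_mul, map_sub, hφp, hQ, hi]
      simp
  have hd0 : ∀ i, φ (p' i) = 0 → φ (d' i) ∈ s' := by
    intro i hi
    by_contra h
    obtain ⟨Q, hQ, hu⟩ := hs' i _ h
    refine hφ (aeval (d' i) (Q.map (algebraMap 𝕜 ℂ)) * (1 - p' i) + p' i) ?_ ?_
    · convert hu.map t using 1
      push_cast
      simp [hp', hd', hpoly]
    · rw [map_add, map_mul, map_sub, hφp, hQ, hi]
      simp
  set J := Finset.univ.filter fun i => φ (p' i) = 0 with hJ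
  rcases Finset.eq_empty_or_nonempty J with hJe | hJn
  · have hall : ∀ i, φ (p' i) = 1 := fun i => (hp01 i).resolve_left fun h => by
      have : i ∈ J := by simp [hJ, h]
      simp [hJe] at this
    rw [Finset.prod_eq_one fun i _ => hall i, mul_one] at hφ0
    rcases hκ01 with rfl | rfl
    · rcases hκ with hκ | hκ
      · have h1 : (1 : ℂ) = 0 := by
          have := congrArg (algebraMap 𝕜 ℂ) hκ
          simpa using this.symm
        exact one_ne_zero h1
      · rw [map_zero, sub_zero, one_mul] at hφ0
        have hmem : ∏ i, φ (d' i) ∈ s ^ n := by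
          have := Set.finsetProd_mem_finsetProd Finset.univ (fun _ => s) (fun i => φ (d' i))
            fun i _ => hd1 i (hall i)
          simpa using this
        have : φ L' ∈ s ^ n ∩ s := ⟨by rwa [sub_eq_zero.1 hφ0], hφL⟩
        rw [hκ] at this
        exact this
    · rw [map_one, sub_self, zero_mul, sub_zero] at hφ0
      exact h0 (hφ0 ▸ hφL)
  · obtain ⟨i, hi⟩ := hJn
    have hi' : φ (p' i) = 0 := by simpa [hJ] using hi
    rw [Finset.prod_eq_zero (Finset.mem_univ i) hi', mul_zero, sub_zero, one_mul] at hφ0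
    have hcard : J.card ≤ n := by simpa using Finset.card_le_univ J
    have hmem : ∏ i, φ (d' i) ∈ s ^ (n - J.card) * s' ^ J.card := by
      rw [← Finset.prod_compl_mul_prod J]
      refine Set.mul_mem_mul ?_ ?_
      · have := Set.finsetProd_mem_finsetProd Jᶜ (fun _ => s) (fun i => φ (d' i))
          fun i hi => hd1 i ((hp01 i).resolve_left fun h => by simp [hJ, h] at hi)
        simpa [Finset.card_compl] using this
      · have := Set.finsetProd_mem_finsetProd J (fun _ => s') (fun i => φ (d' i))
          fun i hi => hd0 i (by simpa [hJ] using hi)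
        simpa using this
    have : φ L' ∈ (s ^ (n - J.card) * s' ^ J.card) ∩ s := ⟨by rwa [sub_eq_zero.1 hφ0], hφL⟩
    rw [hres J.card (Finset.card_pos.2 ⟨i, hi⟩) hcard] at this
    exact this

end Commuting

end InvFoliation

namespace InvFoliation
open Set Filter Topology Asymptotics Polynomial

universe v

/-! ### Transposes on complex valued functionals -/

section Transpose

variable {𝕜 : Type*} [RCLike 𝕜] [NormedAlgebra 𝕜 ℂ] {E : Type v} [NormedAddCommGroup E]
  [NormedSpace 𝕜 E]

lemma exists_complex_dual_vector (x : E) : ∃ ψ : E →L[𝕜] ℂ, ‖ψ‖ ≤ 1 ∧ ‖ψ x‖ = ‖x‖ := by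
  obtain ⟨g, hg, hgx⟩ := exists_dual_vector'' 𝕜 x
  refine ⟨(Algebra.linearMap 𝕜 ℂ).mkContinuous 1 (fun c => by simp) |>.comp g, ?_, ?_⟩
  · refine (ContinuousLinearMap.opNorm_comp_le _ _).trans ?_
    refine mul_le_one₀ (LinearMap.mkContinuous_norm_le _ zero_le_one _) (norm_nonneg _) hg
  · simp [hgx, norm_algebraMap']

variable (𝕜 E) in
/-- The bounded operators on the complex Banach space of complex valued functionals on `E`. -/
abbrev DualOperators : Type _ := (E →L[𝕜] ℂ) →L[ℂ] (E →L[𝕜] ℂ)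

/-- The transpose of an operator, acting on the complex Banach space of complex valued functionals.
It replaces the complexification of a real Banach space. -/
noncomputable def transpose (T : E →L[𝕜] E) : DualOperators 𝕜 E :=
  LinearMap.mkContinuous
    { toFun := fun ψ => ψ.comp T
      map_add' := fun _ _ => rfl
      map_smul' := fun _ _ => rfl } ‖T‖
    fun ψ => (ContinuousLinearMap.opNorm_comp_le ψ T).trans_eq (mul_comm _ _)

@[simp] lemma transpose_apply (T : E →L[𝕜] E) (ψ : E →L[𝕜] ℂ) (x : E) :
    transpose T ψ x = ψ (T x) := rfl

variable (𝕜 E) in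
/-- The transpose as a ring homomorphism on the opposite algebra. -/
noncomputable def transposeHom :
    (E →L[𝕜] E)ᵐᵒᵖ →+* DualOperators 𝕜 E where
  toFun T := transpose T.unop
  map_one' := rfl
  map_mul' _ _ := rfl
  map_zero' := by ext; simp
  map_add' _ _ := by ext; simp

lemma transposeHom_algebraMap (c : 𝕜) :
    transposeHom 𝕜 E (algebraMap 𝕜 _ c) =
      algebraMap 𝕜 ℂ c • (1 : DualOperators 𝕜 E) := by
  refine ContinuousLinearMap.ext fun ψ => ContinuousLinearMap.ext fun x => ?_
  have h1 : ψ ((algebraMap 𝕜 (E →L[𝕜] E)ᵐᵒᵖ c).unop x) = ψ (c • x) := rfl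
  refine h1.trans ?_
  rw [map_smul, Algebra.smul_def]
  rfl

lemma transpose_pow (T : E →L[𝕜] E) (n : ℕ) : transpose (T ^ n) = transpose T ^ n := by
  have := map_pow (transposeHom 𝕜 E) (MulOpposite.op T) n
  rwa [← MulOpposite.op_pow] at this

lemma norm_le_norm_transpose (T : E →L[𝕜] E) : ‖T‖ ≤ ‖transpose T‖ := by
  refine ContinuousLinearMap.opNorm_le_bound T (norm_nonneg (transpose T)) fun x => ?_
  obtain ⟨ψ, hψ, hψx⟩ := exists_complex_dual_vector (𝕜 := 𝕜) (T x)
  rw [← hψx, ← transpose_apply]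
  refine ((transpose T ψ).le_opNorm x).trans ?_
  gcongr
  exact (transpose T).le_of_opNorm_le_of_le le_rfl hψ |>.trans_eq (mul_one _)

lemma isUnit_of_isUnit_transpose [CompleteSpace E] {T : E →L[𝕜] E} (h : IsUnit (transpose T)) :
    IsUnit T := by
  obtain ⟨u, hu⟩ := h
  have h1 : ∀ ψ : E →L[𝕜] ℂ, ((u⁻¹ : Units _) : DualOperators 𝕜 E)
      (transpose T ψ) = ψ := fun ψ => by
    rw [← hu, ← mul_apply_eq_comp, Units.inv_mul]; rfl
  have h2 : ∀ ψ : E →L[𝕜] ℂ, transpose T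
      (((u⁻¹ : Units _) : DualOperators 𝕜 E) ψ) = ψ := fun ψ => by
    rw [← hu, ← mul_apply_eq_comp, Units.mul_inv]; rfl
  set S := ((u⁻¹ : Units _) : DualOperators 𝕜 E)
  rw [ContinuousLinearMap.isUnit_iff_bijective]
  have hanti : AntilipschitzWith ‖S‖₊ T := by
    refine ContinuousLinearMap.antilipschitz_of_bound T fun x => ?_
    obtain ⟨ψ, hψ, hψx⟩ := exists_complex_dual_vector (𝕜 := 𝕜) x
    rw [← hψx, ← h2 ψ, transpose_apply]
    refine ((S ψ).le_opNorm _).trans ?_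
    rw [coe_nnnorm]
    gcongr
    exact S.le_of_opNorm_le_of_le le_rfl hψ |>.trans_eq (mul_one _)
  refine ⟨hanti.injective, ?_⟩
  have hcl : IsClosed (LinearMap.range (T : E →ₗ[𝕜] E) : Set E) := by
    exact hanti.isClosed_range T.uniformContinuous
  set p := LinearMap.range (T : E →ₗ[𝕜] E) with hp
  have : IsClosed (p : Set E) := hcl
  rw [← Set.range_eq_univ, Set.eq_univ_iff_forall]
  intro y
  obtain ⟨ψ, -, hψy⟩ := exists_complex_dual_vector (𝕜 := 𝕜) (p.mkQ y)
  have h3 : transpose T (ψ.comp p.mkQL) = 0 := by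
    ext x
    have : p.mkQ (T x) = 0 := by
      rw [Submodule.mkQ_apply, Submodule.Quotient.mk_eq_zero]
      exact ⟨x, rfl⟩
    have h4 : ψ (p.mkQ (T x)) = 0 := by rw [this, map_zero]
    exact h4
  have h4 : ψ.comp p.mkQL = 0 := by rw [← h1 (ψ.comp p.mkQL), h3, map_zero]
  have h5 : ψ (p.mkQ y) = 0 := DFunLike.congr_fun h4 y
  rw [h5, norm_zero] at hψy
  have h6 : p.mkQ y = 0 := norm_eq_zero.1 hψy.symm
  rw [Submodule.mkQ_apply, Submodule.Quotient.mk_eq_zero] at h6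
  exact h6

lemma spectrum_transpose_subset {s : Set ℂ} {T : E →L[𝕜] E} (h : ContainsSpectrum (𝕜 := 𝕜) s T) :
    spectrum ℂ (transpose T) ⊆ s := by
  intro z hz
  by_contra hzs
  obtain ⟨Q, hQ, hu⟩ := h z hzs
  have h1 : aeval (transpose T) (Q.map (algebraMap 𝕜 ℂ)) = transpose (aeval T Q) := by
    have h2 := hom_eval₂ Q (algebraMap 𝕜 (E →L[𝕜] E)ᵐᵒᵖ) (transposeHom 𝕜 E) (MulOpposite.op T)
    have h3 : eval₂ (algebraMap 𝕜 (E →L[𝕜] E)ᵐᵒᵖ) (MulOpposite.op T) Q =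
        MulOpposite.op (aeval T Q) := by
      clear h2 hu hQ
      induction Q using Polynomial.induction_on' with
      | add p q hp hq => rw [eval₂_add, hp, hq, map_add, MulOpposite.op_add]
      | monomial n c =>
        rw [eval₂_monomial, aeval_monomial, MulOpposite.op_mul, MulOpposite.op_pow]
        exact Algebra.commutes c _
    rw [h3] at h2
    have h4 : (transposeHom 𝕜 E).comp (algebraMap 𝕜 (E →L[𝕜] E)ᵐᵒᵖ) =
      (algebraMap ℂ (DualOperators 𝕜 E)).comp (algebraMap 𝕜 ℂ) :=
      RingHom.ext fun c => transposeHom_algebraMap c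
    rw [aeval_def, eval₂_map, ← h4]
    exact h2.symm
  have h2 : IsUnit (transpose (aeval T Q)) := hu.op.map (transposeHom 𝕜 E)
  rw [← h1] at h2
  have h3 : (Q.map (algebraMap 𝕜 ℂ)).IsRoot z := by
    rw [IsRoot.def, eval_map_algebraMap]; exact hQ
  obtain ⟨q, hq⟩ := dvd_iff_isRoot.2 h3
  rw [hq, map_mul] at h2
  have h5 := (Commute.isUnit_mul_iff (by
    rw [Commute, SemiconjBy, ← map_mul, ← map_mul, mul_comm])).1 h2
  refine hz ?_
  rw [spectrum.mem_resolventSet_iff]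
  have h6 := h5.1
  rw [map_sub, aeval_X, aeval_C] at h6
  exact IsUnit.sub_iff.1 h6

end Transpose

end InvFoliation

namespace InvFoliation
open Set Filter Topology Asymptotics Polynomial

universe v

/-! ### Spectra and bounds of powers -/

section PowerBounds

/-- The consequence of Gelfand's formula used below: `ρ` is the spectral radius. -/
lemma exists_radius {C : Type*} [NormedRing C] [NormedAlgebra ℂ C] [CompleteSpace C] (x : C) :
    ∃ ρ : ℝ, 0 ≤ ρ ∧ (ρ = 0 ∨ ∃ z ∈ spectrum ℂ x, ‖z‖ = ρ) ∧
      ∀ b, ρ < b → ∃ N : ℕ, ‖x ^ N‖ < b ^ N := by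
  rcases subsingleton_or_nontrivial C with h | h
  · refine ⟨0, le_rfl, Or.inl rfl, fun b hb => ⟨1, ?_⟩⟩
    rw [Subsingleton.elim (x ^ 1) 0, norm_zero, pow_one]
    exact hb
  · obtain ⟨z, hz, hzr⟩ := spectrum.exists_nnnorm_eq_spectralRadius x
    refine ⟨‖z‖, norm_nonneg z, Or.inr ⟨z, hz, rfl⟩, fun b hb => ?_⟩
    have hb0 : 0 < b := (norm_nonneg z).trans_lt hb
    have h1 := spectrum.pow_nnnorm_pow_one_div_tendsto_nhds_spectralRadius x
    rw [← hzr] at h1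
    have h2 : (‖z‖₊ : ENNReal) < ENNReal.ofReal b := by
      rw [← ENNReal.ofReal_coe_nnreal, coe_nnnorm]
      exact (ENNReal.ofReal_lt_ofReal_iff hb0).2 hb
    obtain ⟨N, hN, hN0⟩ := ((h1.eventually (gt_mem_nhds h2)).and (eventually_gt_atTop 0)).exists
    refine ⟨N, ?_⟩
    rw [one_div, ENNReal.rpow_inv_lt_iff (by exact_mod_cast hN0), ENNReal.rpow_natCast,
      ← ENNReal.ofReal_pow hb0.le, ← ENNReal.ofReal_coe_nnreal, coe_nnnorm,
      ENNReal.ofReal_lt_ofReal_iff (by positivity)] at hN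
    exact hN

variable {𝕜 : Type*} [RCLike 𝕜] [NormedAlgebra 𝕜 ℂ] {E : Type v} [NormedAddCommGroup E]
  [NormedSpace 𝕜 E] {F : Type v} [NormedAddCommGroup F] [NormedSpace 𝕜 F]

lemma exists_power_bounds {s s' : Set ℂ} {T : E →L[𝕜] E} {T' : F →L[𝕜] F}
    (hT : ContainsSpectrum (𝕜 := 𝕜) s T) (hT' : ContainsSpectrum (𝕜 := 𝕜) s' T')
    (hs : s ⊆ Metric.ball 0 1) {ℓ : ℕ} (hss' : s' * s ^ (ℓ + 1) ⊆ Metric.ball 0 1) :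
    ∃ a : ℝ, 0 < a ∧ a < 1 ∧ ∃ N N' : ℕ, ‖T ^ N‖ < a ^ N ∧ ‖T' ^ N'‖ * a ^ ((ℓ + 1) * N') < 1 := by
  obtain ⟨ρ, hρ0, hρ, hρb⟩ := exists_radius (transpose T)
  obtain ⟨ρ', hρ'0, hρ', hρ'b⟩ := exists_radius (transpose T')
  have h1 : ρ < 1 := by
    rcases hρ with h | ⟨z, hz, hzρ⟩
    · rw [h]; exact one_pos
    · rw [← hzρ]
      exact mem_ball_zero_iff.1 (hs (spectrum_transpose_subset hT hz))
  have h2 : ρ' * ρ ^ (ℓ + 1) < 1 := by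
    rcases hρ with h | ⟨z, hz, hzρ⟩
    · rw [h]; simp
    rcases hρ' with h | ⟨z', hz', hzρ'⟩
    · rw [h]; simp
    · have := hss' (Set.mul_mem_mul (spectrum_transpose_subset hT' hz')
        (Set.pow_mem_pow (spectrum_transpose_subset hT hz)))
      rwa [mem_ball_zero_iff, norm_mul, norm_pow, hzρ, hzρ'] at this
  have h3 : ∀ᶠ a in 𝓝[>] ρ, a < 1 ∧ ρ' * a ^ (ℓ + 1) < 1 ∧ ρ < a := by
    have h4 : ContinuousAt (fun a : ℝ => ρ' * a ^ (ℓ + 1)) ρ := by fun_prop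
    have h5 : ∀ᶠ a in 𝓝 ρ, a < 1 ∧ ρ' * a ^ (ℓ + 1) < 1 :=
      Filter.Eventually.and (gt_mem_nhds h1) (h4.eventually (gt_mem_nhds h2))
    filter_upwards [nhdsWithin_le_nhds h5, self_mem_nhdsWithin] with a ha ha'
    exact ⟨ha.1, ha.2, ha'⟩
  obtain ⟨a, ha1, ha2, ha3⟩ := h3.exists
  have ha0 : 0 < a := hρ0.trans_lt ha3
  have h4 : ρ' < (a ^ (ℓ + 1))⁻¹ := by rwa [← one_div, lt_div_iff₀ (by positivity)]
  obtain ⟨N, hN⟩ := hρb a ha3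
  obtain ⟨N', hN'⟩ := hρ'b _ h4
  refine ⟨a, ha0, ha1, N, N', ?_, ?_⟩
  · rw [← transpose_pow] at hN
    exact (norm_le_norm_transpose _).trans_lt hN
  · rw [← transpose_pow, inv_pow, ← one_div, lt_div_iff₀ (by positivity), ← pow_mul] at hN'
    refine lt_of_le_of_lt ?_ hN'
    gcongr
    exact norm_le_norm_transpose _

omit [RCLike 𝕜] [NormedAlgebra 𝕜 ℂ] in
lemma ContainsSpectrum.isUnit {𝕜 B : Type*} [Field 𝕜] [Algebra 𝕜 ℂ] [Ring B] [Algebra 𝕜 B]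
    {s : Set ℂ} {T : B} (h : ContainsSpectrum (𝕜 := 𝕜) s T) (h0 : (0 : ℂ) ∉ s) : IsUnit T := by
  obtain ⟨Q, hQ, hu⟩ := h 0 h0
  have h1 : X ∣ Q := by
    rw [X_dvd_iff]
    have : algebraMap 𝕜 ℂ (Q.coeff 0) = 0 := by
      rw [← hQ, ← coeff_zero_eq_aeval_zero']
    simpa using this
  obtain ⟨q, rfl⟩ := h1
  rw [map_mul] at hu
  have h5 := (Commute.isUnit_mul_iff (by
    rw [Commute, SemiconjBy, ← map_mul, ← map_mul, mul_comm])).1 hu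
  simpa using h5.1

end PowerBounds

section Fields

lemma containsSpectrum_complex {E : Type v} [NormedAddCommGroup E] [NormedSpace ℂ E]
    (T : E →L[ℂ] E) : ContainsSpectrum (𝕜 := ℂ) (complexSpectrum T) T := by
  intro z hz
  refine ⟨X - C z, by simp, ?_⟩
  rw [complexSpectrum, spectrum.notMem_iff] at hz
  rw [map_sub, aeval_X, aeval_C]
  exact IsUnit.sub_iff.1 hz

/-- If `z = a + i b` is not in the spectrum of the complexification of `T`, neither is its
conjugate, and `(T - a)² + b²` is invertible. -/
lemma containsSpectrum_real {E : Type v} [NormedAddCommGroup E] [NormedSpace ℝ E] [CompleteSpace E]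
    (T : E →L[ℝ] E) : ContainsSpectrum (𝕜 := ℝ) (realSpectrum T) T := by
  intro z hz
  set Tc : (ℂ ⊗[ℝ] E) →ₗ[ℂ] (ℂ ⊗[ℝ] E) := LinearMap.baseChange ℂ (T : E →ₗ[ℝ] E) with hTc
  rw [realSpectrum, spectrum.notMem_iff, Module.End.isUnit_iff] at hz
  refine ⟨(X - C z.re) ^ 2 + C (z.im ^ 2), ?_, ?_⟩
  · simp only [map_add, map_pow, map_sub, aeval_X, aeval_C]
    apply Complex.ext <;> simp [pow_two]
  set Q : E →L[ℝ] E := aeval T ((X - C z.re) ^ 2 + C (z.im ^ 2)) with hQ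
  have hQapp : ∀ x, Q x = T (T x) - (2 * z.re) • T x + (z.re ^ 2 + z.im ^ 2) • x := by
    intro x
    simp only [hQ, map_add, aeval_C, pow_two]
    simp [Algebra.algebraMap_eq_smul_one]
    module
  -- Complex conjugation of the coefficients commutes with the complexification of `T`.
  set σ : (ℂ ⊗[ℝ] E) →ₗ[ℝ] (ℂ ⊗[ℝ] E) := LinearMap.rTensor E (Complex.conjAe.toLinearMap) with hσ
  have hσσ : ∀ y, σ (σ y) = y := by
    intro y
    induction y using TensorProduct.induction_on with
    | zero => simp
    | tmul c x => simp [hσ]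
    | add x y hx hy => rw [map_add, map_add, hx, hy]
  have hσT : ∀ y, σ (Tc y) = Tc (σ y) := by
    intro y
    induction y using TensorProduct.induction_on with
    | zero => simp
    | tmul c x => simp [hσ, hTc]
    | add x y hx hy => simp only [map_add, hx, hy]
  have hσs : ∀ (c : ℂ) y, σ (c • y) = (starRingEnd ℂ c) • σ y := by
    intro c y
    induction y using TensorProduct.induction_on with
    | zero => simp
    | tmul c x => simp [hσ, TensorProduct.smul_tmul']
    | add x y hx hy => simp only [map_add, smul_add, hx, hy]
  have hz' : Function.Bijective (fun y => (starRingEnd ℂ z) • y - Tc y) := by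
    have h1 : (fun y => (starRingEnd ℂ z) • y - Tc y) =
        σ ∘ (algebraMap ℂ (Module.End ℂ (ℂ ⊗[ℝ] E)) z - Tc) ∘ σ := by
      funext y
      simp [hσs, hσT, hσσ]
    have h2 : Function.Bijective σ := Function.Involutive.bijective hσσ
    rw [h1]
    exact h2.comp (hz.comp h2)
  set R : (ℂ ⊗[ℝ] E) → (ℂ ⊗[ℝ] E) := fun y => Tc (Tc y) - ((2 * z.re : ℝ) : ℂ) • Tc y +
    ((z.re ^ 2 + z.im ^ 2 : ℝ) : ℂ) • y with hR
  have hRb : Function.Bijective R := by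
    have h1 : R = (fun y => (starRingEnd ℂ z) • y - Tc y) ∘
        (algebraMap ℂ (Module.End ℂ (ℂ ⊗[ℝ] E)) z - Tc) := by
      funext y
      have e1 : ((2 * z.re : ℝ) : ℂ) = z + starRingEnd ℂ z := by
        rw [Complex.add_conj]
      have e2 : ((z.re ^ 2 + z.im ^ 2 : ℝ) : ℂ) = starRingEnd ℂ z * z := by
        rw [mul_comm, Complex.mul_conj, Complex.normSq_apply]; push_cast; ring
      simp only [hR, e1, e2, Function.comp_apply, LinearMap.sub_apply, Module.algebraMap_end_apply,
        map_sub, map_smul]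
      module
    rw [h1]
    exact hz'.comp hz
  -- The bijectivity of `R` on `ℂ ⊗ E` descends to `Q` by taking real parts.
  set ρ : (ℂ ⊗[ℝ] E) →ₗ[ℝ] E :=
    TensorProduct.lift ((LinearMap.lsmul ℝ E).comp Complex.reLm) with hρ
  have hρ1 : ∀ x : E, ρ ((1 : ℂ) ⊗ₜ x) = x := fun x => by simp [hρ]
  have hρR : ∀ y, ρ (R y) = Q (ρ y) := by
    have h1 : ∀ y, ρ (Tc y) = T (ρ y) := by
      intro y
      induction y using TensorProduct.induction_on with
      | zero => simp
      | tmul c x => simp [hρ, hTc]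
      | add x y hx hy => simp only [map_add, hx, hy]
    have h2 : ∀ (c : ℝ) y, ρ ((c : ℂ) • y) = c • ρ y := by
      intro c y
      rw [Complex.coe_smul, map_smul]
    intro y
    simp only [hR, map_add, map_sub, h1, h2, hQapp]
  have hR1 : ∀ x : E, R ((1 : ℂ) ⊗ₜ x) = (1 : ℂ) ⊗ₜ Q x := by
    intro x
    rw [hQapp, TensorProduct.tmul_add, TensorProduct.tmul_sub, TensorProduct.tmul_smul,
      TensorProduct.tmul_smul]
    simp only [hR, hTc, LinearMap.baseChange_tmul, Complex.coe_smul]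
    rfl
  rw [ContinuousLinearMap.isUnit_iff_bijective]
  constructor
  · intro x y hxy
    have h1 : R ((1 : ℂ) ⊗ₜ x) = R ((1 : ℂ) ⊗ₜ y) := by rw [hR1, hR1, hxy]
    rw [← hρ1 x, hRb.1 h1, hρ1]
  · intro y
    obtain ⟨w, hw⟩ := hRb.2 ((1 : ℂ) ⊗ₜ y)
    exact ⟨ρ w, by rw [← hρR, hw, hρ1]⟩

end Fields

end InvFoliation

namespace InvFoliation
open Set Filter Topology Asymptotics Polynomial

universe v

/-! ### The homological operator -/

section Homological

variable {𝕜 : Type*} [RCLike 𝕜] {X : Type v} [NormedAddCommGroup X]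
  [NormedSpace 𝕜 X] {F : Type v} [NormedAddCommGroup F] [NormedSpace 𝕜 F]
  {G : Type v} [NormedAddCommGroup G] [NormedSpace 𝕜 G] {n : ℕ}

variable (F) in
/-- The operator `p ↦ p (f 0 ·, …, f (n - 1) ·)` on multilinear maps. -/
noncomputable def pullback (f : Fin n → X →L[𝕜] X) : (X [×n]→L[𝕜] F) →L[𝕜] (X [×n]→L[𝕜] F) :=
  ContinuousMultilinearMap.compContinuousLinearMapContinuousMultilinear 𝕜
    (fun _ : Fin n => X) (fun _ => X) F f

variable (F) in
lemma continuous_pullback :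
    Continuous (pullback F : (Fin n → X →L[𝕜] X) → (X [×n]→L[𝕜] F) →L[𝕜] (X [×n]→L[𝕜] F)) :=
  ContinuousMultilinearMap.cont _

lemma pullback_apply (f : Fin n → X →L[𝕜] X) (p : X [×n]→L[𝕜] F) (v : Fin n → X) :
    pullback F f p v = p fun i => f i (v i) := rfl

lemma pullback_mul (f g : Fin n → X →L[𝕜] X) :
    pullback F f * pullback F g = pullback F (g * f) := by
  refine ContinuousLinearMap.ext fun p => ContinuousMultilinearMap.ext fun v => ?_
  rfl

lemma pullback_one : pullback F (1 : Fin n → X →L[𝕜] X) = 1 := by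
  refine ContinuousLinearMap.ext fun p => ContinuousMultilinearMap.ext fun v => ?_
  rfl

lemma mulSingle_apply_vec (i : Fin n) (T : X →L[𝕜] X) (v : Fin n → X) :
    (fun j => (Pi.mulSingle i T : Fin n → X →L[𝕜] X) j (v j)) = Function.update v i (T (v i)) := by
  funext j
  rcases eq_or_ne j i with rfl | h
  · simp
  · simp [Pi.mulSingle_eq_of_ne h, Function.update_of_ne h]

variable (𝕜 X F) in
/-- Composition with an operator in the `i`-th argument of multilinear maps. -/
noncomputable def slot (i : Fin n) :
    (X →L[𝕜] X) →ₐ[𝕜] ((X [×n]→L[𝕜] F) →L[𝕜] (X [×n]→L[𝕜] F))ᵐᵒᵖ :=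
  AlgHom.ofLinearMap
    { toFun := fun T => MulOpposite.op (pullback F (Pi.mulSingle i T))
      map_add' := fun T T' => by
        rw [← MulOpposite.op_add]
        congr 1
        refine ContinuousLinearMap.ext fun p => ContinuousMultilinearMap.ext fun v => ?_
        rw [_root_.add_apply, _root_.add_apply, pullback_apply, pullback_apply,
          pullback_apply, mulSingle_apply_vec, mulSingle_apply_vec, mulSingle_apply_vec,
          _root_.add_apply, ContinuousMultilinearMap.map_update_add]
      map_smul' := fun c T => by
        rw [← MulOpposite.op_smul]
        congr 1
        refine ContinuousLinearMap.ext fun p => ContinuousMultilinearMap.ext fun v => ?_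
        rw [RingHom.id_apply, _root_.smul_apply, _root_.smul_apply, pullback_apply,
          pullback_apply, mulSingle_apply_vec, mulSingle_apply_vec,
          _root_.smul_apply, ContinuousMultilinearMap.map_update_smul] }
    (by
      show MulOpposite.op (pullback F (Pi.mulSingle i 1)) = 1
      rw [Pi.mulSingle_one, pullback_one]; rfl)
    (fun T T' => by
      show MulOpposite.op (pullback F (Pi.mulSingle i (T * T'))) =
        MulOpposite.op (pullback F (Pi.mulSingle i T)) *
          MulOpposite.op (pullback F (Pi.mulSingle i T'))
      rw [← MulOpposite.op_mul, pullback_mul, Pi.mulSingle_mul])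

lemma slot_apply (i : Fin n) (T : X →L[𝕜] X) :
    slot 𝕜 X F i T = MulOpposite.op (pullback F (Pi.mulSingle i T)) := rfl

lemma slot_commute (i j : Fin n) {T T' : X →L[𝕜] X} (h : Commute T T') :
    Commute (slot 𝕜 X F i T) (slot 𝕜 X F j T') := by
  rw [Commute, SemiconjBy, slot_apply, slot_apply, ← MulOpposite.op_mul, ← MulOpposite.op_mul,
    pullback_mul, pullback_mul]
  congr 2
  rcases eq_or_ne i j with rfl | hij
  · rw [← Pi.mulSingle_mul, ← Pi.mulSingle_mul, h.eq]
  · exact (Pi.mulSingle_commute (f := fun _ : Fin n => X →L[𝕜] X) hij T T').eq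

lemma prod_slot (T : X →L[𝕜] X) :
    (List.ofFn fun i : Fin n => slot 𝕜 X F i T).prod = MulOpposite.op (pullback F fun _ => T) := by
  have h : ∀ l : List (Fin n), l.Nodup → (l.map fun i : Fin n => slot 𝕜 X F i T).prod =
      MulOpposite.op (pullback F fun i => if i ∈ l then T else 1) := by
    intro l hl
    induction l with
    | nil =>
      simp only [List.map_nil, List.prod_nil, List.not_mem_nil, if_false]
      exact congrArg MulOpposite.op (pullback_one (𝕜 := 𝕜) (X := X) (F := F)).symm
    | cons i l ih =>
      obtain ⟨hi, hl⟩ := List.nodup_cons.1 hl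
      rw [List.map_cons, List.prod_cons, ih hl, slot_apply, ← MulOpposite.op_mul, pullback_mul]
      congr 2
      funext j
      rcases eq_or_ne j i with rfl | h
      · simp [hi]
      · simp [h]
  rw [List.ofFn_eq_map, h _ (List.nodup_finRange n)]
  simp

variable (X n) in
/-- Composition of multilinear maps with an operator from the left. -/
noncomputable def postcomp (S : F →L[𝕜] F) : (X [×n]→L[𝕜] F) →L[𝕜] (X [×n]→L[𝕜] F) :=
  ContinuousLinearMap.compContinuousMultilinearMapL 𝕜 (fun _ : Fin n => X) F F S

lemma postcomp_slot_commute (S : F →L[𝕜] F) (i : Fin n) (T : X →L[𝕜] X) :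
    Commute (MulOpposite.op (postcomp X n S)) (slot 𝕜 X F i T) := by
  rw [Commute, SemiconjBy, slot_apply, ← MulOpposite.op_mul, ← MulOpposite.op_mul]
  rfl

/-- The homological operator for terms of order `n`: `p ↦ S p - p ∘ A + κ p ∘ A ∘ P`. -/
noncomputable def homological (n : ℕ) (κ : 𝕜) (S : F →L[𝕜] F) (A P : X →L[𝕜] X) :
    (X [×n]→L[𝕜] F) →L[𝕜] (X [×n]→L[𝕜] F) :=
  postcomp X n S - (pullback F (fun _ => A) - κ • pullback F fun _ => A * P)

lemma homological_apply (κ : 𝕜) (S : F →L[𝕜] F) (A P : X →L[𝕜] X) (p : X [×n]→L[𝕜] F)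
    (v : Fin n → X) : homological n κ S A P p v =
      S (p v) - (p (fun i => A (v i)) - κ • p fun i => A (P (v i))) := rfl

variable [NormedAlgebra 𝕜 ℂ]

lemma containsSpectrum_postcomp {s : Set ℂ} {S : F →L[𝕜] F}
    (h : ContainsSpectrum (𝕜 := 𝕜) s S) :
    ContainsSpectrum (𝕜 := 𝕜) s (MulOpposite.op (postcomp X n S)) := by
  intro z hz
  obtain ⟨Q, hQ, hu⟩ := h z hz
  refine ⟨Q, hQ, ?_⟩
  have h1 : ∀ Q : 𝕜[X], aeval (MulOpposite.op (postcomp X n S)) Q =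
      MulOpposite.op (postcomp X n (aeval S Q)) := by
    intro Q
    induction Q using Polynomial.induction_on with
    | C c => rw [aeval_C, aeval_C]; rfl
    | add p q hp hq => rw [map_add, map_add, hp, hq]; rfl
    | monomial k c ih =>
      rw [pow_succ, ← mul_assoc, map_mul _ (C c * Polynomial.X ^ k),
        map_mul _ (C c * Polynomial.X ^ k), ih, aeval_X, aeval_X, ← MulOpposite.op_mul]
      congr 1
      have : Commute (aeval S (C c * Polynomial.X ^ k)) S := by
        have h2 := Commute.all (C c * Polynomial.X ^ k) (Polynomial.X : 𝕜[X])
        have := h2.map (aeval S)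
        rwa [aeval_X] at this
      rw [this.eq]
      rfl
  rw [h1]
  obtain ⟨u, hu⟩ := hu
  rw [← hu]
  refine IsUnit.op ⟨⟨postcomp X n ↑u, postcomp X n ↑u⁻¹, ?_, ?_⟩, rfl⟩
  · refine ContinuousLinearMap.ext fun p => ContinuousMultilinearMap.ext fun v => ?_
    show ((↑u : F →L[𝕜] F) * (↑u⁻¹ : F →L[𝕜] F)) (p v) = p v
    rw [Units.mul_inv]; rfl
  · refine ContinuousLinearMap.ext fun p => ContinuousMultilinearMap.ext fun v => ?_
    show ((↑u⁻¹ : F →L[𝕜] F) * (↑u : F →L[𝕜] F)) (p v) = p v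
    rw [Units.inv_mul]; rfl

omit [NormedAlgebra 𝕜 ℂ] in
lemma isUnit_block {ι : F →L[𝕜] X} {P : X →L[𝕜] F} (hP : P.comp ι = .id 𝕜 F) {D : X →L[𝕜] X}
    {T : F →L[𝕜] F} (hD : D.comp ι = ι.comp T) {Q : 𝕜[X]} (hu : IsUnit (aeval T Q)) :
    IsUnit (aeval D Q * (ι.comp P) + (1 - ι.comp P)) := by
  have h1 : ∀ Q : 𝕜[X], ∀ x, aeval D Q (ι x) = ι (aeval T Q x) := by
    intro Q
    induction Q using Polynomial.induction_on with
    | C c => intro x; rw [aeval_C, aeval_C]; simp [Algebra.algebraMap_eq_smul_one]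
    | add p q hp hq => intro x; simp [hp, hq]
    | monomial k c ih =>
      intro x
      rw [pow_succ, ← mul_assoc, map_mul _ (C c * Polynomial.X ^ k),
        map_mul _ (C c * Polynomial.X ^ k), aeval_X, aeval_X]
      have := DFunLike.congr_fun hD x
      simp only [ContinuousLinearMap.comp_apply] at this
      show aeval D _ (D (ι x)) = ι (aeval T _ (T x))
      rw [this, ih]
  have hP' : ∀ x, P (ι x) = x := fun x => DFunLike.congr_fun hP x
  obtain ⟨u, hu⟩ := hu
  have hu1 : ∀ x, (↑u : F →L[𝕜] F) ((↑u⁻¹ : F →L[𝕜] F) x) = x := fun x => by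
    show ((↑u : F →L[𝕜] F) * (↑u⁻¹ : F →L[𝕜] F)) x = x
    rw [Units.mul_inv]; rfl
  have hu2 : ∀ x, (↑u⁻¹ : F →L[𝕜] F) ((↑u : F →L[𝕜] F) x) = x := fun x => by
    show ((↑u⁻¹ : F →L[𝕜] F) * (↑u : F →L[𝕜] F)) x = x
    rw [Units.inv_mul]; rfl
  refine ⟨⟨_, ι.comp ((↑u⁻¹ : F →L[𝕜] F).comp P) + (1 - ι.comp P), ?_, ?_⟩, rfl⟩
  · ext x
    simp [hP', h1, ← hu, hu1]
  · ext x
    simp [hP', h1, ← hu, hu2]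

omit [NormedAlgebra 𝕜 ℂ] in
lemma homological_eq_unop (κ : 𝕜) {S : F →L[𝕜] F} {D P : X →L[𝕜] X} (h : D * P = P * D) :
    homological n κ S D P = (MulOpposite.op (postcomp X n S) -
      (1 - algebraMap 𝕜 ((X [×n]→L[𝕜] F) →L[𝕜] (X [×n]→L[𝕜] F))ᵐᵒᵖ κ *
        (List.ofFn fun i : Fin n => slot 𝕜 X F i P).prod) *
        (List.ofFn fun i : Fin n => slot 𝕜 X F i D).prod).unop := by
  rw [prod_slot, prod_slot]
  unfold homological
  rw [h]
  rfl

/-- The homological operator is invertible in the absence of resonances. If `A` is block diagonal,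
this holds by Gelfand theory since all operators commute. The triangular case reduces to this one,
because conjugation by `P + ε (1 - P)` multiplies the off-diagonal block by `ε`, and invertibility
is an open condition. -/
lemma isUnit_homological [CompleteSpace X] [CompleteSpace F] {ι₀ : F →L[𝕜] X} {P₀ : X →L[𝕜] F}
    {ι₁ : G →L[𝕜] X} {P₁ : X →L[𝕜] G} (h00 : P₀.comp ι₀ = .id 𝕜 F) (h11 : P₁.comp ι₁ = .id 𝕜 G)
    (hsum : ι₀.comp P₀ + ι₁.comp P₁ = 1) {A : X →L[𝕜] X} (hA : P₀.comp (A.comp ι₁) = 0)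
    {s s' : Set ℂ} (hs : ContainsSpectrum (𝕜 := 𝕜) s (P₀.comp (A.comp ι₀)))
    (hs' : ContainsSpectrum (𝕜 := 𝕜) s' (P₁.comp (A.comp ι₁))) (h0 : (0 : ℂ) ∉ s) {κ : 𝕜}
    (hκ01 : κ = 0 ∨ κ = 1) (hκ : κ = 1 ∨ s ^ n ∩ s = ∅)
    (hres : ∀ j, 1 ≤ j → j ≤ n → (s ^ (n - j) * s' ^ j) ∩ s = ∅) :
    IsUnit (homological n κ (P₀.comp (A.comp ι₀)) A (ι₀.comp P₀)) := by
  have e00 : ∀ x, P₀ (ι₀ x) = x := fun x => DFunLike.congr_fun h00 x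
  have e11 : ∀ x, P₁ (ι₁ x) = x := fun x => DFunLike.congr_fun h11 x
  have esum : ∀ x, ι₀ (P₀ x) + ι₁ (P₁ x) = x := fun x => DFunLike.congr_fun hsum x
  have eA : ∀ x, P₀ (A (ι₁ x)) = 0 := fun x => DFunLike.congr_fun hA x
  have e01 : ∀ x, P₀ (ι₁ x) = 0 := fun x => by
    have := congrArg P₀ (esum (ι₁ x))
    rw [map_add, e00, e11] at this
    simpa using this
  have e10 : ∀ x, P₁ (ι₀ x) = 0 := fun x => by
    have := congrArg P₁ (esum (ι₀ x))
    rw [map_add, e00, e11] at this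
    simpa using this
  set T₀ := P₀.comp (A.comp ι₀) with hT₀
  set T₁ := P₁.comp (A.comp ι₁) with hT₁
  set P := ι₀.comp P₀ with hP
  set D : X →L[𝕜] X := ι₀.comp (T₀.comp P₀) + ι₁.comp (T₁.comp P₁) with hD
  set B : X →L[𝕜] X := ι₁.comp (P₁.comp (A.comp P)) with hB
  have hAD : ∀ x, A x = D x + B x := fun x => by
    have h1 : A x = ι₀ (P₀ (A x)) + ι₁ (P₁ (A x)) := (esum _).symm
    have h2 : A x = A (ι₀ (P₀ x)) + A (ι₁ (P₁ x)) := by rw [← map_add, esum]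
    rw [h1, h2]
    simp only [map_add, eA, hD, hB, hT₀, hT₁, hP, _root_.add_apply,
      ContinuousLinearMap.comp_apply, add_zero]
    abel
  have hDP : D * P = P * D := by
    ext x
    simp [hD, hP, e00, e01, e10]
  have h1P : 1 - P = ι₁.comp P₁ := by rw [← hsum]; simp [hP]
  have hPP : P * P = P := by ext x; simp [hP, e00]
  have hu : IsUnit (homological n κ T₀ D P) := by
    rw [homological_eq_unop κ hDP]
    have hrefl : ∀ x : ((X [×n]→L[𝕜] F) →L[𝕜] (X [×n]→L[𝕜] F))ᵐᵒᵖ,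
        IsUnit (transposeHom 𝕜 (X [×n]→L[𝕜] F) x) → IsUnit x := fun x hx => by
      have := (isUnit_of_isUnit_transpose (T := x.unop) hx).op
      exact this
    refine IsUnit.unop (isUnit_sub_of_nonresonance (𝕜 := 𝕜)
      (C := DualOperators 𝕜 (X [×n]→L[𝕜] F))
      (transposeHom 𝕜 (X [×n]→L[𝕜] F)) transposeHom_algebraMap
      hrefl ?_ (postcomp_slot_commute T₀ · D)
      (postcomp_slot_commute T₀ · P) (fun i j => slot_commute i j (Commute.refl D))
      (fun i j => slot_commute i j hDP) (fun i j => slot_commute i j (Commute.refl P))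
      (s := s) (s' := s')
      (containsSpectrum_postcomp hs) ?_ ?_ h0 hκ hres hκ01)
    · intro i
      rw [← map_mul, hPP]
    · intro i z hz
      obtain ⟨Q, hQ, hu⟩ := hs z hz
      refine ⟨Q, hQ, ?_⟩
      have h1 := (isUnit_block h00 (D := D) (by ext x; simp [hD, e00, e10]) hu).map
        (slot 𝕜 X F i)
      rw [map_add, map_mul, map_sub, map_one, ← Polynomial.aeval_algHom_apply] at h1
      exact h1
    · intro i z hz
      obtain ⟨Q, hQ, hu⟩ := hs' z hz
      refine ⟨Q, hQ, ?_⟩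
      have h1 := (isUnit_block h11 (D := D) (by ext x; simp [hD, e11, e01]) hu).map
        (slot 𝕜 X F i)
      rw [← h1P, sub_sub_cancel, map_add, map_mul, map_sub, map_one,
        ← Polynomial.aeval_algHom_apply] at h1
      exact h1
  have hcont : Continuous fun ε : 𝕜 => homological n κ T₀ (D + ε • B) P := by
    unfold homological
    have h1 : Continuous fun ε : 𝕜 => pullback F fun _ : Fin n => D + ε • B :=
      (continuous_pullback F).comp (by fun_prop)
    have h2 : Continuous fun ε : 𝕜 => pullback F fun _ : Fin n => (D + ε • B) * P :=
      (continuous_pullback F).comp (by fun_prop)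
    exact continuous_const.sub (h1.sub (h2.const_smul κ))
  have hev : ∀ᶠ ε : 𝕜 in 𝓝 0, IsUnit (homological n κ T₀ (D + ε • B) P) := by
    refine hcont.continuousAt.eventually ?_
    have h2 : {x | IsUnit x} ∈ 𝓝 (homological n κ T₀ D P) :=
      (Units.isOpen (R := (X [×n]→L[𝕜] F) →L[𝕜] (X [×n]→L[𝕜] F))).mem_nhds hu
    beta_reduce
    rw [zero_smul, add_zero]
    exact h2
  obtain ⟨ε, hε, hε0⟩ := ((hev.filter_mono nhdsWithin_le_nhds).and
    (self_mem_nhdsWithin (s := {(0 : 𝕜)}ᶜ))).exists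
  have hε0 : ε ≠ 0 := hε0
  set Sm : 𝕜 → X →L[𝕜] X := fun c => P + c • (1 - P) with hSm
  have hSm1 : ∀ c c', c * c' = 1 → Sm c * Sm c' = 1 := by
    intro c c' h
    have h3 : (1 - P) * (1 - P) = 1 - P := by rw [mul_sub, sub_mul, sub_mul, hPP]; simp
    have h4 : P * (1 - P) = 0 := by rw [mul_sub, hPP]; simp
    have h5 : (1 - P) * P = 0 := by rw [sub_mul, hPP]; simp
    have h6 : c' * c = 1 := by rw [mul_comm, h]
    simp only [hSm, add_mul, mul_add, smul_mul_assoc, mul_smul_comm, h3, h4, h5, hPP, smul_smul,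
      h6, one_smul, smul_zero, add_zero, zero_add]
    abel
  have hV : ∀ c c', c * c' = 1 → IsUnit (pullback F fun _ : Fin n => Sm c) := by
    intro c c' h
    refine ⟨⟨pullback F fun _ => Sm c, pullback F fun _ => Sm c', ?_, ?_⟩, rfl⟩
    · rw [pullback_mul, ← pullback_one]
      congr 1
      funext i
      exact hSm1 c' c (by rw [mul_comm, h])
    · rw [pullback_mul, ← pullback_one]
      congr 1
      funext i
      exact hSm1 c c' h
  have hconj : Sm ε * A = (D + ε • B) * Sm ε := by
    ext x
    simp only [mul_apply_eq_comp, hSm, _root_.add_apply, _root_.smul_apply, _root_.sub_apply,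
      one_apply_eq_self, hAD]
    simp only [hD, hB, hP, hT₀, hT₁, ContinuousLinearMap.comp_apply, _root_.add_apply, map_add,
      map_sub, map_smul, e00, e01, e10, smul_sub, map_zero,
      add_zero, sub_self]
    module
  have hP' : Sm ε * P = P * Sm ε := by
    simp only [hSm, add_mul, mul_add, smul_mul_assoc, mul_smul_comm, mul_sub, sub_mul, hPP]
    simp
  have hrel : homological n κ T₀ A P * (pullback F fun _ => Sm ε) =
      (pullback F fun _ => Sm ε) * homological n κ T₀ (D + ε • B) P := by
    refine ContinuousLinearMap.ext fun p => ContinuousMultilinearMap.ext fun v => ?_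
    have c1 : ∀ x, Sm ε (A x) = (D + ε • B) (Sm ε x) := fun x => DFunLike.congr_fun hconj x
    have c2 : ∀ x, Sm ε (P x) = P (Sm ε x) := fun x => DFunLike.congr_fun hP' x
    show T₀ (p fun i => Sm ε (v i)) - ((p fun i => Sm ε (A (v i))) -
      κ • p fun i => Sm ε (A (P (v i)))) = T₀ (p fun i => Sm ε (v i)) -
      ((p fun i => (D + ε • B) (Sm ε (v i))) - κ • p fun i => (D + ε • B) (P (Sm ε (v i))))
    simp only [c1, c2]
  obtain ⟨u, hu'⟩ := hV ε ε⁻¹ (mul_inv_cancel₀ hε0)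
  have h6 : homological n κ T₀ A P = u * homological n κ T₀ (D + ε • B) P * (u⁻¹ : Units _) := by
    rw [hu', ← hrel, ← hu', Units.mul_inv_cancel_right]
  rw [h6]
  exact (u.isUnit.mul hε).mul u⁻¹.isUnit

end Homological

end InvFoliation

namespace InvFoliation
open Set Filter Topology Asymptotics

universe v

/-! ### Polynomials and formal solutions -/

section Polynomials

variable {𝕜 : Type*} [RCLike 𝕜] {E : Type v} [NormedAddCommGroup E] [NormedSpace 𝕜 E]
  {F : Type v} [NormedAddCommGroup F] [NormedSpace 𝕜 F]

lemma diag_succ {n : ℕ} (M : E [×(n + 1)]→L[𝕜] F) (x : E) :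
    (M fun _ => x) = M.curryRight (fun _ => x) x := by
  rw [ContinuousMultilinearMap.curryRight_apply]
  congr 1
  funext i
  refine Fin.lastCases ?_ (fun i => ?_) i <;> simp

lemma contDiff_diag {n : ℕ} {k : WithTop ℕ∞} (M : E [×n]→L[𝕜] F) :
    ContDiff 𝕜 k fun x => M fun _ => x :=
  M.contDiff.comp (contDiff_pi.2 fun _ => contDiff_id)

lemma isCb_diag {k : WithTop ℕ∞} {S : Set E} (hS : IsOpen S) (hb : Bornology.IsBounded S) (n : ℕ) :
    ∀ {F : Type v} [NormedAddCommGroup F] [NormedSpace 𝕜 F] (M : E [×n]→L[𝕜] F),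
      IsCb 𝕜 k (fun x => M fun _ => x) S := by
  induction n with
  | zero =>
    intro F _ _ M
    have : (fun x => M fun _ => x) = fun _ => M fun _ => 0 := by
      funext x
      congr 1
      exact Subsingleton.elim _ _
    rw [this]
    exact isCb_const _
  | succ n ih =>
    intro F _ _ M
    simp only [diag_succ]
    exact (ih M.curryRight).bilinear (ContinuousLinearMap.id 𝕜 (E →L[𝕜] F))
      (isCb_clm (ContinuousLinearMap.id 𝕜 E) hb) hS

/-- The difference quotient of a monomial, as a smooth operator valued function. -/
lemma exists_factor_diag (n : ℕ) : ∀ {F : Type v} [NormedAddCommGroup F] [NormedSpace 𝕜 F]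
    (M : E [×n]→L[𝕜] F), ∃ H : E × E → E →L[𝕜] F, ContDiff 𝕜 ω H ∧
      ∀ u y, (M fun _ => u + y) = (M fun _ => u) + H (u, y) y := by
  induction n with
  | zero =>
    intro F _ _ M
    refine ⟨fun _ => 0, contDiff_const, fun u y => ?_⟩
    rw [_root_.zero_apply, add_zero]
    congr 1
    exact Subsingleton.elim _ _
  | succ n ih =>
    intro F _ _ M
    obtain ⟨H, hH, hHM⟩ := ih M.curryRight
    refine ⟨fun z => (M.curryRight fun _ => z.1 + z.2) +
      ContinuousLinearMap.flipₗᵢ 𝕜 E E F (H z) z.1, ?_, fun u y => ?_⟩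
    · refine ContDiff.add ?_ ?_
      · exact (contDiff_diag M.curryRight).comp (contDiff_fst.add contDiff_snd)
      · refine ContDiff.clm_apply ?_ contDiff_fst
        have h1 : ContDiff 𝕜 ω (ContinuousLinearMap.flipₗᵢ 𝕜 E E F :
            (E →L[𝕜] E →L[𝕜] F) → E →L[𝕜] E →L[𝕜] F) :=
          LinearIsometryEquiv.contDiff (𝕜 := 𝕜) (n := ω) (E := E →L[𝕜] E →L[𝕜] F)
            (F := E →L[𝕜] E →L[𝕜] F) (ContinuousLinearMap.flipₗᵢ 𝕜 E E F)
        exact h1.comp hH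
    · rw [diag_succ, diag_succ, map_add, hHM]
      simp only [_root_.add_apply, hHM]
      simp
      abel

lemma IsPolynomialOfDegreeLE.contDiff {d : ℕ} {g : E → F} (hg : IsPolynomialOfDegreeLE 𝕜 d g)
    {k : WithTop ℕ∞} : ContDiff 𝕜 k g := by
  obtain ⟨p, hp⟩ := hg
  have : g = fun y => ∑ i ∈ Finset.range (d + 1), p i fun _ => y := funext hp
  rw [this]
  exact ContDiff.sum fun i _ => contDiff_diag (p i)

lemma IsPolynomialOfDegreeLE.isCb {d : ℕ} {g : E → F} (hg : IsPolynomialOfDegreeLE 𝕜 d g)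
    {k : WithTop ℕ∞} {S : Set E} (hS : IsOpen S) (hb : Bornology.IsBounded S) : IsCb 𝕜 k g S := by
  obtain ⟨p, hp⟩ := hg
  have : g = fun y => ∑ i ∈ Finset.range (d + 1), p i fun _ => y := funext hp
  rw [this]
  clear this hp
  induction d + 1 with
  | zero => simpa using isCb_const (0 : F)
  | succ d ih =>
    simp only [Finset.sum_range_succ]
    exact ih.add (isCb_diag hS hb d (p d)) hS

lemma IsPolynomialOfDegreeLE.exists_factor {d : ℕ} {g : E → F}
    (hg : IsPolynomialOfDegreeLE 𝕜 d g) : ∃ H : E × E → E →L[𝕜] F, ContDiff 𝕜 ω H ∧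
      ∀ u y, g (u + y) = g u + H (u, y) y := by
  obtain ⟨p, hp⟩ := hg
  choose H hH hHp using fun i => exists_factor_diag i (p i)
  refine ⟨fun z => ∑ i ∈ Finset.range (d + 1), H i z, ContDiff.sum fun i _ => hH i, fun u y => ?_⟩
  rw [hp, hp, _root_.sum_apply, ← Finset.sum_add_distrib]
  exact Finset.sum_congr rfl fun i _ => hHp i u y

lemma IsPolynomialOfDegreeLE.add_diag {d n : ℕ} {g : E → F} (hg : IsPolynomialOfDegreeLE 𝕜 d g)
    (hn : n ≤ d) (M : E [×n]→L[𝕜] F) :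
    IsPolynomialOfDegreeLE 𝕜 d fun y => g y + M fun _ => y := by
  obtain ⟨p, hp⟩ := hg
  refine ⟨fun i => p i + (Pi.single n M : ∀ i, E [×i]→L[𝕜] F) i, fun y => ?_⟩
  simp only [_root_.add_apply, Finset.sum_add_distrib, hp]
  congr 1
  rw [Finset.sum_eq_single n]
  · simp
  · intro i _ hi
    simp [Pi.single_eq_of_ne hi]
  · intro h
    exact absurd (Finset.mem_range.2 (Nat.lt_succ_of_le hn)) h

lemma isPolynomialOfDegreeLE_clm {d : ℕ} (hd : 1 ≤ d) (L : E →L[𝕜] F) :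
    IsPolynomialOfDegreeLE 𝕜 d L := by
  have h0 : IsPolynomialOfDegreeLE 𝕜 d (fun _ : E => (0 : F)) :=
    ⟨fun _ => 0, fun y => by simp⟩
  have h1 := h0.add_diag hd ((continuousMultilinearCurryFin1 𝕜 E F).symm L)
  convert h1 using 1
  funext y
  simp

omit [NormedSpace 𝕜 E] in
lemma diag_sub_isLittleO {G : Type v} [NormedAddCommGroup G] [NormedSpace 𝕜 G] {n : ℕ}
    (M : G [×(n + 1)]→L[𝕜] F) {u v : E → G}
    (huv : (fun x => u x - v x) =o[𝓝 0] fun x => ‖x‖) (hv : v =O[𝓝 0] fun x => ‖x‖) :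
    (fun x => (M fun _ => u x) - M fun _ => v x) =o[𝓝 0] fun x => ‖x‖ ^ (n + 1) := by
  have hu : u =O[𝓝 0] fun x => ‖x‖ := by simpa using huv.isBigO.add hv
  have h1 : (fun x => (M fun _ => u x) - M fun _ => v x) =O[𝓝 0]
      fun x => (‖u x‖ + ‖v x‖) ^ n * ‖u x - v x‖ := by
    refine IsBigO.of_bound (‖M‖ * (n + 1)) (Eventually.of_forall fun x => ?_)
    have h2 := M.norm_image_sub_le (fun _ => u x) (fun _ => v x)
    refine h2.trans ?_
    rw [Fintype.card_fin, Nat.add_sub_cancel]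
    have e1 : ‖(fun _ : Fin (n + 1) => u x)‖ ≤ ‖u x‖ + ‖v x‖ := by
      rw [pi_norm_const]; linarith [norm_nonneg (v x)]
    have e2 : ‖(fun _ : Fin (n + 1) => v x)‖ ≤ ‖u x‖ + ‖v x‖ := by
      rw [pi_norm_const]; linarith [norm_nonneg (u x)]
    have e3 : ‖(fun _ : Fin (n + 1) => u x) - (fun _ => v x)‖ = ‖u x - v x‖ :=
      pi_norm_const _
    rw [e3, norm_mul, norm_pow, norm_norm, Real.norm_of_nonneg (by positivity), mul_assoc (‖M‖ * _)]
    push_cast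
    gcongr
    exact max_le e1 e2
  refine h1.trans_isLittleO ?_
  have h3 : (fun x => (‖u x‖ + ‖v x‖) ^ n) =O[𝓝 0] fun x : E => ‖x‖ ^ n :=
    (hu.norm_left.add hv.norm_left).pow n
  simpa [pow_succ] using h3.mul_isLittleO huv.norm_left

end Polynomials

section FormalSolution

variable {𝕜 : Type*} [RCLike 𝕜] {X : Type v} [NormedAddCommGroup X] [NormedSpace 𝕜 X]
  {F : Type v} [NormedAddCommGroup F] [NormedSpace 𝕜 F]

/-- Polynomials `p`, `g` which solve `p ∘ f = g ∘ p` up to order `n`, where the degree of `g` is at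
most `d`. The term of order `n + 1` is obtained by inverting the homological operator. -/
lemma exists_formal_solution {ι : F →L[𝕜] X} {P : X →L[𝕜] F}
    {A : X →L[𝕜] X} {A₀ : F →L[𝕜] F} (hPA : P.comp A = A₀.comp P) {ℓ d : ℕ} (hd : 1 ≤ d)
    (h1 : ∀ n, 2 ≤ n → n ≤ ℓ → n ≤ d → IsUnit (homological n (1 : 𝕜) A₀ A (ι.comp P)))
    (h0 : ∀ n, d < n → n ≤ ℓ → IsUnit (homological n (0 : 𝕜) A₀ A (ι.comp P)))
    {f : X → X} (hf0 : f 0 = 0) (hfA : HasFDerivAt f A 0) (hf : ContDiffAt 𝕜 ℓ f 0) (n : ℕ)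
    (hn1 : 1 ≤ n) (hn : n ≤ ℓ) :
    ∃ (p : X → F) (g : F → F), ContDiff 𝕜 ω p ∧ IsPolynomialOfDegreeLE 𝕜 d g ∧ p 0 = 0 ∧
      HasFDerivAt p P 0 ∧ g 0 = 0 ∧ HasFDerivAt g A₀ 0 ∧ (d = 1 → ∀ y, g y = A₀ y) ∧
      (fun x => g (p x) - p (f x)) =o[𝓝 0] fun x => ‖x‖ ^ n := by
  induction n, hn1 using Nat.le_induction with
  | base =>
    refine ⟨P, A₀, P.contDiff, isPolynomialOfDegreeLE_clm hd A₀, map_zero _, P.hasFDerivAt,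
      map_zero _, A₀.hasFDerivAt, fun _ _ => rfl, ?_⟩
    have h2 : (fun x => f x - A x) =o[𝓝 0] fun x => x := by
      simpa [hf0] using hfA.isLittleO
    have h3 : (fun x => A₀ (P x) - P (f x)) = fun x => -P (f x - A x) := by
      funext x
      have := DFunLike.congr_fun hPA x
      simp only [ContinuousLinearMap.comp_apply] at this
      rw [map_sub, this, neg_sub]
    rw [h3]
    simpa using ((P.isBigO_comp (fun x => f x - A x) (𝓝 0)).trans_isLittleO h2).norm_right.neg_left
  | succ n hn1 ih =>
    obtain ⟨p, g, hp, hg, hp0, hpP, hg0, hgA, hgd, ho⟩ := ih (by omega)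
    have hfn : ContDiffAt 𝕜 (n + 1 : ℕ) f 0 := hf.of_le (by exact_mod_cast hn)
    have hq : ContDiffAt 𝕜 (n + 1 : ℕ) (fun x => g (p x) - p (f x)) 0 := by
      refine ContDiffAt.sub ?_ ?_
      · exact (hg.contDiff.comp (hp.of_le le_top)).contDiffAt
      · exact (hp.of_le le_top).contDiffAt.comp _ hfn
    obtain ⟨R, hR⟩ := exists_leading_term hq ho
    -- the equation in order `n + 1`
    obtain ⟨p₁, γ, hγ, hpγ⟩ : ∃ (p₁ : X [×(n + 1)]→L[𝕜] F) (γ : F [×(n + 1)]→L[𝕜] F),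
        (γ = 0 ∨ n + 1 ≤ d) ∧ ∀ x, A₀ (p₁ fun _ => x) + (γ fun _ => P x) + (R fun _ => x) -
          (p₁ fun _ => A x) = 0 := by
      have hsolve : ∀ κ : 𝕜, IsUnit (homological (n + 1) κ A₀ A (ι.comp P)) →
          ∃ p₁ : X [×(n + 1)]→L[𝕜] F, ∀ x, A₀ (p₁ fun _ => x) - ((p₁ fun _ => A x) -
            κ • p₁ fun _ => A (ι (P x))) = -R fun _ => x := by
        rintro κ ⟨u, hu⟩
        refine ⟨(↑u⁻¹ : (X [×(n + 1)]→L[𝕜] F) →L[𝕜] (X [×(n + 1)]→L[𝕜] F)) (-R), fun x => ?_⟩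
        have h2 : homological (n + 1) κ A₀ A (ι.comp P)
            ((↑u⁻¹ : (X [×(n + 1)]→L[𝕜] F) →L[𝕜] (X [×(n + 1)]→L[𝕜] F)) (-R)) = -R := by
          rw [← hu, ← mul_apply_eq_comp, Units.mul_inv]; rfl
        exact DFunLike.congr_fun h2 fun _ => x
      rcases le_or_gt (n + 1) d with hnd | hnd
      · obtain ⟨p₁, hp₁⟩ := hsolve 1 (h1 (n + 1) (by omega) hn hnd)
        refine ⟨p₁, p₁.compContinuousLinearMap fun _ => A.comp ι, Or.inr hnd, fun x => ?_⟩
        have := hp₁ x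
        rw [one_smul] at this
        simp only [ContinuousMultilinearMap.compContinuousLinearMap_apply,
          ContinuousLinearMap.comp_apply]
        rw [← neg_eq_iff_eq_neg] at this
        rw [← this]
        abel
      · obtain ⟨p₁, hp₁⟩ := hsolve 0 (h0 (n + 1) hnd hn)
        refine ⟨p₁, 0, Or.inl rfl, fun x => ?_⟩
        have := hp₁ x
        rw [zero_smul, sub_zero, ← neg_eq_iff_eq_neg] at this
        rw [_root_.zero_apply, ← this]
        abel
    have hdiag0 : ∀ {E' F' : Type v} [NormedAddCommGroup E'] [NormedSpace 𝕜 E']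
        [NormedAddCommGroup F'] [NormedSpace 𝕜 F'] (M : E' [×(n + 1)]→L[𝕜] F'),
        HasFDerivAt (fun x => M fun _ => x) (0 : E' →L[𝕜] F') 0 := by
      intro E' F' _ _ _ _ M
      have h2 : (fun x => M fun _ => x) =O[𝓝 0] fun x : E' => ‖x - 0‖ ^ (n + 1) := by
        simpa using isBigO_diag M (𝓝 0)
      exact h2.hasFDerivAt (by omega)
    have hdiag00 : ∀ {E' F' : Type v} [NormedAddCommGroup E'] [NormedSpace 𝕜 E']
        [NormedAddCommGroup F'] [NormedSpace 𝕜 F'] (M : E' [×(n + 1)]→L[𝕜] F'),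
        (M fun _ => (0 : E')) = 0 := fun M => M.map_zero
    refine ⟨fun x => p x + p₁ fun _ => x, fun y => g y + γ fun _ => y, hp.add (contDiff_diag p₁),
      ?_, ?_, ?_, ?_, ?_, ?_, ?_⟩
    · rcases hγ with rfl | h
      · simpa using hg
      · exact hg.add_diag h γ
    · simp only [hp0, hdiag00, add_zero]
    · exact (hpP.add (hdiag0 p₁)).congr_fderiv (add_zero _)
    · simp only [hg0, hdiag00, add_zero]
    · exact (hgA.add (hdiag0 γ)).congr_fderiv (add_zero _)
    · intro hd1 y
      rcases hγ with rfl | h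
      · simpa using hgd hd1 y
      · omega
    · -- the four contributions to the error
      have hpO : p =O[𝓝 0] fun x => ‖x‖ := by
        simpa [hp0] using hpP.isBigO_sub.norm_right
      have hp₁O : (fun x => p₁ fun _ => x) =O[𝓝 0] fun x => ‖x‖ ^ (n + 1) := isBigO_diag p₁ _
      have hp₁o : (fun x => p₁ fun _ => x) =o[𝓝 0] fun x => ‖x‖ := by
        simpa using hp₁O.trans_isLittleO (isLittleO_norm_pow (E := X) (by omega : 1 < n + 1))
      have e1 : (fun x => g (p x + p₁ fun _ => x) - g (p x) - A₀ (p₁ fun _ => x)) =o[𝓝 0]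
          fun x => ‖x‖ ^ (n + 1) := by
        have hs : HasStrictFDerivAt g A₀ 0 :=
          (hg.contDiff (k := 1)).contDiffAt.hasStrictFDerivAt' hgA one_ne_zero
        have ht : Tendsto (fun x => (p x + p₁ fun _ => x, p x)) (𝓝 0) (𝓝 ((0 : F), (0 : F))) := by
          have c1 : ContinuousAt (fun x => (p x + p₁ fun _ => x, p x)) 0 :=
            ((hp.continuous.add (contDiff_diag (k := 0) p₁).continuous).prodMk
              hp.continuous).continuousAt
          have c2 := c1.tendsto
          simpa only [hp0, hdiag00, add_zero] using c2
        have h2 := hs.isLittleO.comp_tendsto ht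
        refine (h2.congr_left fun x => ?_).trans_isBigO (hp₁O.congr_left fun x => ?_)
        · simp
        · simp
      have e2 : (fun x => (γ fun _ => p x + p₁ fun _ => x) - γ fun _ => P x) =o[𝓝 0]
          fun x => ‖x‖ ^ (n + 1) := by
        refine diag_sub_isLittleO γ (u := fun x => p x + p₁ fun _ => x) (v := P) ?_ ?_
        · have h2 : (fun x => p x - P x) =o[𝓝 0] fun x => ‖x‖ := by
            simpa [hp0] using hpP.isLittleO.norm_right
          refine (h2.add hp₁o).congr_left fun x => by abel
        · simpa using (P.isBigO_id (𝓝 0)).norm_right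
      have e3 : (fun x => (p₁ fun _ => f x) - p₁ fun _ => A x) =o[𝓝 0] fun x => ‖x‖ ^ (n + 1) := by
        refine diag_sub_isLittleO p₁ ?_ ?_
        · simpa [hf0] using hfA.isLittleO.norm_right
        · simpa using (A.isBigO_id (𝓝 0)).norm_right
      have hsum := ((e1.add e2).sub e3).add hR
      refine hsum.congr_left fun x => ?_
      have h4 := hpγ x
      have h5 : (p₁ fun _ => A x) = A₀ (p₁ fun _ => x) + (γ fun _ => P x) + (R fun _ => x) :=
        (sub_eq_zero.1 h4).symm
      beta_reduce
      rw [h5]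
      abel

end FormalSolution

end InvFoliation

namespace InvFoliation
open Set Filter Topology Asymptotics

universe v

/-! ### Adapted norms and local diffeomorphisms -/

section Adapted

variable {𝕜 : Type*} [RCLike 𝕜] {E : Type v} [NormedAddCommGroup E] [NormedSpace 𝕜 E]

/-- `ν` is a continuous subadditive function with `‖x‖ ≤ ν x ≤ K ‖x‖`. -/
structure IsEquivNorm (ν : E → ℝ) (K : ℝ) : Prop where
  pos : 0 < K
  continuous : Continuous ν
  norm_le : ∀ x, ‖x‖ ≤ ν x
  le_norm : ∀ x, ν x ≤ K * ‖x‖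
  add_le : ∀ x y, ν (x + y) ≤ ν x + ν y

lemma IsEquivNorm.map_zero {ν : E → ℝ} {K : ℝ} (h : IsEquivNorm ν K) : ν 0 = 0 :=
  le_antisymm (by simpa using h.le_norm 0) (by simpa using h.norm_le 0)

lemma IsEquivNorm.nonneg {ν : E → ℝ} {K : ℝ} (h : IsEquivNorm ν K) (x : E) : 0 ≤ ν x :=
  (norm_nonneg x).trans (h.norm_le x)

lemma IsEquivNorm.isOpen_ball {ν : E → ℝ} {K : ℝ} (h : IsEquivNorm ν K) (s : ℝ) :
    IsOpen {x | ν x < s} :=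
  isOpen_lt h.continuous continuous_const

/-- An operator with `‖T ^ N‖ < c ^ N` contracts by the factor `c` in the equivalent norm
`ν x = ∑ i < N, c ^ (-i) * ‖T ^ i x‖`. -/
lemma exists_adapted_norm (T : E →L[𝕜] E) {c : ℝ} (hc : 0 < c) {N : ℕ} (h : ‖T ^ N‖ < c ^ N) :
    ∃ (ν : E → ℝ) (K : ℝ), IsEquivNorm ν K ∧ ∀ x, ν (T x) ≤ c * ν x := by
  rcases N.eq_zero_or_pos with rfl | hN
  · have h0 : ∀ x : E, x = 0 := by
      intro x
      by_contra hx
      have h1 := (1 : E →L[𝕜] E).le_opNorm x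
      rw [pow_zero, pow_zero] at h
      have h2 : 0 < ‖x‖ := norm_pos_iff.2 hx
      have h3 : (1 : E →L[𝕜] E) x = x := rfl
      rw [h3] at h1
      nlinarith
    refine ⟨norm, 1, ⟨one_pos, continuous_norm, fun _ => le_rfl, fun _ => (one_mul _).ge,
      norm_add_le⟩, fun x => ?_⟩
    rw [h0 (T x), h0 x]; simp
  obtain ⟨M, rfl⟩ : ∃ M, N = M + 1 := ⟨N - 1, by omega⟩
  refine ⟨fun x => ∑ i ∈ Finset.range (M + 1), (c ^ i)⁻¹ * ‖(T ^ i) x‖,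
    1 + ∑ i ∈ Finset.range (M + 1), (c ^ i)⁻¹ * ‖T ^ i‖, 
    ⟨by positivity, by fun_prop, ?_, ?_, ?_⟩, ?_⟩
  · intro x
    rw [Finset.sum_range_succ']
    simp only [pow_zero, inv_one, one_mul, one_apply_eq_self]
    have : 0 ≤ ∑ i ∈ Finset.range M, (c ^ (i + 1))⁻¹ * ‖(T ^ (i + 1)) x‖ :=
      Finset.sum_nonneg fun i _ => by positivity
    linarith
  · intro x
    rw [add_mul, one_mul, Finset.sum_mul]
    have : ∀ i ∈ Finset.range (M + 1), (c ^ i)⁻¹ * ‖(T ^ i) x‖ ≤ (c ^ i)⁻¹ * ‖T ^ i‖ * ‖x‖ := by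
      intro i _
      rw [mul_assoc]
      gcongr
      exact (T ^ i).le_opNorm x
    linarith [Finset.sum_le_sum this, norm_nonneg x]
  · intro x y
    rw [← Finset.sum_add_distrib]
    refine Finset.sum_le_sum fun i _ => ?_
    rw [map_add, ← mul_add]
    gcongr
    exact norm_add_le _ _
  · intro x
    have e : ∀ i, (T ^ i) (T x) = (T ^ (i + 1)) x := fun i => by rw [pow_succ]; rfl
    simp only [e]
    rw [Finset.sum_range_succ, Finset.sum_range_succ' (fun i => (c ^ i)⁻¹ * ‖(T ^ i) x‖), mul_add,
      Finset.mul_sum]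
    refine add_le_add (Finset.sum_le_sum fun i _ => ?_) ?_
    · have : c * (c ^ (i + 1))⁻¹ = (c ^ i)⁻¹ := by
        rw [pow_succ, mul_inv, mul_left_comm, mul_inv_cancel₀ hc.ne', mul_one]
      rw [← mul_assoc, this]
    · simp only [pow_zero, inv_one, one_mul, one_apply_eq_self]
      rw [inv_mul_le_iff₀ (by positivity), ← mul_assoc, ← pow_succ]
      exact ((T ^ (M + 1)).le_opNorm x).trans (by gcongr)

/-- Near a fixed point, a map contracts as its linear part does in an adapted norm. -/
lemma IsEquivNorm.contract {T : E →L[𝕜] E} {c c' K : ℝ} {ν : E → ℝ} (hν : IsEquivNorm ν K)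
    (hT : ∀ x, ν (T x) ≤ c * ν x) {f : E → E} {x : E}
    (h : ‖f x - T x‖ ≤ (c' - c) / K * ‖x‖) (hcc' : c ≤ c') : ν (f x) ≤ c' * ν x := by
  have h4 := hν.add_le (T x) (f x - T x)
  rw [add_sub_cancel] at h4
  have h6 : K * ‖f x - T x‖ ≤ (c' - c) * ‖x‖ := by
    calc K * ‖f x - T x‖ ≤ K * ((c' - c) / K * ‖x‖) := by have := hν.pos; gcongr
      _ = _ := by have := hν.pos; field_simp
  have h7 : (c' - c) * ‖x‖ ≤ (c' - c) * ν x := by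
    have := sub_nonneg.2 hcc'
    gcongr
    exact hν.norm_le x
  linarith [hT x, hν.le_norm (f x - T x)]

lemma exists_contracting_ball {T : E →L[𝕜] E} {c c' K : ℝ} (hcc' : c < c') {ν : E → ℝ}
    (hν : IsEquivNorm ν K) (hT : ∀ x, ν (T x) ≤ c * ν x) {f : E → E}
    (hf0 : f 0 = 0) (hf : HasFDerivAt f T 0) :
    ∃ η : ℝ, 0 < η ∧ ∀ x, ν x < η → ν (f x) ≤ c' * ν x := by
  have h1 := hf.isLittleO.def (div_pos (sub_pos.2 hcc') hν.pos)
  simp only [hf0, sub_zero] at h1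
  obtain ⟨η, hη, h⟩ := Metric.eventually_nhds_iff_ball.1 h1
  exact ⟨η, hη, fun x hx =>
    hν.contract hT (h x (by simpa using (hν.norm_le x).trans_lt hx)) hcc'.le⟩

lemma IsEquivNorm.exists_forall_lt {ν : E → ℝ} {K : ℝ} (hν : IsEquivNorm ν K) {p : E → Prop}
    (hp : ∀ᶠ x in 𝓝 (0 : E), p x) : ∃ η : ℝ, 0 < η ∧ ∀ x, ν x < η → p x := by
  obtain ⟨η, hη, h⟩ := Metric.mem_nhds_iff.1 hp
  exact ⟨η, hη, fun x hx => h (by simpa using (hν.norm_le x).trans_lt hx)⟩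

end Adapted

section LocalDiffeo

variable {𝕜 : Type*} [RCLike 𝕜] {E : Type*} [NormedAddCommGroup E] [NormedSpace 𝕜 E]
  {n : WithTop ℕ∞}

lemma isCb_of_semiconj {X : Type*} [NormedAddCommGroup X] [NormedSpace 𝕜 X] {f : X → X}
    {π : X → E} {e : OpenPartialHomeomorph E E} {S S' : Set X} (hS : IsOpen S) (hS' : IsOpen S')
    (hf : IsCb 𝕜 n f S) (hπ : IsCb 𝕜 n π S') (he : IsCb 𝕜 n e.symm e.target)
    (hfS : MapsTo f S S') (hπS : MapsTo π S e.source) (h : ∀ x ∈ S, π (f x) = e (π x)) :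
    IsCb 𝕜 n π S := by
  have h1 : IsCb 𝕜 n (fun x => π (f x)) S := hπ.comp hS' hf hS hfS
  have h2 : MapsTo (fun x => π (f x)) S e.target := fun x hx => by
    beta_reduce
    rw [h x hx]
    exact e.map_source (hπS hx)
  refine (he.comp e.open_target h1 hS h2).congr hS fun x hx => ?_
  rw [Function.comp_apply, h x hx, e.left_inv (hπS hx)]

/-- The inverse function theorem in the class `C^n_b`. -/
lemma exists_openPartialHomeomorph [CompleteSpace E] {θ : E → E} {S : Set E}
    (hS : IsOpen S) (hn : 1 ≤ n) (hθ : IsCb 𝕜 n θ S) {x : E} (hx : x ∈ S) {L : E ≃L[𝕜] E}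
    (hL : HasFDerivAt θ (L : E →L[𝕜] E) x) :
    ∃ e : OpenPartialHomeomorph E E, ⇑e = θ ∧ x ∈ e.source ∧ e.source ⊆ S ∧
      IsCb 𝕜 n e e.source ∧ IsCb 𝕜 n e.symm e.target := by
  have hn0 : n ≠ 0 := fun h => by simp [h] at hn
  have hs : HasStrictFDerivAt θ (L : E →L[𝕜] E) x :=
    (hθ.1.contDiffAt (hS.mem_nhds hx)).hasStrictFDerivAt' hL hn0
  obtain ⟨c, hc⟩ := exists_gt ‖Ring.inverse (L : E →L[𝕜] E)‖
  have hu : IsUnit (L : E →L[𝕜] E) :=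
    ⟨⟨L, L.symm, by ext; simp, by ext; simp⟩, rfl⟩
  set S' : Set E := (S ∩ Metric.ball x 1) ∩ fderiv 𝕜 θ ⁻¹' boundedUnits (E →L[𝕜] E) c with hS'
  have hS'o : IsOpen S' :=
    ((hθ.1.continuousOn_fderiv_of_isOpen hS hn).mono inter_subset_left).isOpen_inter_preimage
      (hS.inter Metric.isOpen_ball) (isOpen_boundedUnits c)
  have hxS' : x ∈ S' := by
    refine ⟨⟨hx, Metric.mem_ball_self one_pos⟩, ?_⟩
    rw [mem_preimage, hL.fderiv]
    exact ⟨hu, hc⟩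
  set e := (hs.toOpenPartialHomeomorph θ).restrOpen S' hS'o with he
  have heθ : ⇑e = θ := rfl
  have hes : e.source ⊆ S' := inter_subset_right
  have heS : e.source ⊆ S := fun y hy => (hes hy).1.1
  have hcb : IsCb 𝕜 n e e.source := by
    rw [heθ]; exact hθ.mono heS
  refine ⟨e, heθ, ⟨hs.mem_toOpenPartialHomeomorph_source, hxS'⟩, heS, hcb, ?_⟩
  refine hcb.symm hn (c := c) (Metric.isBounded_ball.subset fun y hy => (hes hy).1.2) fun y hy => ?_
  rw [heθ]
  exact (hes hy).2

end LocalDiffeo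

/-! ### Existence -/

section Existence

variable {𝕜 : Type*} [RCLike 𝕜] {X : Type v} [NormedAddCommGroup X] [NormedSpace 𝕜 X]
  [CompleteSpace X] {F : Type v} [NormedAddCommGroup F] [NormedSpace 𝕜 F] [CompleteSpace F]

/-- A formal solution of order `ℓ` can be corrected to a true solution near `0`. -/
lemma exists_solution_germ {ι : F →L[𝕜] X} {P : X →L[𝕜] F}
    {A : X →L[𝕜] X} {A₀ : F ≃L[𝕜] F} (hPA : P.comp A = (A₀ : F →L[𝕜] F).comp P) {ℓ d : ℕ}
    (hℓ : 1 ≤ ℓ) (hd : 1 ≤ d)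
    (h1 : ∀ n, 2 ≤ n → n ≤ ℓ → n ≤ d →
      IsUnit (homological n (1 : 𝕜) (A₀ : F →L[𝕜] F) A (ι.comp P)))
    (h0 : ∀ n, d < n → n ≤ ℓ → IsUnit (homological n (0 : 𝕜) (A₀ : F →L[𝕜] F) A (ι.comp P)))
    {a : ℝ} (ha0 : 0 < a) (ha1 : a < 1) {N N' : ℕ} (hA : ‖A ^ N‖ < a ^ N)
    (hA₀ : ‖(A₀.symm : F →L[𝕜] F) ^ N'‖ * a ^ ((ℓ + 1) * N') < 1)
    {f : X → X} (hf0 : f 0 = 0) (hfA : HasFDerivAt f A 0)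
    (hf : ContDiffAt 𝕜 (ℓ + 1 : ℕ) f 0) :
    ∃ (π : X → F) (g : F → F),
      (∀ k : WithTop ℕ∞, k ≠ ∞ → ((ℓ + 1 : ℕ) : WithTop ℕ∞) ≤ k → ContDiffAt 𝕜 k f 0 →
        ContDiffAt 𝕜 k π 0) ∧
      IsPolynomialOfDegreeLE 𝕜 d g ∧ π 0 = 0 ∧ HasFDerivAt π P 0 ∧
      HasFDerivAt g (A₀ : F →L[𝕜] F) 0 ∧ (d = 1 → ∀ y, g y = A₀ y) ∧
      ∀ᶠ x in 𝓝 0, π (f x) = g (π x) := by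
  obtain ⟨p, g, hp, hg, hp0, hpP, hg0, hgA, hgd, ho⟩ := exists_formal_solution hPA hd h1 h0 hf0 hfA
    (hf.of_le (by exact_mod_cast Nat.le_succ ℓ)) ℓ hℓ le_rfl
  have hq : ∀ k : WithTop ℕ∞, ContDiffAt 𝕜 k f 0 →
      ContDiffAt 𝕜 k (fun x => g (p x) - p (f x)) 0 := by
    intro k hk
    refine ContDiffAt.sub ?_ ?_
    · exact (hg.contDiff.comp (hp.of_le le_top)).contDiffAt
    · exact (hp.of_le le_top).contDiffAt.comp _ hk
  obtain ⟨H, hH, hgH⟩ := hg.exists_factor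
  have hH' : ∀ k : WithTop ℕ∞, ContDiff 𝕜 k fun z : X × F => H (p z.1, z.2) := fun k =>
    (hH.of_le le_top).comp (((hp.of_le le_top).comp contDiff_fst).prodMk contDiff_snd)
  have hH0 : H (p (0 : X × F).1, (0 : X × F).2) = (A₀ : F →L[𝕜] F) := by
    have h2 : HasFDerivAt (fun y => H (0, y) y) (H (0, 0)) 0 := by
      have h3 : HasFDerivAt (fun y : F => H (0, y)) (fderiv 𝕜 (fun y : F => H (0, y)) 0) 0 := by
        refine DifferentiableAt.hasFDerivAt ?_
        exact ((hH.comp (contDiff_const.prodMk contDiff_id)).differentiable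
          (by simp)).differentiableAt
      have h4 := h3.clm_apply (hasFDerivAt_id (𝕜 := 𝕜) (0 : F))
      refine h4.congr_fderiv ?_
      ext v
      simp
    have h3 : (fun y => H (0, y) y) = g := by
      funext y
      have := hgH 0 y
      rw [hg0, zero_add, zero_add] at this
      exact this.symm
    rw [h3] at h2
    simp only [Prod.fst_zero, Prod.snd_zero, hp0]
    exact h2.unique hgA
  have hna : ‖((a : ℝ) : 𝕜)‖ = a := by rw [RCLike.norm_ofReal, abs_of_pos ha0]
  obtain ⟨ρ, hρ, hρ0, hρd, hρe⟩ := exists_solution_functional_equation (𝕜 := 𝕜) (a := (a : 𝕜))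
    (by exact_mod_cast ha0.ne') (by rw [hna]; exact ha1) (L := ℓ + 1) (by omega) hf0 hfA hf
    (hq _ hf) (isBigO_of_isLittleO_pow (hq _ hf) ho) (hH' _).contDiffAt hH0 (N := N) (N' := N')
    (by rw [hna]; exact hA) (by rw [hna]; exact hA₀)
  refine ⟨fun x => p x + ρ x, g, ?_, hg, ?_, ?_, hgA, hgd, ?_⟩
  · intro k hk hℓk hfk
    exact (hp.of_le le_top).contDiffAt.add
      (hρ k hk hℓk hfk (hq k hfk) (hH' k).contDiffAt)
  · simp only [hp0, hρ0, add_zero]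
  · exact (hpP.add hρd).congr_fderiv (add_zero _)
  · filter_upwards [hρe] with x hx
    rw [hx, hgH]
    abel

/-- A solution germ extends to a `C^r_b` solution on a small ball of an adapted norm. For `r = ∞`,
the neighborhoods on which the derivatives of order `j` are bounded might shrink as `j` grows;
since `π = g⁻¹ ∘ π ∘ f`, such bounds are transported from a small ball to a fixed one. -/
lemma exists_solution_on_nhds {ι : F →L[𝕜] X} {P : X →L[𝕜] F} (hPι : P.comp ι = .id 𝕜 F)
    {A : X →L[𝕜] X} {A₀ : F ≃L[𝕜] F} {d : ℕ}
    {a : ℝ} (ha0 : 0 < a) (ha1 : a < 1) {N : ℕ} (hA : ‖A ^ N‖ < a ^ N)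
    {r : WithTop ℕ∞} {ℓ : ℕ} (hr : ((ℓ + 1 : ℕ) : WithTop ℕ∞) ≤ r)
    {O : Set X} {f : X → X} (hf : IsMapWithFixedPoint r O f A) {π : X → F} {g : F → F}
    (hπ : ∀ k : WithTop ℕ∞, k ≠ ∞ → ((ℓ + 1 : ℕ) : WithTop ℕ∞) ≤ k → ContDiffAt 𝕜 k f 0 →
        ContDiffAt 𝕜 k π 0)
    (hg : IsPolynomialOfDegreeLE 𝕜 d g) (hπ0 : π 0 = 0) (hπP : HasFDerivAt π P 0)
    (hgA : HasFDerivAt g (A₀ : F →L[𝕜] F) 0) (hπf : ∀ᶠ x in 𝓝 0, π (f x) = g (π x)) :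
    ∃ (U : Set X) (O₀ : Set F), IsOpen U ∧ 0 ∈ U ∧ U ⊆ O ∧ IsCb 𝕜 r π U ∧ IsOpen O₀ ∧
      IsCb 𝕜 r g O₀ ∧ MapsTo f U U ∧ MapsTo π U O₀ ∧ MapsTo g O₀ O₀ ∧
      (∀ x ∈ U, π (f x) = g (π x)) ∧ IsSubmersionOn 𝕜 π U := by
  obtain ⟨a', haa', ha'1⟩ := exists_between ha1
  obtain ⟨ν, K, hν, hνA⟩ := exists_adapted_norm A ha0 hA
  obtain ⟨η₁, hη₁, hcontr⟩ := exists_contracting_ball haa' hν hνA hf.map_zero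
    hf.hasFDerivAt
  have h1r : (1 : WithTop ℕ∞) ≤ r := le_trans (by exact_mod_cast Nat.le_add_left 1 ℓ) hr
  have hfr : ContDiffAt 𝕜 r f 0 := hf.isCb.1.contDiffAt (hf.isOpen.mem_nhds hf.zero_mem)
  have hπj : ∀ j : ℕ, (j : WithTop ℕ∞) ≤ r → ∃ V, IsOpen V ∧ (0 : X) ∈ V ∧ IsCb 𝕜 j π V := by
    intro j hj
    obtain ⟨k, hjk, hk⟩ : ∃ k : ℕ, j ≤ k ∧
        (((ℓ + 1 : ℕ) : WithTop ℕ∞) ≤ k ∧ (k : WithTop ℕ∞) ≤ r) := by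
      refine ⟨max j (ℓ + 1), le_max_left _ _, by exact_mod_cast le_max_right _ _, ?_⟩
      rcases max_choice j (ℓ + 1) with h | h <;> rw [h] <;> assumption
    refine exists_isCb_of_contDiffAt (by simp) ?_
    exact (hπ k (by simp) hk.1 (hfr.of_le hk.2)).of_le (by exact_mod_cast hjk)
  obtain ⟨V₁, hV₁o, h0V₁, hV₁⟩ := hπj 1 (by exact_mod_cast h1r)
  have hπc : ContDiffAt 𝕜 1 π 0 := by
    simpa using hV₁.1.contDiffAt (hV₁o.mem_nhds h0V₁)
  -- the part of the neighborhood that carries the bounds on `π`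
  obtain ⟨V, hV, hVr⟩ : ∃ V ∈ 𝓝 (0 : X), r ≠ ∞ → ∀ S ⊆ V, IsCb 𝕜 r π S := by
    by_cases h : r = ∞
    · exact ⟨univ, univ_mem, fun h' => absurd h h'⟩
    · obtain ⟨V, hVo, h0V, hV⟩ := exists_isCb_of_contDiffAt h (hπ r h hr hfr)
      exact ⟨V, hVo.mem_nhds h0V, fun _ S hS => hV.mono hS⟩
  have hgcb : ∀ {k : WithTop ℕ∞}, IsCb 𝕜 k g (Metric.ball 0 1) :=
    hg.isCb Metric.isOpen_ball Metric.isBounded_ball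
  obtain ⟨e, heg, h0e, -, -, hesymm⟩ := exists_openPartialHomeomorph (𝕜 := 𝕜) (n := ∞)
    Metric.isOpen_ball (by norm_cast) hgcb (Metric.mem_ball_self one_pos) hgA
  have hunit : ∀ᶠ x in 𝓝 (0 : X), IsUnit ((fderiv 𝕜 π x).comp ι) := by
    have hc : ContinuousAt (fun x => (fderiv 𝕜 π x).comp ι) 0 :=
      (hπc.fderiv_right (m := 0) (by simp)).continuousAt.clm_comp continuousAt_const
    refine hc.eventually_mem (Units.isOpen.mem_nhds ?_)
    rw [hπP.fderiv, hPι]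
    exact isUnit_one
  have hπe : ∀ᶠ x in 𝓝 (0 : X), π x ∈ e.source := by
    refine hπc.continuousAt.eventually_mem (e.open_source.mem_nhds ?_)
    rwa [hπ0]
  have hgood : ∀ᶠ x in 𝓝 (0 : X), ((x ∈ V₁ ∧ x ∈ V) ∧ x ∈ O ∧ π x ∈ e.source) ∧
      π (f x) = g (π x) ∧ IsUnit ((fderiv 𝕜 π x).comp ι) := by
    filter_upwards [hV₁o.mem_nhds h0V₁, hV, hf.isOpen.mem_nhds hf.zero_mem, hπe, hπf, hunit] with x
      h1 h2 h3 h4 h5 h6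
    exact ⟨⟨⟨h1, h2⟩, h3, h4⟩, h5, h6⟩
  obtain ⟨η₂, hη₂, hη₂'⟩ := hν.exists_forall_lt hgood
  set η := min η₁ η₂ with hη
  have hη0 : 0 < η := lt_min hη₁ hη₂
  set U : Set X := {x | ν x < η} with hU
  have hUo : IsOpen U := hν.isOpen_ball η
  have hUg : ∀ x ∈ U, ((x ∈ V₁ ∧ x ∈ V) ∧ x ∈ O ∧ π x ∈ e.source) ∧ π (f x) = g (π x) ∧
      IsUnit ((fderiv 𝕜 π x).comp ι) := fun x hx => hη₂' x (lt_of_lt_of_le hx (min_le_right _ _))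
  have hUc : ∀ x ∈ U, ν (f x) ≤ a' * ν x := fun x hx =>
    hcontr x (lt_of_lt_of_le hx (min_le_left _ _))
  have ha'0 : 0 < a' := ha0.trans haa'
  have hUf : MapsTo f U U := fun x hx => by
    refine lt_of_le_of_lt (hUc x hx) (lt_of_le_of_lt ?_ hx)
    exact mul_le_of_le_one_left (hν.nonneg x) ha'1.le
  have hUO : U ⊆ O := fun x hx => (hUg x hx).1.2.1
  have hUπ : IsCb 𝕜 r π U := by
    by_cases hr' : r = ∞
    · subst hr'
      refine isCb_of_forall_nat (by simp) fun j hj => ?_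
      obtain ⟨S, hSo, h0S, hS⟩ := hπj j hj
      obtain ⟨η₃, hη₃, hη₃'⟩ := hν.exists_forall_lt (hSo.mem_nhds h0S)
      obtain ⟨n, hn⟩ : ∃ n : ℕ, a' ^ n * η < η₃ := by
        obtain ⟨n, hn⟩ := exists_pow_lt_of_lt_one (div_pos hη₃ hη0) ha'1
        exact ⟨n, by rwa [lt_div_iff₀ hη0] at hn⟩
      -- bounds on the ball of radius `a' ^ n * η` are transported to larger and larger balls
      have key : ∀ m : ℕ, IsCb 𝕜 j π {x | ν x < a' ^ m * η} → IsCb 𝕜 j π U := by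
        intro m
        induction m with
        | zero => intro h; simpa using h
        | succ m ih =>
          intro h
          refine ih ?_
          have hsub : {x | ν x < a' ^ m * η} ⊆ U := fun x (hx : ν x < a' ^ m * η) =>
            hx.trans_le (mul_le_of_le_one_left hη0.le (pow_le_one₀ ha'0.le ha'1.le))
          refine isCb_of_semiconj (hν.isOpen_ball _) (hν.isOpen_ball _)
            ((hf.isCb.of_le hj fun h => by simp at h).mono (hsub.trans hUO)) h
            (hesymm.of_le hj fun h => by simp at h) (fun x hx => ?_)
            (fun x hx => (hUg x (hsub hx)).1.2.2) (fun x hx => ?_)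
          · refine lt_of_le_of_lt (hUc x (hsub hx)) ?_
            rw [pow_succ', mul_assoc]
            exact mul_lt_mul_of_pos_left hx ha'0
          · rw [heg]
            exact (hUg x (hsub hx)).2.1
      exact key n (hS.mono fun x (hx : ν x < a' ^ n * η) => hη₃' x (hx.trans hn))
    · exact hVr hr' U fun x hx => (hUg x hx).1.1.2
  have hπd : ∀ x ∈ U, ContDiffAt 𝕜 1 π x := fun x hx => by
    simpa using hV₁.1.contDiffAt (hV₁o.mem_nhds (hUg x hx).1.1.1)
  have hright : ∀ x ∈ U, ∃ R : F →L[𝕜] X, Function.RightInverse R (fderiv 𝕜 π x) := by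
    intro x hx
    obtain ⟨u, hu⟩ := (hUg x hx).2.2
    refine ⟨ι.comp (↑u⁻¹ : F →L[𝕜] F), fun y => ?_⟩
    have h2 := DFunLike.congr_fun u.mul_inv y
    rw [hu] at h2
    exact h2
  have hopen : IsOpen (π '' U) := by
    rw [isOpen_iff_mem_nhds]
    rintro _ ⟨x, hx, rfl⟩
    obtain ⟨R, hR⟩ := hright x hx
    rw [← ((hπd x hx).hasStrictFDerivAt one_ne_zero).map_nhds_eq_of_surj
      (LinearMap.range_eq_top.2 hR.surjective)]
    exact image_mem_map (hUo.mem_nhds hx)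
  have h0U : (0 : X) ∈ U := by
    change ν 0 < η
    rwa [hν.map_zero]
  refine ⟨U, π '' U, hUo, h0U, hUO, hUπ, hopen, hg.isCb hopen ?_, hUf, mapsTo_image π U, ?_,
    fun x hx => (hUg x hx).2.1, fun x hx => ?_⟩
  · obtain ⟨M, hM⟩ := hUπ.bounded
    refine isBounded_iff_forall_norm_le.2 ⟨M, ?_⟩
    rintro _ ⟨x, hx, rfl⟩
    exact hM x hx
  · rintro _ ⟨x, hx, rfl⟩
    exact ⟨f x, hUf hx, (hUg x hx).2.1⟩
  · obtain ⟨R, hR⟩ := hright x hx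
    exact ⟨(hπd x hx).differentiableAt one_ne_zero, hR.surjective,
      ContinuousLinearMap.closedComplemented_ker_of_rightInverse _ R hR⟩

end Existence

end InvFoliation

namespace InvFoliation
open Set Filter Topology Asymptotics

universe v

/-! ### Uniqueness of germs -/

section FormalUniqueness

variable {𝕜 : Type*} [RCLike 𝕜] {X : Type v} [NormedAddCommGroup X] [NormedSpace 𝕜 X]
  {F : Type v} [NormedAddCommGroup F] [NormedSpace 𝕜 F]

/-- Only the restriction to the diagonal is known to solve the homological equation, so that the
operator, which commutes with permutations of the arguments, is inverted on symmetric maps. -/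
lemma diag_eq_zero_of_homological {n : ℕ} {κ : 𝕜} {S : F →L[𝕜] F} {A P : X →L[𝕜] X}
    (hu : IsUnit (homological n κ S A P)) {R : X [×n]→L[𝕜] F}
    (h : ∀ x, S (R fun _ => x) - ((R fun _ => A x) - κ • R fun _ => A (P x)) = 0) (x : X) :
    (R fun _ => x) = 0 := by
  set R' : X [×n]→L[𝕜] F := ∑ σ : Equiv.Perm (Fin n), R.domDomCongr σ with hR'
  have hR'v : ∀ v : Fin n → X, R' v = ∑ σ : Equiv.Perm (Fin n), R fun i => v (σ i) := fun v => by
    rw [hR', _root_.sum_apply]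
    rfl
  have h0 : homological n κ S A P R' = 0 := by
    ext v
    have := sum_perm_eq_zero_of_diag_eq_zero (homological n κ S A P R)
      (fun x => by rw [homological_apply]; exact h x) v
    rw [homological_apply, hR'v, hR'v, hR'v, _root_.zero_apply, ← this, map_sum, Finset.smul_sum,
      ← Finset.sum_sub_distrib, ← Finset.sum_sub_distrib]
    refine Finset.sum_congr rfl fun σ _ => ?_
    rw [homological_apply]
  obtain ⟨u, hu⟩ := hu
  have h1 : R' = 0 := by
    have h2 := DFunLike.congr_fun u.inv_mul R'
    rw [mul_apply_eq_comp, hu, h0, map_zero] at h2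
    exact h2.symm
  have h2 := hR'v fun _ => x
  rw [h1, _root_.zero_apply, Finset.sum_const, eq_comm, ← Nat.cast_smul_eq_nsmul 𝕜,
    smul_eq_zero] at h2
  refine h2.resolve_left ?_
  rw [Finset.card_univ]
  exact_mod_cast Fintype.card_ne_zero

/-- A map which solves the equation of differences of solutions vanishes to order `ℓ + 1`: its
leading term in the orders `2, …, ℓ` is in the kernel of the homological operator. -/
lemma isBigO_of_difference_equation {d : X → F} {f z : X → X} {S : F →L[𝕜] F} {A P Z : X →L[𝕜] X}
    {κ : 𝕜} {ℓ : ℕ} (hℓ : 1 ≤ ℓ)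
    (hZ : ∀ (n : ℕ) (R : X [×(n + 1)]→L[𝕜] F) (x : X),
      (R fun _ => A (Z x)) = κ • R fun _ => A (P x))
    (hd : ContDiffAt 𝕜 (ℓ + 1 : ℕ) d 0) (hd1 : d =o[𝓝 0] fun x => ‖x‖)
    (hf0 : f 0 = 0) (hfA : HasFDerivAt f A 0) (hz0 : z 0 = 0) (hzZ : HasFDerivAt z Z 0)
    (heq : (fun x => d (f x) - d (f (z x)) - S (d x)) =o[𝓝 0] d)
    (hu : ∀ n, 2 ≤ n → n ≤ ℓ → IsUnit (homological n κ S A P)) :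
    d =O[𝓝 0] fun x => ‖x‖ ^ (ℓ + 1) := by
  have key : ∀ n, 1 ≤ n → n ≤ ℓ → d =o[𝓝 0] fun x => ‖x‖ ^ n := by
    intro n hn
    induction n, hn using Nat.le_induction with
    | base => intro _; simpa using hd1
    | succ n hn ih =>
      intro hnℓ
      have hdn : ContDiffAt 𝕜 (n + 1 : ℕ) d 0 := hd.of_le (by exact_mod_cast by omega)
      obtain ⟨R, hR⟩ := exists_leading_term hdn (ih (by omega))
      have hdO : d =O[𝓝 0] fun x => ‖x‖ ^ (n + 1) := by
        simpa using hR.isBigO.add (isBigO_diag R (𝓝 0))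
      -- composition with a map with linear part `B`
      have hcomp : ∀ (y : X → X) (B : X →L[𝕜] X), y 0 = 0 → HasFDerivAt y B 0 →
          (fun x => d (y x) - R fun _ => B x) =o[𝓝 0] fun x => ‖x‖ ^ (n + 1) := by
        intro y B hy0 hyB
        have h1 : Tendsto y (𝓝 0) (𝓝 0) := by simpa [hy0] using hyB.continuousAt.tendsto
        have hyO : y =O[𝓝 0] fun x => ‖x‖ := by simpa [hy0] using hyB.isBigO_sub.norm_right
        have h2 := (hR.comp_tendsto h1).trans_isBigO (hyO.norm_left.pow (n + 1))
        have h3 := diag_sub_isLittleO R (u := y) (v := B)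
          (by simpa [hy0] using hyB.isLittleO.norm_right)
          (by simpa using (B.isBigO_id (𝓝 0)).norm_right)
        refine (h2.add h3).congr_left fun x => ?_
        simp only [Function.comp_apply]
        abel
      have e1 := hcomp f A hf0 hfA
      have e2 := hcomp (fun x => f (z x)) (A.comp Z) (by simp only [hz0, hf0])
        (HasFDerivAt.comp (g := f) (0 : X) (by rwa [hz0]) hzZ)
      have e3 : (fun x => S (d x) - S (R fun _ => x)) =o[𝓝 0] fun x => ‖x‖ ^ (n + 1) := by
        refine ((S.isBigO_comp _ (𝓝 0)).trans_isLittleO hR).congr_left fun x => ?_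
        rw [map_sub]
      have e4 := heq.trans_isBigO hdO
      have e5 : (fun x => S (R fun _ => x) - ((R fun _ => A x) - κ • R fun _ => A (P x)))
          =o[𝓝 0] fun x => ‖x‖ ^ (n + 1) := by
        refine (((e1.sub e2).sub e3).sub e4).congr_left fun x => ?_
        rw [← hZ]
        simp only [ContinuousLinearMap.comp_apply]
        abel
      have hzero := diag_eq_zero_of_homological (hu (n + 1) (by omega) hnℓ) (R := R)
        (eq_zero_of_homogeneous_isLittleO (n := n + 1) (𝕜 := 𝕜) (fun t x => by
          simp only [map_smul, diag_smul, smul_sub, smul_comm κ]) e5)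
      simpa [hzero] using hR
  exact isBigO_of_isLittleO_pow hd (key ℓ hℓ le_rfl)

end FormalUniqueness

section Dynamics

variable {𝕜 : Type*} [RCLike 𝕜] {X : Type v} [NormedAddCommGroup X] [NormedSpace 𝕜 X]
  {F : Type v} [NormedAddCommGroup F] [NormedSpace 𝕜 F]

/-- Bounds on powers: `A` contracts at a rate `a < 1`, and `A₀⁻¹` expands at most at a rate `m`
with `m * a ^ (ℓ + 1) < 1`. -/
structure HasGap (A : X →L[𝕜] X) (A₀ : F ≃L[𝕜] F) (ℓ : ℕ) (a m : ℝ) : Prop where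
  pos : 0 < a
  lt_one : a < 1
  pos' : 0 < m
  gap : m * a ^ (ℓ + 1) < 1
  exists_pow : ∃ N, ‖A ^ N‖ < a ^ N
  exists_pow' : ∃ N, ‖(A₀.symm : F →L[𝕜] F) ^ N‖ < m ^ N

lemma exists_hasGap {A : X →L[𝕜] X} {A₀ : F ≃L[𝕜] F} {ℓ : ℕ} {a : ℝ} (ha0 : 0 < a) (ha1 : a < 1)
    {N N' : ℕ} (hA : ‖A ^ N‖ < a ^ N)
    (hA₀ : ‖(A₀.symm : F →L[𝕜] F) ^ N'‖ * a ^ ((ℓ + 1) * N') < 1) :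
    ∃ m, HasGap A A₀ ℓ a m := by
  have hp : 0 < a ^ (ℓ + 1) := by positivity
  have h1 : ‖(A₀.symm : F →L[𝕜] F) ^ N'‖ < ((a ^ (ℓ + 1))⁻¹) ^ N' := by
    rw [inv_pow, ← pow_mul, ← one_div, lt_div_iff₀ (by positivity)]
    exact hA₀
  have h2 : ∀ᶠ m in 𝓝[<] (a ^ (ℓ + 1))⁻¹, ‖(A₀.symm : F →L[𝕜] F) ^ N'‖ < m ^ N' :=
    ((continuous_pow N').continuousAt.eventually (lt_mem_nhds h1)).filter_mono nhdsWithin_le_nhds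
  have h3 : ∀ᶠ m in 𝓝[<] (a ^ (ℓ + 1))⁻¹, 0 < m :=
    (lt_mem_nhds (inv_pos.2 hp)).filter_mono nhdsWithin_le_nhds
  obtain ⟨m, hm1, hm2, hm3⟩ := (h2.and (h3.and self_mem_nhdsWithin)).exists
  refine ⟨m, ha0, ha1, hm2, ?_, ⟨N, hA⟩, N', hm1⟩
  rwa [← one_div, lt_div_iff₀ hp] at hm3

lemma exists_expanding_nhds {A₀ : F ≃L[𝕜] F} {ν : F → ℝ} {K m m' : ℝ} (hν : IsEquivNorm ν K)
    (hm : 0 < m) (hmm' : m < m') (hA₀ : ∀ y, ν (A₀.symm y) ≤ m * ν y) {g : F → F}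
    (hg : HasStrictFDerivAt g (A₀ : F →L[𝕜] F) 0) :
    ∃ V ∈ 𝓝 (0 : F), ∀ u ∈ V, ∀ v ∈ V, ν (u - v) ≤ m' * ν (g u - g v) := by
  have hm' : 0 < m' := hm.trans hmm'
  -- `ε` is chosen such that `m / (1 - m * K * ε) = m'`
  set ε := (m' - m) / (m * K * m') with hε
  have hε0 : 0 < ε := div_pos (sub_pos.2 hmm') (by have := hν.pos; positivity)
  have h1 := hg.isLittleO.def hε0
  rw [nhds_prod_eq] at h1
  obtain ⟨V, hV, h⟩ := eventually_prod_self_iff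
    (r := fun u v => ‖g u - g v - (A₀ : F →L[𝕜] F) (u - v)‖ ≤ ε * ‖u - v‖) |>.1 h1
  refine ⟨V, hV, fun u hu v hv => ?_⟩
  have h2 := h u hu v hv
  have h3 : u - v = A₀.symm ((g u - g v) + -(g u - g v - A₀ (u - v))) := by
    rw [A₀.eq_symm_apply]; abel
  have h4 : ν (u - v) ≤ m * (ν (g u - g v) + K * (ε * ν (u - v))) := by
    calc ν (u - v) = ν (A₀.symm ((g u - g v) + -(g u - g v - A₀ (u - v)))) := by rw [← h3]
      _ ≤ m * ν ((g u - g v) + -(g u - g v - A₀ (u - v))) := hA₀ _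
      _ ≤ m * (ν (g u - g v) + ν (-(g u - g v - A₀ (u - v)))) := by
        gcongr; exact hν.add_le _ _
      _ ≤ m * (ν (g u - g v) + K * ‖-(g u - g v - A₀ (u - v))‖) := by
        gcongr; exact hν.le_norm _
      _ ≤ m * (ν (g u - g v) + K * (ε * ν (u - v))) := by
        have := hν.pos
        rw [norm_neg]
        gcongr
        refine h2.trans ?_
        gcongr
        exact hν.norm_le _
  have h5 : m * (K * (ε * ν (u - v))) = (m' - m) / m' * ν (u - v) := by
    have := hν.pos
    rw [hε]; field_simp
  have h6 : ν (u - v) * (m / m') ≤ m * ν (g u - g v) := by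
    have : (m' - m) / m' = 1 - m / m' := by field_simp
    rw [mul_add, h5, this] at h4
    linarith
  have h7 : ν (u - v) * (m / m') = m * (ν (u - v) / m') := by ring
  rw [h7, mul_le_mul_iff_right₀ hm, div_le_iff₀ hm'] at h6
  linarith

/-- Two semiconjugacies to the same map `g` agree on pairs of points of a forward invariant
relation on which they agree up to order `ℓ + 1`: the difference along the orbits decays too
fast for `g`, which contracts at a slower rate, unless it vanishes. -/
lemma exists_nhds_eq_of_isBigO {A : X →L[𝕜] X} {A₀ : F ≃L[𝕜] F} {ℓ : ℕ} {a m : ℝ}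
    (hgap : HasGap A A₀ ℓ a m) {f : X → X} (hf0 : f 0 = 0) (hfA : HasFDerivAt f A 0) {g : F → F}
    (hg : HasStrictFDerivAt g (A₀ : F →L[𝕜] F) 0) {π₁ π₂ : X → F} (h₁ : ContinuousAt π₁ 0)
    (h₂ : ContinuousAt π₂ 0) (h₁0 : π₁ 0 = 0) (h₂0 : π₂ 0 = 0)
    (hs₁ : ∀ᶠ x in 𝓝 0, π₁ (f x) = g (π₁ x)) (hs₂ : ∀ᶠ x in 𝓝 0, π₂ (f x) = g (π₂ x))
    {Γ : X → X → Prop} {C : ℝ} {V : Set X} (hV : V ∈ 𝓝 (0 : X))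
    (hΓ : ∀ x ∈ V, ∀ y ∈ V, Γ x y → Γ (f x) (f y))
    (hC : ∀ x ∈ V, ∀ y ∈ V, Γ x y → ‖π₁ x - π₂ y‖ ≤ C * (‖x‖ ^ (ℓ + 1) + ‖y‖ ^ (ℓ + 1))) :
    ∃ V ∈ 𝓝 (0 : X), ∀ x ∈ V, ∀ y ∈ V, Γ x y → π₁ x = π₂ y := by
  -- slightly larger rates
  obtain ⟨m', hmm', hm'⟩ : ∃ m', m < m' ∧ m' * a ^ (ℓ + 1) < 1 := by
    have h : ContinuousAt (fun t : ℝ => t * a ^ (ℓ + 1)) m := by fun_prop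
    have h' := (h.eventually (gt_mem_nhds hgap.gap)).filter_mono (nhdsWithin_le_nhds (s := Ioi m))
    obtain ⟨t, h1, h2⟩ := (h'.and self_mem_nhdsWithin).exists
    exact ⟨t, h2, h1⟩
  obtain ⟨c, hac, hc1, hc⟩ : ∃ c, a < c ∧ c < 1 ∧ m' * c ^ (ℓ + 1) < 1 := by
    have h : ContinuousAt (fun t : ℝ => m' * t ^ (ℓ + 1)) a := by fun_prop
    have h' := ((h.eventually (gt_mem_nhds hm')).and (gt_mem_nhds hgap.lt_one)).filter_mono
      (nhdsWithin_le_nhds (s := Ioi a))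
    obtain ⟨t, ⟨h1, h2⟩, h3⟩ := (h'.and self_mem_nhdsWithin).exists
    exact ⟨t, h3, h2, h1⟩
  have hc0 : 0 < c := hgap.pos.trans hac
  have hm'0 : 0 < m' := hgap.pos'.trans hmm'
  obtain ⟨N, hN⟩ := hgap.exists_pow
  obtain ⟨N', hN'⟩ := hgap.exists_pow'
  obtain ⟨ν, K, hν, hνA⟩ := exists_adapted_norm A hgap.pos hN
  obtain ⟨μ, K', hμ, hμA⟩ := exists_adapted_norm _ hgap.pos' hN'
  obtain ⟨η₁, hη₁, hcontr⟩ := exists_contracting_ball hac hν hνA hf0 hfA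
  obtain ⟨V₀, hV₀, hexp⟩ := exists_expanding_nhds hμ hgap.pos' hmm' hμA hg
  have hgood : ∀ᶠ x in 𝓝 (0 : X), x ∈ V ∧ (π₁ x ∈ V₀ ∧ π₂ x ∈ V₀) ∧
      π₁ (f x) = g (π₁ x) ∧ π₂ (f x) = g (π₂ x) := by
    have e1 := h₁.eventually_mem (s := V₀) (by rwa [h₁0])
    have e2 := h₂.eventually_mem (s := V₀) (by rwa [h₂0])
    filter_upwards [hV, e1, e2, hs₁, hs₂] with x q1 q2 q3 q4 q5
    exact ⟨q1, ⟨q2, q3⟩, q4, q5⟩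
  obtain ⟨η₂, hη₂, hη₂'⟩ := hν.exists_forall_lt hgood
  set η := min η₁ η₂ with hη
  have hη0 : 0 < η := lt_min hη₁ hη₂
  refine ⟨{x | ν x < η}, (hν.isOpen_ball η).mem_nhds (by
    change ν 0 < η
    rwa [hν.map_zero]), fun x hx y hy hxy => ?_⟩
  have horb : ∀ x, ν x < η → ∀ n : ℕ, ν (f^[n] x) ≤ c ^ n * η := by
    intro x hx n
    induction n with
    | zero => simpa using hx.le
    | succ n ih =>
      rw [Function.iterate_succ_apply', pow_succ', mul_assoc]
      have h1 : ν (f^[n] x) < η₁ := by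
        rcases n.eq_zero_or_pos with rfl | hn
        · exact lt_of_lt_of_le hx (min_le_left _ _)
        · refine lt_of_le_of_lt ih (lt_of_lt_of_le ?_ (min_le_left η₁ η₂))
          exact mul_lt_of_lt_one_left hη0 (pow_lt_one₀ hc0.le hc1 hn.ne')
      exact (hcontr _ h1).trans (by gcongr)
  have horb' : ∀ x, ν x < η → ∀ n : ℕ, ν (f^[n] x) < η₂ := by
    intro x hx n
    rcases n.eq_zero_or_pos with rfl | hn
    · exact lt_of_lt_of_le hx (min_le_right _ _)
    · refine lt_of_le_of_lt (horb x hx n) (lt_of_lt_of_le ?_ (min_le_right η₁ η₂))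
      exact mul_lt_of_lt_one_left hη0 (pow_lt_one₀ hc0.le hc1 hn.ne')
  have hΓn : ∀ n : ℕ, Γ (f^[n] x) (f^[n] y) := by
    intro n
    induction n with
    | zero => exact hxy
    | succ n ih =>
      rw [Function.iterate_succ_apply', Function.iterate_succ_apply']
      exact hΓ _ (hη₂' _ (horb' x hx n)).1 _ (hη₂' _ (horb' y hy n)).1 ih
  have hback : ∀ n : ℕ, μ (π₁ x - π₂ y) ≤ m' ^ n * μ (π₁ (f^[n] x) - π₂ (f^[n] y)) := by
    intro n
    induction n with
    | zero => simp
    | succ n ih =>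
      rw [Function.iterate_succ_apply', Function.iterate_succ_apply']
      have q1 := hη₂' _ (horb' x hx n)
      have q2 := hη₂' _ (horb' y hy n)
      rw [q1.2.2.1, q2.2.2.2, pow_succ, mul_assoc]
      exact ih.trans (by gcongr; exact hexp _ q1.2.1.1 _ q2.2.1.2)
  have hbound : ∀ n : ℕ, ‖π₁ x - π₂ y‖ ≤
      (m' * c ^ (ℓ + 1)) ^ n * (K' * (|C| * (η ^ (ℓ + 1) + η ^ (ℓ + 1)))) := by
    intro n
    have q1 := hη₂' _ (horb' x hx n)
    have q2 := hη₂' _ (horb' y hy n)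
    have hx' : ‖f^[n] x‖ ^ (ℓ + 1) ≤ (c ^ n * η) ^ (ℓ + 1) :=
      pow_le_pow_left₀ (norm_nonneg _) ((hν.norm_le _).trans (horb x hx n)) _
    have hy' : ‖f^[n] y‖ ^ (ℓ + 1) ≤ (c ^ n * η) ^ (ℓ + 1) :=
      pow_le_pow_left₀ (norm_nonneg _) ((hν.norm_le _).trans (horb y hy n)) _
    have hK' := hμ.pos
    calc ‖π₁ x - π₂ y‖ ≤ m' ^ n * μ (π₁ (f^[n] x) - π₂ (f^[n] y)) :=
          (hμ.norm_le _).trans (hback n)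
      _ ≤ m' ^ n * (K' * (|C| * ((c ^ n * η) ^ (ℓ + 1) + (c ^ n * η) ^ (ℓ + 1)))) := by
        gcongr
        refine (hμ.le_norm _).trans ?_
        gcongr
        refine (hC _ q1.1 _ q2.1 (hΓn n)).trans ?_
        gcongr
        exact le_abs_self C
      _ = _ := by
        rw [mul_pow, mul_pow, ← pow_mul, ← pow_mul, mul_comm n (ℓ + 1)]
        ring
  have hlim : Tendsto (fun n : ℕ => (m' * c ^ (ℓ + 1)) ^ n *
      (K' * (|C| * (η ^ (ℓ + 1) + η ^ (ℓ + 1))))) atTop (𝓝 0) := by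
    simpa using (tendsto_pow_atTop_nhds_zero_of_lt_one (by positivity) hc).mul_const
      (K' * (|C| * (η ^ (ℓ + 1) + η ^ (ℓ + 1))))
  have := ge_of_tendsto' hlim hbound
  exact sub_eq_zero.1 (norm_le_zero_iff.1 this)

end Dynamics

section Germs

variable {𝕜 : Type*} [RCLike 𝕜] {X : Type v} [NormedAddCommGroup X] [NormedSpace 𝕜 X]
  {F : Type v} [NormedAddCommGroup F] [NormedSpace 𝕜 F]

/-- `(g, π)` is a solution of class `C^n` near `0`, normalized by `Dπ(0) = P`, `Dg(0) = A₀`. -/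
structure IsSolutionGerm (n : WithTop ℕ∞) (f : X → X) (A₀ : F →L[𝕜] F) (P : X →L[𝕜] F) (π : X → F)
    (g : F → F) : Prop where
  contDiffAt : ContDiffAt 𝕜 n π 0
  map_zero : π 0 = 0
  hasFDerivAt : HasFDerivAt π P 0
  hasStrictFDerivAt : HasStrictFDerivAt g A₀ 0
  semiconj : ∀ᶠ x in 𝓝 0, π (f x) = g (π x)

/-- Two normalized solutions are related by `π' = (π' ∘ w) ∘ π`, where `w` is a right inverse
of `π`. -/
lemma IsSolutionGerm.eventually_eq_comp {ι : F →L[𝕜] X} {P : X →L[𝕜] F} (hPι : P.comp ι = .id 𝕜 F)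
    {A : X →L[𝕜] X} {A₀ : F ≃L[𝕜] F} {ℓ : ℕ} {a m : ℝ} (hℓ : 1 ≤ ℓ)
    (hgap : HasGap A A₀ ℓ a m)
    (hu : ∀ n, 2 ≤ n → n ≤ ℓ → IsUnit (homological n (1 : 𝕜) (A₀ : F →L[𝕜] F) A (ι.comp P)))
    {f : X → X} (hf0 : f 0 = 0) (hfA : HasFDerivAt f A 0) {π π' : X → F} {g g' : F → F}
    (h : IsSolutionGerm (ℓ + 1 : ℕ) f (A₀ : F →L[𝕜] F) P π g)
    (h' : IsSolutionGerm (ℓ + 1 : ℕ) f (A₀ : F →L[𝕜] F) P π' g')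
    {w : F → X} (hw0 : w 0 = 0) (hw : ContDiffAt 𝕜 (ℓ + 1 : ℕ) w 0) (hwι : HasFDerivAt w ι 0)
    (hπw : ∀ᶠ y in 𝓝 0, π (w y) = y) : ∀ᶠ x in 𝓝 0, π' x = π' (w (π x)) := by
  have hfc : Tendsto f (𝓝 0) (𝓝 0) := by simpa [hf0] using hfA.continuousAt.tendsto
  have hπc : Tendsto π (𝓝 0) (𝓝 0) := by simpa [h.map_zero] using h.hasFDerivAt.continuousAt.tendsto
  have hπ'c : Tendsto π' (𝓝 0) (𝓝 0) := by
    simpa [h'.map_zero] using h'.hasFDerivAt.continuousAt.tendsto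
  have hwc : Tendsto w (𝓝 0) (𝓝 0) := by simpa [hw0] using hwι.continuousAt.tendsto
  set z : X → X := fun x => w (π x) with hz
  have hzc : Tendsto z (𝓝 0) (𝓝 0) := hwc.comp hπc
  have hz0 : z 0 = 0 := by simp only [hz, h.map_zero, hw0]
  have hzd : HasFDerivAt z (ι.comp P) 0 :=
    HasFDerivAt.comp (g := w) (0 : X) (by rwa [h.map_zero]) h.hasFDerivAt
  have hzn : ContDiffAt 𝕜 (ℓ + 1 : ℕ) z 0 :=
    ContDiffAt.comp (g := w) (0 : X) (by rwa [h.map_zero]) h.contDiffAt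
  have hπz : ∀ᶠ x in 𝓝 0, π (z x) = π x := hπc.eventually hπw
  set d : X → F := fun x => π' x - π' (z x) with hd
  have hPP : ∀ x, P (ι (P x)) = P x := fun x => DFunLike.congr_fun hPι (P x)
  have hd1 : d =o[𝓝 0] fun x => ‖x‖ := by
    have h1 : HasFDerivAt d (P - P.comp (ι.comp P)) 0 :=
      h'.hasFDerivAt.sub (HasFDerivAt.comp (g := π') (0 : X) (by
        rw [hz0]; exact h'.hasFDerivAt) hzd)
    have h2 : P - P.comp (ι.comp P) = 0 := by
      ext x
      simp [hPP]
    have h3 := h1.isLittleO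
    rw [h2] at h3
    simpa [hd, h'.map_zero, hz0] using h3.norm_right
  have hdn : ContDiffAt 𝕜 (ℓ + 1 : ℕ) d 0 :=
    h'.contDiffAt.sub (ContDiffAt.comp (g := π') (0 : X) (by
        rw [hz0]; exact h'.contDiffAt) hzn)
  -- `z (f x)` depends only on `π x`, hence agrees at `x` and `z x`
  have hzf : ∀ᶠ x in 𝓝 0, z (f x) = z (f (z x)) := by
    filter_upwards [h.semiconj, hzc.eventually h.semiconj, hπz] with x e1 e2 e3
    simp only [hz] at e2 e3 ⊢
    rw [e1, e2, e3]
  have heq : (fun x => d (f x) - d (f (z x)) - (A₀ : F →L[𝕜] F) (d x)) =o[𝓝 0] d := by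
    have ht : Tendsto (fun x => (π' x, π' (z x))) (𝓝 0) (𝓝 ((0 : F), (0 : F))) :=
      hπ'c.prodMk_nhds (hπ'c.comp hzc)
    have h1 := h'.hasStrictFDerivAt.isLittleO.comp_tendsto ht
    refine h1.congr' ?_ (Eventually.of_forall fun x => rfl)
    filter_upwards [h'.semiconj, hzc.eventually h'.semiconj, hzf] with x e1 e2 e3
    simp only [hd, Function.comp_apply, e1, e2, ← e3, map_sub]
    abel
  have hdO := isBigO_of_difference_equation hℓ (κ := 1) (Z := ι.comp P) (P := ι.comp P)
    (fun n R x => (one_smul _ _).symm) hdn hd1 hf0 hfA hz0 hzd heq hu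
  obtain ⟨C, hC⟩ := hdO.bound
  have hg' := h'.hasStrictFDerivAt
  obtain ⟨V, hV, hVe⟩ := exists_nhds_eq_of_isBigO hgap hf0 hfA hg' h'.hasFDerivAt.continuousAt
    h'.hasFDerivAt.continuousAt h'.map_zero h'.map_zero h'.semiconj h'.semiconj
    (Γ := fun x y => π x = π y) (C := C) (h.semiconj.and hC) (fun x hx y hy hxy => by
      rw [hx.1, hy.1, hxy]) (fun x hx y hy hxy => by
      have e1 : π' x - π' y = d x - d y := by
        simp only [hd, hz, hxy]
        abel
      have e2 := hx.2
      have e3 := hy.2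
      rw [Real.norm_of_nonneg (by positivity)] at e2 e3
      rw [e1, mul_add]
      exact (norm_sub_le _ _).trans (add_le_add e2 e3))
  filter_upwards [hV, hzc.eventually_mem hV, hπz] with x e1 e2 e3
  exact hVe x e1 _ e2 e3.symm

/-- Without resonances of `A₀` with itself, the normalized solution with linear `g` is unique. -/
lemma IsSolutionGerm.eventually_eq {P' : X →L[𝕜] X} {P : X →L[𝕜] F}
    {A : X →L[𝕜] X} {A₀ : F ≃L[𝕜] F} {ℓ : ℕ} {a m : ℝ} (hℓ : 1 ≤ ℓ)
    (hgap : HasGap A A₀ ℓ a m)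
    (hu : ∀ n, 2 ≤ n → n ≤ ℓ → IsUnit (homological n (0 : 𝕜) (A₀ : F →L[𝕜] F) A P'))
    {f : X → X} (hf0 : f 0 = 0) (hfA : HasFDerivAt f A 0) {π π' : X → F}
    (h : IsSolutionGerm (ℓ + 1 : ℕ) f (A₀ : F →L[𝕜] F) P π A₀)
    (h' : IsSolutionGerm (ℓ + 1 : ℕ) f (A₀ : F →L[𝕜] F) P π' A₀) : ∀ᶠ x in 𝓝 0, π' x = π x := by
  set d : X → F := fun x => π' x - π x with hd
  have hd1 : d =o[𝓝 0] fun x => ‖x‖ := by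
    have h3 := (h'.hasFDerivAt.sub h.hasFDerivAt).isLittleO
    rw [sub_self] at h3
    simpa [hd, h'.map_zero, h.map_zero] using h3.norm_right
  have hd0 : d 0 = 0 := by simp only [hd, h.map_zero, h'.map_zero, sub_zero]
  have heq : (fun x => d (f x) - d (f ((fun _ => 0 : X → X) x)) - (A₀ : F →L[𝕜] F) (d x))
      =o[𝓝 0] d := by
    refine (isLittleO_zero d (𝓝 0)).congr' ?_ EventuallyEq.rfl
    filter_upwards [h.semiconj, h'.semiconj] with x e1 e2
    rw [hf0, hd0]
    simp only [hd, e1, e2, ContinuousLinearEquiv.coe_coe, map_sub, sub_zero, sub_self]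
  have hdO := isBigO_of_difference_equation hℓ (κ := 0) (Z := 0) (P := P')
    (fun n R x => by
      simp only [_root_.zero_apply, ContinuousLinearMap.map_zero, zero_smul]
      exact R.map_zero) (h'.contDiffAt.sub h.contDiffAt) hd1 hf0 hfA rfl (hasFDerivAt_const _ _)
    heq hu
  obtain ⟨C, hC⟩ := hdO.bound
  obtain ⟨V, hV, hVe⟩ := exists_nhds_eq_of_isBigO hgap hf0 hfA h.hasStrictFDerivAt
    h'.hasFDerivAt.continuousAt h.hasFDerivAt.continuousAt h'.map_zero h.map_zero h'.semiconj
    h.semiconj (Γ := fun x y => x = y) (C := C) hC (fun x _ y _ hxy => by rw [hxy])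
    (fun x hx y hy hxy => by
      subst hxy
      have e2 : ‖d x‖ ≤ C * ‖‖x‖ ^ (ℓ + 1)‖ := hx
      rw [Real.norm_of_nonneg (by positivity)] at e2
      have e3 := (norm_nonneg _).trans e2
      rw [mul_add]
      change ‖d x‖ ≤ _
      linarith)
  filter_upwards [hV] with x hx
  exact hVe x hx x hx rfl

end Germs

end InvFoliation

namespace InvFoliation
open Set Filter Topology Asymptotics

universe v

/-! ### Transition maps on neighborhoods of uniform size -/

section CbDiffeo

variable {𝕜 : Type*} [RCLike 𝕜] {E : Type v} [NormedAddCommGroup E] [NormedSpace 𝕜 E]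
  {n : WithTop ℕ∞}

/-- A local homeomorphism which is `C^n_b` together with its inverse. -/
structure IsCbDiffeo (𝕜 : Type*) [RCLike 𝕜] {E : Type v} [NormedAddCommGroup E] [NormedSpace 𝕜 E]
    (n : WithTop ℕ∞) (e : OpenPartialHomeomorph E E) : Prop where
  isCb : IsCb 𝕜 n e e.source
  isCb_symm : IsCb 𝕜 n e.symm e.target

lemma IsCbDiffeo.symm {e : OpenPartialHomeomorph E E} (he : IsCbDiffeo 𝕜 n e) :
    IsCbDiffeo 𝕜 n e.symm :=
  ⟨he.isCb_symm, he.isCb⟩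

lemma isCb_trans {e e' : OpenPartialHomeomorph E E} (he : IsCb 𝕜 n e e.source)
    (he' : IsCb 𝕜 n e' e'.source) : IsCb 𝕜 n (e.trans e') (e.trans e').source := by
  rw [OpenPartialHomeomorph.coe_trans]
  refine he'.comp e'.open_source (he.mono ?_) (e.trans e').open_source ?_
  · rw [OpenPartialHomeomorph.trans_source]; exact inter_subset_left
  · rw [OpenPartialHomeomorph.trans_source]; exact fun x hx => hx.2

lemma IsCbDiffeo.trans {e e' : OpenPartialHomeomorph E E} (he : IsCbDiffeo 𝕜 n e)
    (he' : IsCbDiffeo 𝕜 n e') : IsCbDiffeo 𝕜 n (e.trans e') := by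
  refine ⟨isCb_trans he.isCb he'.isCb, ?_⟩
  have := isCb_trans (e := e'.symm) (e' := e.symm) he'.isCb_symm he.isCb_symm
  rwa [← OpenPartialHomeomorph.trans_symm_eq_symm_trans_symm] at this

/-- A map whose derivative is close to an automorphism `L` is a `C^n_b` diffeomorphism on each open
subset of a ball. -/
lemma exists_pos_isCbDiffeo [CompleteSpace E] (L : E ≃L[𝕜] E) : ∃ ε : ℝ, 0 < ε ∧
    ∀ (n : WithTop ℕ∞) (ρ : ℝ) (g : E → E) (S : Set E), 1 ≤ n → IsOpen S → S ⊆ Metric.ball 0 ρ →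
      IsCb 𝕜 n g (Metric.ball 0 ρ) →
      (∀ y ∈ Metric.ball (0 : E) ρ, ‖fderiv 𝕜 g y - (L : E →L[𝕜] E)‖ ≤ ε) →
      ∃ G : OpenPartialHomeomorph E E, ⇑G = g ∧ G.source = S ∧ IsCbDiffeo 𝕜 n G := by
  obtain ⟨c, hc⟩ := exists_gt ‖Ring.inverse (L : E →L[𝕜] E)‖
  have hu : IsUnit (L : E →L[𝕜] E) :=
    ⟨⟨L, L.symm, by ext; simp, by ext; simp⟩, rfl⟩
  obtain ⟨ε₁, hε₁, hball⟩ := Metric.isOpen_iff.1 (isOpen_boundedUnits (R := E →L[𝕜] E) c)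
    (L : E →L[𝕜] E) ⟨hu, hc⟩
  set ε : ℝ := min (ε₁ / 2) (‖(L.symm : E →L[𝕜] E)‖ + 1)⁻¹ with hε
  have hε0 : 0 < ε := lt_min (by positivity) (by positivity)
  refine ⟨ε, hε0, fun n ρ g S hn hS hSρ hg hgL => ?_⟩
  have hn0 : n ≠ 0 := fun h => by simp [h] at hn
  have hdiff : ∀ y ∈ Metric.ball (0 : E) ρ, DifferentiableAt 𝕜 g y := fun y hy =>
    (hg.1.contDiffAt (Metric.isOpen_ball.mem_nhds hy)).differentiableAt hn0
  have happ : ApproximatesLinearOn g (L : E →L[𝕜] E) S (Real.toNNReal ε) := by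
    intro x hx y hy
    rw [Real.coe_toNNReal _ hε0.le]
    let _ : NormedSpace ℝ E := NormedSpace.restrictScalars ℝ 𝕜 E
    exact Convex.norm_image_sub_le_of_norm_fderiv_le' hdiff hgL (convex_ball 0 ρ) (hSρ hy) (hSρ hx)
  have hsub : Subsingleton E ∨ Real.toNNReal ε < ‖(L.symm : E →L[𝕜] E)‖₊⁻¹ := by
    rcases L.subsingleton_or_nnnorm_symm_pos with h | h
    · exact Or.inl h
    · refine Or.inr ?_
      rw [← NNReal.coe_lt_coe]
      have h' : 0 < ‖(L.symm : E →L[𝕜] E)‖ := h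
      rw [Real.coe_toNNReal _ hε0.le]
      push_cast
      refine lt_of_le_of_lt (min_le_right _ _) ?_
      exact inv_strictAnti₀ h' (lt_add_one _)
  refine ⟨happ.toOpenPartialHomeomorph g S hsub hS, rfl, rfl, hg.mono hSρ, ?_⟩
  refine IsCb.symm (hg.mono hSρ) hn (c := c) (Metric.isBounded_ball.subset hSρ) fun y hy => ?_
  refine hball ?_
  rw [mem_ball_iff_norm]
  refine (hgL y (hSρ hy)).trans_lt ((min_le_left _ _).trans_lt (half_lt_self hε₁))

lemma norm_sub_clm_le {L : E →L[𝕜] E} {f : E → E} {ρ ε : ℝ} (hf0 : f 0 = 0)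
    (hf : ∀ x ∈ Metric.ball (0 : E) ρ, DifferentiableAt 𝕜 f x)
    (hfL : ∀ x ∈ Metric.ball (0 : E) ρ, ‖fderiv 𝕜 f x - L‖ ≤ ε) {x : E}
    (hx : x ∈ Metric.ball (0 : E) ρ) : ‖f x - L x‖ ≤ ε * ‖x‖ := by
  let _ : NormedSpace ℝ E := NormedSpace.restrictScalars ℝ 𝕜 E
  have hρ : 0 < ρ := Metric.pos_of_mem_ball hx
  simpa [hf0] using Convex.norm_image_sub_le_of_norm_fderiv_le' hf hfL (convex_ball 0 ρ)
    (Metric.mem_ball_self hρ) hx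

end CbDiffeo

section Transition

variable {𝕜 : Type*} [RCLike 𝕜] {X : Type v} [NormedAddCommGroup X] [NormedSpace 𝕜 X]
  {F : Type v} [NormedAddCommGroup F] [NormedSpace 𝕜 F]

/-- The quotient map `A₀` contracts at any rate larger than `a` if `A` contracts at the rate `a`. -/
lemma exists_pow_lt_of_semiconj {ι : F →L[𝕜] X} {P : X →L[𝕜] F} (hPι : P.comp ι = .id 𝕜 F)
    {A : X →L[𝕜] X} {A₀ : F →L[𝕜] F} (hPA : P.comp A = A₀.comp P) {a c : ℝ} (ha : 0 < a)
    (hac : a < c) {N : ℕ} (hA : ‖A ^ N‖ < a ^ N) : ∃ N, ‖A₀ ^ N‖ < c ^ N := by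
  obtain ⟨ν, K, hν, hνA⟩ := exists_adapted_norm A ha hA
  have hc : 0 < c := ha.trans hac
  have hpow : ∀ (n : ℕ) x, ν ((A ^ n) x) ≤ a ^ n * ν x := by
    intro n x
    induction n with
    | zero => simp
    | succ n ih =>
      rw [pow_succ' A, mul_apply_eq_comp, pow_succ', mul_assoc]
      exact (hνA _).trans (by gcongr)
  have hPn : ∀ (n : ℕ) x, (A₀ ^ n) (P x) = P ((A ^ n) x) := by
    intro n x
    induction n with
    | zero => simp
    | succ n ih =>
      rw [pow_succ', mul_apply_eq_comp, ih, pow_succ', mul_apply_eq_comp]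
      exact (DFunLike.congr_fun hPA _).symm
  have hK := hν.pos
  have hbd : ∀ n : ℕ, ‖A₀ ^ n‖ ≤ ‖P‖ * (K * ‖ι‖) * a ^ n := by
    intro n
    refine ContinuousLinearMap.opNorm_le_bound _ (by positivity) fun y => ?_
    have h1 : (A₀ ^ n) y = P ((A ^ n) (ι y)) := by
      rw [← hPn]
      congr 1
      exact (DFunLike.congr_fun hPι y).symm
    rw [h1]
    calc ‖P ((A ^ n) (ι y))‖ ≤ ‖P‖ * ‖(A ^ n) (ι y)‖ := P.le_opNorm _
      _ ≤ ‖P‖ * (a ^ n * (K * (‖ι‖ * ‖y‖))) := by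
        gcongr
        refine ((hν.norm_le _).trans (hpow n _)).trans ?_
        gcongr
        refine (hν.le_norm _).trans ?_
        gcongr
        exact ι.le_opNorm y
      _ = _ := by ring
  have hlim : Tendsto (fun n : ℕ => ‖P‖ * (K * ‖ι‖) * (a / c) ^ n) atTop (𝓝 0) := by
    simpa using (tendsto_pow_atTop_nhds_zero_of_lt_one (by positivity)
      ((div_lt_one hc).2 hac)).const_mul (‖P‖ * (K * ‖ι‖))
  obtain ⟨n, hn⟩ := (hlim.eventually (gt_mem_nhds one_pos)).exists
  refine ⟨n, (hbd n).trans_lt ?_⟩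
  rwa [div_pow, ← mul_div_assoc, div_lt_one (by positivity)] at hn

/-- `(g, π)` is a `C^k_b` solution on the neighborhood `U`, normalized by `Dπ(0) = P` and
`Dg(0) = A₀`, where `Dg` is `ε`-close to `A₀` on the ball of radius `ρ`. -/
structure IsNormalizedSolution (k : WithTop ℕ∞) (ρ ε : ℝ) (f : X → X) (A₀ : F →L[𝕜] F)
    (P : X →L[𝕜] F) (U : Set X) (π : X → F) (g : F → F) : Prop where
  isOpen : IsOpen U
  zero_mem : (0 : X) ∈ U
  isCb : IsCb 𝕜 k π U
  map_zero : π 0 = 0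
  hasFDerivAt : HasFDerivAt π P 0
  mapsTo : MapsTo f U U
  semiconj : ∀ x ∈ U, π (f x) = g (π x)
  isCb_ball : IsCb 𝕜 k g (Metric.ball 0 ρ)
  hasFDerivAt_zero : HasFDerivAt g A₀ 0
  norm_sub_le : ∀ y ∈ Metric.ball (0 : F) ρ, ‖fderiv 𝕜 g y - A₀‖ ≤ ε

lemma IsNormalizedSolution.isSolutionGerm {k : WithTop ℕ∞} {ρ ε : ℝ} {f : X → X}
    {A₀ : F →L[𝕜] F} {P : X →L[𝕜] F} {U : Set X} {π : X → F} {g : F → F}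
    (h : IsNormalizedSolution k ρ ε f A₀ P U π g) (hρ : 0 < ρ) {n : ℕ} (hn : 1 ≤ n)
    (hnk : (n : WithTop ℕ∞) ≤ k) : IsSolutionGerm n f A₀ P π g where
  contDiffAt := (h.isCb.1.contDiffAt (h.isOpen.mem_nhds h.zero_mem)).of_le hnk
  map_zero := h.map_zero
  hasFDerivAt := h.hasFDerivAt
  hasStrictFDerivAt := ((h.isCb_ball.1.contDiffAt (Metric.ball_mem_nhds _ hρ)).of_le
    hnk).hasStrictFDerivAt' h.hasFDerivAt_zero (by exact_mod_cast by omega)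
  semiconj := by
    filter_upwards [h.isOpen.mem_nhds h.zero_mem] with x hx
    exact h.semiconj x hx

variable [CompleteSpace F]

/-- The restriction of a normalized `π` to a neighborhood of `0` in `F` is a local
diffeomorphism. -/
lemma IsNormalizedSolution.exists_restrict {k : WithTop ℕ∞} {ρ ε : ℝ} {f : X → X}
    {A₀ : F →L[𝕜] F} {P : X →L[𝕜] F} {U : Set X} {π : X → F} {g : F → F}
    (h : IsNormalizedSolution k ρ ε f A₀ P U π g) (hk : 1 ≤ k) {ι : F →L[𝕜] X}
    (hPι : P.comp ι = .id 𝕜 F) : ∃ e : OpenPartialHomeomorph F F, (∀ y, e y = π (ι y)) ∧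
      (0 : F) ∈ e.source ∧ IsCbDiffeo 𝕜 k e := by
  have hS : IsOpen (ι ⁻¹' U ∩ Metric.ball 0 1) := (h.isOpen.preimage ι.continuous).inter
    Metric.isOpen_ball
  have hcb : IsCb 𝕜 k (fun y => π (ι y)) (ι ⁻¹' U ∩ Metric.ball 0 1) :=
    h.isCb.comp h.isOpen (isCb_clm ι (Metric.isBounded_ball.subset inter_subset_right)) hS
      fun y hy => hy.1
  have hd : HasFDerivAt (fun y => π (ι y)) ((ContinuousLinearEquiv.refl 𝕜 F : F ≃L[𝕜] F) :
      F →L[𝕜] F) 0 := by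
    have := HasFDerivAt.comp (g := π) (0 : F) (by rw [_root_.map_zero]; exact h.hasFDerivAt)
      ι.hasFDerivAt
    rw [hPι] at this
    exact this
  obtain ⟨e, he, h0, -, h1, h2⟩ := exists_openPartialHomeomorph hS hk hcb
    (x := 0) ⟨by simpa using h.zero_mem, Metric.mem_ball_self one_pos⟩ hd
  exact ⟨e, fun y => by rw [he], h0, h1, h2⟩

/-- Near `0`, one normalized solution is obtained from another one by a transition map. -/
lemma IsNormalizedSolution.exists_transition_germ {ι : F →L[𝕜] X} {P : X →L[𝕜] F}
    (hPι : P.comp ι = .id 𝕜 F) {A : X →L[𝕜] X} {A₀ : F ≃L[𝕜] F} {ℓ : ℕ} {a m : ℝ} (hℓ : 1 ≤ ℓ)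
    (hgap : HasGap A A₀ ℓ a m)
    (hu : ∀ n, 2 ≤ n → n ≤ ℓ → IsUnit (homological n (1 : 𝕜) (A₀ : F →L[𝕜] F) A (ι.comp P)))
    {f : X → X} (hf0 : f 0 = 0) (hfA : HasFDerivAt f A 0) {k : WithTop ℕ∞}
    (hk : ((ℓ + 1 : ℕ) : WithTop ℕ∞) ≤ k) {ρ ε : ℝ} (hρ : 0 < ρ) {U U' : Set X} {π π' : X → F}
    {g g' : F → F} (h : IsNormalizedSolution k ρ ε f (A₀ : F →L[𝕜] F) P U π g)
    (h' : IsNormalizedSolution k ρ ε f (A₀ : F →L[𝕜] F) P U' π' g') :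
    ∃ τ : OpenPartialHomeomorph F F, IsCbDiffeo 𝕜 k τ ∧
      ∀ᶠ x in 𝓝 0, π x ∈ τ.source ∧ π' x = τ (π x) := by
  have h1k : 1 ≤ k := le_trans (by exact_mod_cast Nat.le_add_left 1 ℓ) hk
  obtain ⟨e, he, h0e, hcb⟩ := h.exists_restrict h1k hPι
  obtain ⟨e', he', h0e', hcb'⟩ := h'.exists_restrict h1k hPι
  have he0 : e 0 = 0 := by rw [he, _root_.map_zero, h.map_zero]
  have h0t : (0 : F) ∈ e.target := by rw [← he0]; exact e.map_source h0e
  have hs0 : e.symm 0 = 0 := by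
    have := e.left_inv h0e
    rwa [he0] at this
  have hsd : HasFDerivAt e.symm ((ContinuousLinearEquiv.refl 𝕜 F : F ≃L[𝕜] F) :
      F →L[𝕜] F) 0 := by
    refine e.hasFDerivAt_symm h0t (f' := ContinuousLinearEquiv.refl 𝕜 F) ?_
    have h1 := HasFDerivAt.comp (g := π) (0 : F) (by rw [_root_.map_zero]; exact h.hasFDerivAt)
      ι.hasFDerivAt
    rw [hPι] at h1
    rw [hs0]
    exact h1.congr_of_eventuallyEq (Eventually.of_forall he)
  have hw := IsSolutionGerm.eventually_eq_comp hPι hℓ hgap hu hf0 hfA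
    (h.isSolutionGerm hρ (by omega) hk) (h'.isSolutionGerm hρ (by omega) hk)
    (w := fun y => ι (e.symm y)) (by simp only [hs0, _root_.map_zero])
    (ι.contDiff.contDiffAt.comp (0 : F)
      ((hcb.isCb_symm.1.contDiffAt (e.open_target.mem_nhds h0t)).of_le hk))
    ((ι.hasFDerivAt.comp (0 : F) hsd).congr_fderiv (by ext; rfl))
    (by
      filter_upwards [e.open_target.mem_nhds h0t] with y hy
      rw [← he, e.right_inv hy])
  refine ⟨e.symm.trans e', hcb.symm.trans hcb', ?_⟩
  have h0τ : (0 : F) ∈ (e.symm.trans e').source := by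
    rw [OpenPartialHomeomorph.trans_source]
    refine ⟨h0t, ?_⟩
    rw [mem_preimage, hs0]
    exact h0e'
  have hev := h.hasFDerivAt.continuousAt.eventually_mem
    ((e.symm.trans e').open_source.mem_nhds (by rwa [h.map_zero]))
  filter_upwards [hw, hev] with x e1 e2
  refine ⟨e2, ?_⟩
  rw [e1, OpenPartialHomeomorph.coe_trans, Function.comp_apply, he']

/-- The germ of a transition map is extended to a neighborhood of uniform size by means of
`θ = g'⁻¹ ∘ θ ∘ g`: a fixed number of iterations of `f` moves points of a ball, whose size depends
on bounds of the nonlinearities only, to the domain of the germ. -/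
lemma exists_uniform_transition {ι : F →L[𝕜] X} {P : X →L[𝕜] F}
    (hPι : P.comp ι = .id 𝕜 F) {A : X →L[𝕜] X} {A₀ : F ≃L[𝕜] F}
    (hPA : P.comp A = (A₀ : F →L[𝕜] F).comp P) {ℓ : ℕ} {a m : ℝ} (hℓ : 1 ≤ ℓ)
    (hgap : HasGap A A₀ ℓ a m)
    (hu : ∀ n, 2 ≤ n → n ≤ ℓ → IsUnit (homological n (1 : 𝕜) (A₀ : F →L[𝕜] F) A (ι.comp P))) :
    ∃ ε : ℝ, 0 < ε ∧ ∀ ρ : ℝ, 0 < ρ → ∃ δ : ℝ, 0 < δ ∧ ∀ (k : WithTop ℕ∞) (f : X → X),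
      ((ℓ + 1 : ℕ) : WithTop ℕ∞) ≤ k → f 0 = 0 → HasFDerivAt f A 0 →
      (∀ x ∈ Metric.ball (0 : X) ρ, DifferentiableAt 𝕜 f x) →
      (∀ x ∈ Metric.ball (0 : X) ρ, ‖fderiv 𝕜 f x - A‖ ≤ ε) →
      ∀ (U U' : Set X) (π π' : X → F) (g g' : F → F),
        IsNormalizedSolution k ρ ε f (A₀ : F →L[𝕜] F) P U π g →
        IsNormalizedSolution k ρ ε f (A₀ : F →L[𝕜] F) P U' π' g' →
        ∃ θ : OpenPartialHomeomorph F F, IsCbDiffeo 𝕜 k θ ∧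
          ∀ x ∈ U ∩ U', ‖x‖ < δ → ‖π x‖ < δ → ‖π' x‖ < δ →
            π x ∈ θ.source ∧ π' x = θ (π x) ∧ g (π x) ∈ θ.source ∧
              g' (π' x) = θ (g (π x)) := by
  obtain ⟨c₁, hac₁, hc₁1⟩ := exists_between hgap.lt_one
  obtain ⟨c, hc₁c, hc1⟩ := exists_between hc₁1
  have hc0 : 0 < c := hgap.pos.trans (hac₁.trans hc₁c)
  obtain ⟨N, hN⟩ := hgap.exists_pow
  obtain ⟨N₀, hN₀⟩ := exists_pow_lt_of_semiconj hPι hPA hgap.pos hac₁ hN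
  obtain ⟨ν, K, hν, hνA⟩ := exists_adapted_norm A hgap.pos hN
  obtain ⟨μ, K₀, hμ, hμA⟩ := exists_adapted_norm (A₀ : F →L[𝕜] F) (hgap.pos.trans hac₁) hN₀
  obtain ⟨ε₀, hε₀, hdiffeo⟩ := exists_pos_isCbDiffeo A₀
  have hK := hν.pos
  have hK₀ := hμ.pos
  have hacc : 0 < c - a := by linarith
  have hccc : 0 < c - c₁ := by linarith
  refine ⟨min ε₀ (min ((c - a) / K) ((c - c₁) / K₀)), by positivity, fun ρ hρ =>
    ⟨min (ρ / K) (ρ / K₀), by positivity, ?_⟩⟩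
  intro k f hk hf0 hfA hfd hfε U U' π π' g g' h h'
  set ε := min ε₀ (min ((c - a) / K) ((c - c₁) / K₀)) with hε
  have hεa : ε ≤ (c - a) / K := (min_le_right _ _).trans (min_le_left _ _)
  have hεc : ε ≤ (c - c₁) / K₀ := (min_le_right _ _).trans (min_le_right _ _)
  have h1k : 1 ≤ k := le_trans (by exact_mod_cast Nat.le_add_left 1 ℓ) hk
  have hk0 : k ≠ 0 := fun h => by simp [h] at h1k
  have hfν : ∀ x, ν x < ρ → ν (f x) ≤ c * ν x := fun x hx => by
    refine hν.contract hνA ?_ (by linarith)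
    refine (norm_sub_clm_le hf0 hfd hfε (by simpa using (hν.norm_le x).trans_lt hx)).trans ?_
    gcongr
  have hball₀ : {y | μ y < ρ} ⊆ Metric.ball (0 : F) ρ := fun y hy => by
    simpa using (hμ.norm_le y).trans_lt hy
  have hgμ : ∀ {U : Set X} {π : X → F} {g : F → F},
      IsNormalizedSolution k ρ ε f (A₀ : F →L[𝕜] F) P U π g → ∀ y, μ y < ρ → μ (g y) < ρ := by
    intro U π g h y hy
    have hg0 : g 0 = 0 := by
      have := h.semiconj 0 h.zero_mem
      rwa [hf0, h.map_zero, eq_comm] at this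
    have h1 : μ (g y) ≤ c * μ y := by
      refine hμ.contract hμA ?_ (by linarith)
      refine (norm_sub_clm_le hg0 (fun y hy => (h.isCb_ball.1.contDiffAt
        (Metric.isOpen_ball.mem_nhds hy)).differentiableAt hk0) h.norm_sub_le (hball₀ hy)).trans ?_
      gcongr
    exact h1.trans_lt ((mul_le_of_le_one_left (hμ.nonneg y) hc1.le).trans_lt hy)
  obtain ⟨G, hG, hGs, hGcb⟩ := hdiffeo k ρ g _ h1k (hμ.isOpen_ball ρ) hball₀ h.isCb_ball
    fun y hy => (h.norm_sub_le y hy).trans (min_le_left _ _)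
  obtain ⟨G', hG', hGs', hGcb'⟩ := hdiffeo k ρ g' _ h1k (hμ.isOpen_ball ρ) hball₀ h'.isCb_ball
    fun y hy => (h'.norm_sub_le y hy).trans (min_le_left _ _)
  set W : Set X := {x | x ∈ U ∩ U' ∧ ν x < ρ ∧ μ (π x) < ρ ∧ μ (π' x) < ρ} with hW
  have hWf : ∀ x ∈ W, f x ∈ W := by
    rintro x ⟨⟨hx, hx'⟩, h1, h2, h3⟩
    refine ⟨⟨h.mapsTo hx, h'.mapsTo hx'⟩, ?_, ?_, ?_⟩
    · exact (hfν x h1).trans_lt ((mul_le_of_le_one_left (hν.nonneg x) hc1.le).trans_lt h1)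
    · rw [h.semiconj x hx]; exact hgμ h _ h2
    · rw [h'.semiconj x hx']; exact hgμ h' _ h3
  obtain ⟨τ, hτ, hτe⟩ := h.exists_transition_germ hPι hℓ hgap hu hf0 hfA hk hρ h'
  obtain ⟨s, hs, hτs⟩ := hν.exists_forall_lt hτe
  obtain ⟨n, hn⟩ : ∃ n : ℕ, c ^ n * ρ < s := by
    obtain ⟨n, hn⟩ := exists_pow_lt_of_lt_one (div_pos hs hρ) hc1
    exact ⟨n, by rwa [lt_div_iff₀ hρ] at hn⟩
  have hext : ∀ n : ℕ, (∃ θ : OpenPartialHomeomorph F F, IsCbDiffeo 𝕜 k θ ∧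
      ∀ x ∈ W, ν x < c ^ n * ρ → π x ∈ θ.source ∧ π' x = θ (π x)) →
      ∃ θ : OpenPartialHomeomorph F F, IsCbDiffeo 𝕜 k θ ∧
      ∀ x ∈ W, π x ∈ θ.source ∧ π' x = θ (π x) := by
    intro n
    induction n with
    | zero =>
      rintro ⟨θ, hθ, hθW⟩
      exact ⟨θ, hθ, fun x hx => hθW x hx (by simpa using hx.2.1)⟩
    | succ n ih =>
      rintro ⟨θ, hθ, hθW⟩
      refine ih ⟨G.trans (θ.trans G'.symm), hGcb.trans (hθ.trans hGcb'.symm), fun x hx hxn => ?_⟩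
      have h1 : ν (f x) < c ^ (n + 1) * ρ := by
        refine (hfν x hx.2.1).trans_lt ?_
        rw [pow_succ', mul_assoc]
        gcongr
      obtain ⟨h2, h3⟩ := hθW (f x) (hWf x hx) h1
      have h4 : G (π x) = π (f x) := by rw [hG, h.semiconj x hx.1.1]
      have h5 : G' (π' x) = θ (π (f x)) := by rw [hG', ← h'.semiconj x hx.1.2, h3]
      have h6 : π x ∈ G.source := by rw [hGs]; exact hx.2.2.1
      have h7 : π' x ∈ G'.source := by rw [hGs']; exact hx.2.2.2
      constructor
      · simp only [OpenPartialHomeomorph.trans_source, OpenPartialHomeomorph.symm_source,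
          mem_inter_iff, mem_preimage, h4]
        refine ⟨h6, h2, ?_⟩
        rw [← h5]
        exact G'.map_source h7
      · simp only [OpenPartialHomeomorph.coe_trans, Function.comp_apply, h4]
        rw [← h5, G'.left_inv h7]
  obtain ⟨θ, hθ, hθW⟩ := hext n ⟨τ, hτ, fun x _ hx => hτs x (hx.trans hn)⟩
  refine ⟨θ, hθ, fun x hx h1 h2 h3 => ?_⟩
  have hxW : x ∈ W := by
    refine ⟨hx, ?_, ?_, ?_⟩
    · refine (hν.le_norm x).trans_lt ?_
      rw [mul_comm, ← lt_div_iff₀ hK]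
      exact h1.trans_le (min_le_left _ _)
    · refine (hμ.le_norm _).trans_lt ?_
      rw [mul_comm, ← lt_div_iff₀ hK₀]
      exact h2.trans_le (min_le_right _ _)
    · refine (hμ.le_norm _).trans_lt ?_
      rw [mul_comm, ← lt_div_iff₀ hK₀]
      exact h3.trans_le (min_le_right _ _)
  obtain ⟨q1, q2⟩ := hθW x hxW
  obtain ⟨q3, q4⟩ := hθW (f x) (hWf x hxW)
  rw [h.semiconj x hx.1] at q3 q4
  rw [h'.semiconj x hx.2] at q4
  exact ⟨q1, q2, q3, q4⟩

end Transition

end InvFoliation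

namespace InvFoliation
open Set Filter Topology Asymptotics

universe v

/-! ### The assertions for a given splitting -/

section Conjugation

variable {𝕜 : Type*} [RCLike 𝕜] {E : Type v} [NormedAddCommGroup E] [NormedSpace 𝕜 E]
  {n : WithTop ℕ∞}

lemma isBounded_preimage_symm {S : Set E} (hb : Bornology.IsBounded S) (L : E ≃L[𝕜] E) :
    Bornology.IsBounded (L.symm ⁻¹' S) := by
  obtain ⟨M, hM⟩ := hb.exists_norm_le
  refine isBounded_iff_forall_norm_le.2 ⟨‖(L : E →L[𝕜] E)‖ * M, fun y hy => ?_⟩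
  calc ‖y‖ = ‖(L : E →L[𝕜] E) (L.symm y)‖ := by simp
    _ ≤ ‖(L : E →L[𝕜] E)‖ * ‖L.symm y‖ := ContinuousLinearMap.le_opNorm _ _
    _ ≤ _ := by gcongr; exact hM _ hy

lemma IsCb.conj {f : E → E} {S : Set E} (hf : IsCb 𝕜 n f S) (hS : IsOpen S)
    (hb : Bornology.IsBounded S) (L L' : E ≃L[𝕜] E) :
    IsCb 𝕜 n (fun y => L' (f (L.symm y))) (L.symm ⁻¹' S) := by
  have hS' : IsOpen (L.symm ⁻¹' S) := hS.preimage L.symm.continuous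
  exact (hf.comp hS (isCb_clm (L.symm : E →L[𝕜] E) (isBounded_preimage_symm hb L)) hS'
    fun y hy => hy).clm_comp hS' (L' : E →L[𝕜] E)

lemma IsCbDiffeo.isBounded_source {e : OpenPartialHomeomorph E E} (he : IsCbDiffeo 𝕜 n e) :
    Bornology.IsBounded e.source := by
  obtain ⟨M, hM⟩ := he.isCb_symm.bounded
  refine isBounded_iff_forall_norm_le.2 ⟨M, fun x hx => ?_⟩
  have := hM (e x) (e.map_source hx)
  rwa [e.left_inv hx] at this

/-- `L' ∘ θ ∘ L⁻¹` as a local homeomorphism. -/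
noncomputable def conjHomeomorph (θ : OpenPartialHomeomorph E E) (L L' : E ≃L[𝕜] E) :
    OpenPartialHomeomorph E E :=
  L.symm.toHomeomorph.transOpenPartialHomeomorph (θ.transHomeomorph L'.toHomeomorph)

lemma IsCbDiffeo.conj {θ : OpenPartialHomeomorph E E} (hθ : IsCbDiffeo 𝕜 n θ) (L L' : E ≃L[𝕜] E) :
    IsCbDiffeo 𝕜 n (conjHomeomorph θ L L') :=
  ⟨hθ.isCb.conj θ.open_source hθ.isBounded_source L L',
    hθ.isCb_symm.conj θ.open_target hθ.symm.isBounded_source L' L⟩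

end Conjugation

section Splitting

variable {𝕜 : Type*} [RCLike 𝕜] {X : Type v} [NormedAddCommGroup X] [NormedSpace 𝕜 X]
  {X₀ X₁ : Submodule 𝕜 X} {k : WithTop ℕ∞} {O : Set X} {f : X → X} {U U' : Set X}
  {π π' : X → X₀} {O₀ O₀' : Set X₀} {g g' : X₀ → X₀} {C C' : X₀ ≃L[𝕜] X₀}

lemma IsSolution.hasFDerivAt (h : IsSolution X₀ X₁ k O f U π O₀ g C) (hk : 1 ≤ k)
    (hX : X₀.IsTopCompl X₁) :
    HasFDerivAt π ((C : X₀ →L[𝕜] X₀).comp (X₀.projectionOntoL X₁ hX)) 0 := by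
  have hk0 : k ≠ 0 := fun h => by simp [h] at hk
  have hd := ((h.isCb.1.contDiffAt (h.isOpen.mem_nhds h.zero_mem)).differentiableAt hk0).hasFDerivAt
  refine hd.congr_fderiv ?_
  ext1 x
  have hx : x - (X₀.projectionOntoL X₁ hX x : X) ∈ X₁ := by
    rw [← Submodule.projectionOntoL_apply_eq_zero_iff hX, map_sub,
      Submodule.projectionOntoL_apply_left, sub_self]
  have hx' : fderiv 𝕜 π 0 (x - (X₀.projectionOntoL X₁ hX x : X)) = 0 := by
    rw [← ContinuousLinearMap.coe_coe, ← LinearMap.mem_ker, h.ker_eq]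
    exact hx
  rw [map_sub, h.fderiv_eq, sub_eq_zero] at hx'
  exact hx'

lemma IsSolution.map_nhds [CompleteSpace X] [CompleteSpace X₀]
    (h : IsSolution X₀ X₁ k O f U π O₀ g C) (hk : 1 ≤ k)
    (hX : X₀.IsTopCompl X₁) : map π (𝓝 0) = 𝓝 0 := by
  have hk0 : k ≠ 0 := fun h => by simp [h] at hk
  have hd := (h.isCb.1.contDiffAt (h.isOpen.mem_nhds h.zero_mem)).hasStrictFDerivAt'
    (h.hasFDerivAt hk hX) hk0
  have := hd.map_nhds_eq_of_surj (LinearMap.range_eq_top.2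
    (C.surjective.comp (Submodule.projectionOntoL_surjective hX)))
  rwa [h.map_zero] at this

lemma IsSolution.hasFDerivAt_conj (h : IsSolution X₀ X₁ k O f U π O₀ g C) (hk : 1 ≤ k)
    (hX : X₀.IsTopCompl X₁) {A : X →L[𝕜] X} {A₀ : X₀ →L[𝕜] X₀}
    (hPA : (X₀.projectionOntoL X₁ hX).comp A = A₀.comp (X₀.projectionOntoL X₁ hX))
    (hf0 : f 0 = 0) (hfA : HasFDerivAt f A 0) :
    HasFDerivAt (fun y => C.symm (g (C y))) A₀ 0 := by
  have hk0 : k ≠ 0 := fun h => by simp [h] at hk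
  set P := X₀.projectionOntoL X₁ hX with hP
  have h0 : (0 : X₀) ∈ O₀ := by
    have := h.mapsTo_π h.zero_mem
    rwa [h.map_zero] at this
  have hg : HasFDerivAt g (fderiv 𝕜 g 0) 0 :=
    ((h.isCb₀.1.contDiffAt (h.isOpen₀.mem_nhds h0)).differentiableAt hk0).hasFDerivAt
  have hπ := h.hasFDerivAt hk hX
  have e1 : HasFDerivAt (fun x => π (f x)) (((C : X₀ →L[𝕜] X₀).comp P).comp A) 0 :=
    HasFDerivAt.comp (g := π) (0 : X) (by rwa [hf0]) hfA
  have e2 : HasFDerivAt (fun x => g (π x)) ((fderiv 𝕜 g 0).comp ((C : X₀ →L[𝕜] X₀).comp P)) 0 :=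
    HasFDerivAt.comp (g := g) (0 : X) (by rwa [h.map_zero]) hπ
  have e3 : ((C : X₀ →L[𝕜] X₀).comp P).comp A = (fderiv 𝕜 g 0).comp ((C : X₀ →L[𝕜] X₀).comp P) := by
    refine e1.unique (e2.congr_of_eventuallyEq ?_)
    filter_upwards [h.isOpen.mem_nhds h.zero_mem] with x hx
    exact h.semiconj x hx
  have e4 : HasFDerivAt (fun y => C.symm (g (C y)))
      ((C.symm : X₀ →L[𝕜] X₀).comp ((fderiv 𝕜 g 0).comp (C : X₀ →L[𝕜] X₀))) 0 := by
    refine C.symm.hasFDerivAt.comp (0 : X₀) (HasFDerivAt.comp (g := g) (0 : X₀) ?_ C.hasFDerivAt)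
    rwa [_root_.map_zero]
  refine e4.congr_fderiv ?_
  ext1 y
  have e5 := DFunLike.congr_fun e3 (y : X)
  have e6 := DFunLike.congr_fun hPA (y : X)
  simp only [ContinuousLinearMap.comp_apply, ContinuousLinearEquiv.coe_coe, hP,
    Submodule.projectionOntoL_apply_left] at e5 e6 ⊢
  rw [← e5, e6, C.symm_apply_apply]

lemma IsSolution.isNormalizedSolution (h : IsSolution X₀ X₁ k O f U π O₀ g C) (hk : 1 ≤ k)
    (hX : X₀.IsTopCompl X₁) {A : X →L[𝕜] X} {A₀ : X₀ →L[𝕜] X₀}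
    (hPA : (X₀.projectionOntoL X₁ hX).comp A = A₀.comp (X₀.projectionOntoL X₁ hX))
    (hf0 : f 0 = 0) (hfA : HasFDerivAt f A 0) {ρ ε : ℝ}
    (hρ : ∀ y ∈ Metric.ball (0 : X₀) ρ, C y ∈ O₀)
    (hε : ∀ y ∈ Metric.ball (0 : X₀) ρ, ‖fderiv 𝕜 (fun y => C.symm (g (C y))) y - A₀‖ ≤ ε) :
    IsNormalizedSolution k ρ ε f A₀ (X₀.projectionOntoL X₁ hX) U (fun x => C.symm (π x))
      (fun y => C.symm (g (C y))) where
  isOpen := h.isOpen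
  zero_mem := h.zero_mem
  isCb := h.isCb.clm_comp h.isOpen (C.symm : X₀ →L[𝕜] X₀)
  map_zero := by rw [h.map_zero, _root_.map_zero]
  hasFDerivAt := by
    refine (C.symm.hasFDerivAt.comp (0 : X) (h.hasFDerivAt hk hX)).congr_fderiv ?_
    ext1 x
    simp
  mapsTo := h.mapsTo_f
  semiconj x hx := by rw [h.semiconj x hx, C.apply_symm_apply]
  isCb_ball := (h.isCb₀.comp h.isOpen₀ (isCb_clm (C : X₀ →L[𝕜] X₀) Metric.isBounded_ball)
    Metric.isOpen_ball hρ).clm_comp Metric.isOpen_ball (C.symm : X₀ →L[𝕜] X₀)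
  hasFDerivAt_zero := h.hasFDerivAt_conj hk hX hPA hf0 hfA
  norm_sub_le := hε

/-- A transition map between the normalized solutions, conjugated by the derivatives `C` and `C'`
of the given solutions, is a transition map between the latter. -/
lemma IsSolution.isTransition (h : IsSolution X₀ X₁ k O f U π O₀ g C)
    (h' : IsSolution X₀ X₁ k O f U' π' O₀' g' C') {θ : OpenPartialHomeomorph X₀ X₀} {δ : ℝ}
    (hδ : 0 < δ) (hθ : IsCbDiffeo 𝕜 k θ)
    (hθU : ∀ x ∈ U ∩ U', ‖x‖ < δ → ‖C.symm (π x)‖ < δ → ‖C'.symm (π' x)‖ < δ →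
      C.symm (π x) ∈ θ.source ∧ C'.symm (π' x) = θ (C.symm (π x)) ∧
      C.symm (g (C (C.symm (π x)))) ∈ θ.source ∧
      C'.symm (g' (C' (C'.symm (π' x)))) = θ (C.symm (g (C (C.symm (π x)))))) :
    IsTransition (𝕜 := 𝕜) k U π g U' π' g' (conjHomeomorph θ C C')
      {x | x ∈ U ∩ U' ∧ ‖x‖ < δ ∧ ‖C.symm (π x)‖ < δ ∧ ‖C'.symm (π' x)‖ < δ} := by
  have hW0 : (0 : X) ∈ {x | x ∈ U ∩ U' ∧ ‖x‖ < δ ∧ ‖C.symm (π x)‖ < δ ∧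
      ‖C'.symm (π' x)‖ < δ} := by
    refine ⟨⟨h.zero_mem, h'.zero_mem⟩, ?_⟩
    simpa [h.map_zero, h'.map_zero] using hδ
  have hcoe : ∀ y, conjHomeomorph θ C C' y = C' (θ (C.symm y)) := fun y => rfl
  have hcoes : ∀ y, (conjHomeomorph θ C C').symm y = C (θ.symm (C'.symm y)) := fun y => rfl
  have hsrc : ∀ y, y ∈ (conjHomeomorph θ C C').source ↔ C.symm y ∈ θ.source := fun y => Iff.rfl
  refine ⟨?_, (hθ.conj C C').isCb, (hθ.conj C C').isCb_symm, ?_, hW0, fun x hx => hx.1, ?_, ?_, ?_⟩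
  · have := (hθU 0 hW0.1 hW0.2.1 hW0.2.2.1 hW0.2.2.2).1
    rwa [h.map_zero, ← hsrc] at this
  · have hc : ContinuousOn π (U ∩ U') := h.isCb.1.continuousOn.mono inter_subset_left
    have hc' : ContinuousOn π' (U ∩ U') := h'.isCb.1.continuousOn.mono inter_subset_right
    have hpr : ContinuousOn (fun x => (‖x‖, ‖C.symm (π x)‖, ‖C'.symm (π' x)‖)) (U ∩ U') :=
      continuous_norm.continuousOn.prodMk ((C.symm.continuous.comp_continuousOn hc).norm.prodMk
        (C'.symm.continuous.comp_continuousOn hc').norm)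
    exact hpr.isOpen_inter_preimage (h.isOpen.inter h'.isOpen)
      (isOpen_Iio.prod (isOpen_Iio.prod isOpen_Iio))
  · intro x hx
    exact (hθU x hx.1 hx.2.1 hx.2.2.1 hx.2.2.2).1
  · intro x hx
    rw [hcoe, ← (hθU x hx.1 hx.2.1 hx.2.2.1 hx.2.2.2).2.1, C'.apply_symm_apply]
  · rintro _ ⟨x, hx, rfl⟩
    obtain ⟨e1, e2, e3, e4⟩ := hθU x hx.1 hx.2.1 hx.2.2.1 hx.2.2.2
    rw [C.apply_symm_apply] at e3 e4
    rw [C'.apply_symm_apply] at e4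
    rw [hcoes, e2, θ.left_inv e1, C.apply_symm_apply, hsrc, hcoe, ← e4, C'.apply_symm_apply]
    exact ⟨e3, rfl⟩

variable [CompleteSpace X] [CompleteSpace X₀]

/-- A transition map is determined as a germ, since `π` is open at `0`. -/
lemma IsSolution.eventually_eq_of_isTransition (h : IsSolution X₀ X₁ k O f U π O₀ g C)
    (hk : 1 ≤ k) (hX : X₀.IsTopCompl X₁) {θ θ' : OpenPartialHomeomorph X₀ X₀} {W W' : Set X}
    (hθ : IsTransition (𝕜 := 𝕜) k U π g U' π' g' θ W)
    (hθ' : IsTransition (𝕜 := 𝕜) k U π g U' π' g' θ' W') : ∀ᶠ y in 𝓝 (0 : X₀), θ' y = θ y := by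
  rw [← h.map_nhds hk hX, eventually_map]
  filter_upwards [hθ.isOpen.mem_nhds hθ.zero_mem, hθ'.isOpen.mem_nhds hθ'.zero_mem] with x h1 h2
  rw [← hθ.semiconj x h1, ← hθ'.semiconj x h2]

/-- The properties of the linear part which follow from the spectral assumptions. -/
structure HasLinearData (hX : X₀.IsTopCompl X₁) (A : X →L[𝕜] X) (A₀ : X₀ ≃L[𝕜] X₀) (σA₀ : Set ℂ)
    (ℓ : ℕ) : Prop where
  semiconj : (X₀.projectionOntoL X₁ hX).comp A =
    (A₀ : X₀ →L[𝕜] X₀).comp (X₀.projectionOntoL X₁ hX)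
  exists_hasGap : ∃ a m, HasGap A A₀ ℓ a m
  isUnit_one : ∀ n, 2 ≤ n → n ≤ ℓ → IsUnit (homological n (1 : 𝕜) (A₀ : X₀ →L[𝕜] X₀) A
    (X₀.subtypeL.comp (X₀.projectionOntoL X₁ hX)))
  isUnit_zero : ∀ n, 2 ≤ n → n ≤ ℓ → σA₀ ^ n ∩ σA₀ = ∅ →
    IsUnit (homological n (0 : 𝕜) (A₀ : X₀ →L[𝕜] X₀) A
      (X₀.subtypeL.comp (X₀.projectionOntoL X₁ hX)))

variable {hX : X₀.IsTopCompl X₁} {A : X →L[𝕜] X} {A₀ : X₀ ≃L[𝕜] X₀} {σA₀ : Set ℂ} {ℓ : ℕ}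

omit [CompleteSpace X] [CompleteSpace X₀] in
lemma projectionOntoL_comp_subtypeL (hX : X₀.IsTopCompl X₁) :
    (X₀.projectionOntoL X₁ hX).comp X₀.subtypeL = .id 𝕜 X₀ := by
  ext1 y
  exact Submodule.projectionOntoL_apply_left hX y

lemma HasLinearData.existsSolution (hL : HasLinearData hX A A₀ σA₀ ℓ) (hℓ : 1 ≤ ℓ)
    {r : WithTop ℕ∞} (hr : ((ℓ + 1 : ℕ) : WithTop ℕ∞) ≤ r) (hf : IsMapWithFixedPoint r O f A)
    {d : ℕ} (hd : 1 ≤ d) (hσ : ∀ n, d < n → n ≤ ℓ → σA₀ ^ n ∩ σA₀ = ∅) :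
    ExistsSolution X₀ X₁ (𝕜 := 𝕜) r O f d := by
  obtain ⟨a, m, hgap⟩ := hL.exists_hasGap
  obtain ⟨N, hN⟩ := hgap.exists_pow
  obtain ⟨N', hN'⟩ := hgap.exists_pow'
  have hA₀ : ‖(A₀.symm : X₀ →L[𝕜] X₀) ^ N'‖ * a ^ ((ℓ + 1) * N') < 1 := by
    have ha := hgap.pos
    have hm := hgap.pos'
    calc ‖(A₀.symm : X₀ →L[𝕜] X₀) ^ N'‖ * a ^ ((ℓ + 1) * N')
        < m ^ N' * a ^ ((ℓ + 1) * N') := by gcongr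
      _ = (m * a ^ (ℓ + 1)) ^ N' := by rw [mul_pow, ← pow_mul]
      _ ≤ 1 := pow_le_one₀ (by positivity) hgap.gap.le
  have hfr : ContDiffAt 𝕜 r f 0 := hf.isCb.1.contDiffAt (hf.isOpen.mem_nhds hf.zero_mem)
  obtain ⟨π, g, h1, h2, h3, h4, h5, h6, h7⟩ := exists_solution_germ hL.semiconj hℓ hd
    (fun n hn hnℓ _ => hL.isUnit_one n hn hnℓ)
    (fun n hn hnℓ => hL.isUnit_zero n (by omega) hnℓ (hσ n hn hnℓ))
    hgap.pos hgap.lt_one hN hA₀ hf.map_zero hf.hasFDerivAt (hfr.of_le hr)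
  obtain ⟨U, O₀, k1, k2, k3, k4, k5, k6, k7, k8, k9, k10, k11⟩ := exists_solution_on_nhds
    (projectionOntoL_comp_subtypeL hX) hgap.pos hgap.lt_one hN hr hf h1 h2 h3 h4 h5 h7
  refine ⟨U, π, O₀, g, .refl 𝕜 X₀, ⟨k1, k2, k3, k4, h3, fun v => ?_, ?_, k5, k6, k7, k8, k9, k10⟩,
    k11, h2, fun hd1 => ⟨A₀, h6 hd1⟩⟩
  · rw [h4.fderiv]
    exact Submodule.projectionOntoL_apply_left hX v
  · rw [h4.fderiv]
    exact Submodule.ker_projectionOntoL hX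

lemma exists_ball_norm_fderiv_sub_le {E : Type v} [NormedAddCommGroup E] [NormedSpace 𝕜 E]
    {h : E → E} {L : E →L[𝕜] E} (hh : ContDiffAt 𝕜 1 h 0) (hL : HasFDerivAt h L 0) {ε : ℝ}
    (hε : 0 < ε) : ∀ᶠ x in 𝓝 (0 : E), ‖fderiv 𝕜 h x - L‖ ≤ ε := by
  have hc : ContinuousAt (fun x => ‖fderiv 𝕜 h x - L‖) 0 :=
    ((hh.fderiv_right (m := 0) (by simp)).continuousAt.sub continuousAt_const).norm
  have h0 : ‖fderiv 𝕜 h 0 - L‖ < ε := by rwa [hL.fderiv, sub_self, norm_zero]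
  exact (hc.eventually (gt_mem_nhds h0)).mono fun x hx => hx.le

lemma HasLinearData.uniqueUpToTransition (hL : HasLinearData hX A A₀ σA₀ ℓ) (hℓ : 1 ≤ ℓ)
    {k r : WithTop ℕ∞} (hk : ((ℓ + 1 : ℕ) : WithTop ℕ∞) ≤ k) (hkr : k ≤ r)
    (hf : IsMapWithFixedPoint r O f A) :
    UniqueUpToTransition X₀ X₁ (𝕜 := 𝕜) k O f σA₀ ℓ := by
  intro U π O₀ g C U' π' O₀' g' C' h h'
  have h1k : 1 ≤ k := le_trans (by exact_mod_cast Nat.le_add_left 1 ℓ) hk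
  have hk0 : k ≠ 0 := fun h => by simp [h] at h1k
  obtain ⟨a, m, hgap⟩ := hL.exists_hasGap
  obtain ⟨ε, hε, hunif⟩ := exists_uniform_transition (projectionOntoL_comp_subtypeL hX) hL.semiconj
    hℓ hgap hL.isUnit_one
  have hfr : ContDiffAt 𝕜 1 f 0 :=
    (hf.isCb.1.contDiffAt (hf.isOpen.mem_nhds hf.zero_mem)).of_le (h1k.trans hkr)
  -- the bounds hold on some ball
  have hgev : ∀ {U : Set X} {π : X → X₀} {O₀ : Set X₀} {g : X₀ → X₀} {C : X₀ ≃L[𝕜] X₀},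
      IsSolution X₀ X₁ k O f U π O₀ g C → ∀ᶠ y in 𝓝 (0 : X₀), C y ∈ O₀ ∧
        ‖fderiv 𝕜 (fun y => C.symm (g (C y))) y - (A₀ : X₀ →L[𝕜] X₀)‖ ≤ ε := by
    intro U π O₀ g C h
    have h0 : C 0 ∈ O₀ := by
      have := h.mapsTo_π h.zero_mem
      rwa [h.map_zero, ← map_zero C] at this
    have hd := h.hasFDerivAt_conj h1k hX hL.semiconj hf.map_zero hf.hasFDerivAt
    have hc : ContDiffAt 𝕜 1 (fun y => C.symm (g (C y))) 0 :=
      C.symm.contDiff.contDiffAt.comp (0 : X₀) (ContDiffAt.comp (g := g) (0 : X₀)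
        ((h.isCb₀.1.contDiffAt (h.isOpen₀.mem_nhds h0)).of_le h1k) C.contDiff.contDiffAt)
    exact (C.continuous.continuousAt.eventually_mem (h.isOpen₀.mem_nhds h0)).and
      (exists_ball_norm_fderiv_sub_le hc hd hε)
  have hfev : ∀ᶠ x in 𝓝 (0 : X), DifferentiableAt 𝕜 f x ∧ ‖fderiv 𝕜 f x - A‖ ≤ ε :=
    (hfr.eventually (by simp)).mono (fun x hx => hx.differentiableAt one_ne_zero) |>.and
      (exists_ball_norm_fderiv_sub_le hfr hf.hasFDerivAt hε)
  obtain ⟨ρ₁, hρ₁, hb₁⟩ := Metric.eventually_nhds_iff_ball.1 hfev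
  obtain ⟨ρ₂, hρ₂, hb₂⟩ := Metric.eventually_nhds_iff_ball.1 ((hgev h).and (hgev h'))
  set ρ := min ρ₁ ρ₂ with hρdef
  have hρ : 0 < ρ := lt_min hρ₁ hρ₂
  have hb₁' : ∀ x ∈ Metric.ball (0 : X) ρ, x ∈ Metric.ball (0 : X) ρ₁ := fun x hx =>
    Metric.ball_subset_ball (min_le_left _ _) hx
  have hb₂' : ∀ x ∈ Metric.ball (0 : X₀) ρ, x ∈ Metric.ball (0 : X₀) ρ₂ := fun x hx =>
    Metric.ball_subset_ball (min_le_right _ _) hx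
  obtain ⟨δ, hδ, hθ⟩ := hunif ρ hρ
  have hn := h.isNormalizedSolution h1k hX hL.semiconj hf.map_zero hf.hasFDerivAt
    (fun y hy => (hb₂ y (hb₂' y hy)).1.1) (fun y hy => (hb₂ y (hb₂' y hy)).1.2)
  have hn' := h'.isNormalizedSolution h1k hX hL.semiconj hf.map_zero hf.hasFDerivAt
    (fun y hy => (hb₂ y (hb₂' y hy)).2.1) (fun y hy => (hb₂ y (hb₂' y hy)).2.2)
  obtain ⟨θ, hθcb, hθU⟩ := hθ k f hk hf.map_zero hf.hasFDerivAt (fun x hx => (hb₁ x (hb₁' x hx)).1)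
    (fun x hx => (hb₁ x (hb₁' x hx)).2) U U' _ _ _ _ hn hn'
  have htr := h.isTransition h' hδ hθcb hθU
  refine ⟨_, _, htr, fun θ' W' hθ' => h.eventually_eq_of_isTransition h1k hX htr hθ', ?_⟩
  rintro hσ ⟨L, hgL⟩ ⟨L', hgL'⟩
  -- in normalized coordinates, both linear maps are `A₀`
  have hlin : ∀ {U : Set X} {π : X → X₀} {O₀ : Set X₀} {g : X₀ → X₀} {C : X₀ ≃L[𝕜] X₀}
      {L : X₀ →L[𝕜] X₀}, IsSolution X₀ X₁ k O f U π O₀ g C → (∀ y ∈ O₀, g y = L y) →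
      IsNormalizedSolution k ρ ε f (A₀ : X₀ →L[𝕜] X₀) (X₀.projectionOntoL X₁ hX) U
        (fun x => C.symm (π x)) (fun y => C.symm (g (C y))) →
      IsSolutionGerm (ℓ + 1 : ℕ) f (A₀ : X₀ →L[𝕜] X₀) (X₀.projectionOntoL X₁ hX)
        (fun x => C.symm (π x)) A₀ := by
    intro U π O₀ g C L h hgL hn
    have hg := hn.isSolutionGerm hρ (n := ℓ + 1) (by omega) hk
    have h0 : (0 : X₀) ∈ O₀ := by
      have := h.mapsTo_π h.zero_mem
      rwa [h.map_zero] at this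
    have hC0 : C 0 ∈ O₀ := by rwa [map_zero]
    have e1 : ∀ᶠ y in 𝓝 (0 : X₀), C.symm (g (C y)) = C.symm (L (C y)) := by
      filter_upwards [C.continuous.continuousAt.eventually_mem (h.isOpen₀.mem_nhds hC0)] with y hy
      rw [hgL _ hy]
    have e2 : (A₀ : X₀ →L[𝕜] X₀) = (C.symm : X₀ →L[𝕜] X₀).comp (L.comp (C : X₀ →L[𝕜] X₀)) := by
      refine hn.hasFDerivAt_zero.unique (HasFDerivAt.congr_of_eventuallyEq ?_ e1)
      exact ((C.symm : X₀ →L[𝕜] X₀).comp (L.comp (C : X₀ →L[𝕜] X₀))).hasFDerivAt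
    refine ⟨hg.contDiffAt, hg.map_zero, hg.hasFDerivAt,
      ContinuousLinearMap.hasStrictFDerivAt (A₀ : X₀ →L[𝕜] X₀), ?_⟩
    filter_upwards [h.isOpen.mem_nhds h.zero_mem] with x hx
    have e3 := DFunLike.congr_fun e2 (C.symm (π x))
    rw [h.semiconj x hx, hgL _ (h.mapsTo_π hx)]
    simpa using e3.symm
  have heq := IsSolutionGerm.eventually_eq hℓ hgap
    (fun n hn hnℓ => hL.isUnit_zero n hn hnℓ (hσ n hn hnℓ)) hf.map_zero hf.hasFDerivAt
    (hlin h hgL hn) (hlin h' hgL' hn')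
  rw [← h.map_nhds h1k hX, eventually_map]
  filter_upwards [heq, htr.isOpen.mem_nhds htr.zero_mem] with x e1 e2
  rw [← htr.semiconj x e2, ← e1, C'.apply_symm_apply]

/-- `C^N_b` bounds control the first derivative near a critical point, uniformly. -/
def HasUniformDerivBound (𝕜 : Type*) [RCLike 𝕜] (N : WithTop ℕ∞) (E : Type v)
    [NormedAddCommGroup E] [NormedSpace 𝕜 E] : Prop :=
  ∀ R M ε : ℝ, 0 < R → 0 < M → 0 < ε → ∃ ρ : ℝ, 0 < ρ ∧ ρ ≤ R ∧ ∀ h : E → E,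
    CbNormLE 𝕜 N h (Metric.ball 0 R) M → fderiv 𝕜 h 0 = 0 →
    ∀ x ∈ Metric.ball (0 : E) ρ, ‖fderiv 𝕜 h x‖ ≤ ε

lemma norm_fderiv_sub_le_of_cbNormLE {E : Type v} [NormedAddCommGroup E] [NormedSpace 𝕜 E]
    {N : WithTop ℕ∞} {R M ρ ε : ℝ} (hρ : 0 < ρ) (hρR : ρ ≤ R) (hb : ∀ h : E → E,
      CbNormLE 𝕜 N h (Metric.ball 0 R) M → fderiv 𝕜 h 0 = 0 →
      ∀ x ∈ Metric.ball (0 : E) ρ, ‖fderiv 𝕜 h x‖ ≤ ε) {h : E → E} {L : E →L[𝕜] E}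
    (hh : CbNormLE 𝕜 N (fun x => h x - L x) (Metric.ball 0 R) M)
    (hd : ∀ x ∈ Metric.ball (0 : E) R, DifferentiableAt 𝕜 h x) (h0 : HasFDerivAt h L 0) :
    ∀ x ∈ Metric.ball (0 : E) ρ, ‖fderiv 𝕜 h x - L‖ ≤ ε := by
  have key : ∀ x ∈ Metric.ball (0 : E) R, fderiv 𝕜 (fun x => h x - L x) x = fderiv 𝕜 h x - L :=
    fun x hx => ((hd x hx).hasFDerivAt.sub L.hasFDerivAt).fderiv
  intro x hx
  rw [← key x (Metric.ball_subset_ball hρR hx)]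
  refine hb _ hh ?_ x hx
  rw [key 0 (Metric.mem_ball_self (hρ.trans_le hρR)), h0.fderiv, sub_self]

omit [CompleteSpace X] in
lemma HasLinearData.uniformNeighborhood (hL : HasLinearData hX A A₀ σA₀ ℓ) (hℓ : 1 ≤ ℓ)
    {N : WithTop ℕ∞} (hN : ((ℓ + 1 : ℕ) : WithTop ℕ∞) ≤ N) {ℛ : Set (WithTop ℕ∞)}
    (hbX : HasUniformDerivBound 𝕜 N X) (hbX₀ : HasUniformDerivBound 𝕜 N X₀) :
    UniformNeighborhood X₀ X₁ A (A₀ : X₀ →L[𝕜] X₀) N ℛ := by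
  intro R M hR hM
  obtain ⟨a, m, hgap⟩ := hL.exists_hasGap
  obtain ⟨ε, hε, hunif⟩ := exists_uniform_transition (projectionOntoL_comp_subtypeL hX) hL.semiconj
    hℓ hgap hL.isUnit_one
  obtain ⟨ρ₁, hρ₁, hρ₁R, hb₁⟩ := hbX R M ε hR hM hε
  obtain ⟨ρ₂, hρ₂, hρ₂R, hb₂⟩ := hbX₀ R M ε hR hM hε
  set ρ := min ρ₁ ρ₂ with hρdef
  have hρ : 0 < ρ := lt_min hρ₁ hρ₂
  have hρ1 : ∀ {x : X}, x ∈ Metric.ball (0 : X) ρ → x ∈ Metric.ball (0 : X) ρ₁ := fun hx =>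
    Metric.ball_subset_ball (min_le_left _ _) hx
  have hρ2 : ∀ {x : X₀}, x ∈ Metric.ball (0 : X₀) ρ → x ∈ Metric.ball (0 : X₀) ρ₂ := fun hx =>
    Metric.ball_subset_ball (min_le_right _ _) hx
  obtain ⟨δ, hδ, hθ⟩ := hunif ρ hρ
  refine ⟨δ, hδ, ?_⟩
  intro r _ k hNk hkr O f hf hRO hfM U π O₀ g C U' π' O₀' g' C' h h' hC hCM hC' hCM' _ _ _ _ _ _ _ _
    _ _
  have hk := hN.trans hNk
  have h1k : 1 ≤ k := le_trans (by exact_mod_cast Nat.le_add_left 1 ℓ) hk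
  have hk0 : k ≠ 0 := fun h => by simp [h] at h1k
  have hr0 : r ≠ 0 := fun h => by simp [h, hk0] at hkr
  have hfd : ∀ x ∈ Metric.ball (0 : X) R, DifferentiableAt 𝕜 f x := fun x hx =>
    (hf.isCb.1.contDiffAt (hf.isOpen.mem_nhds (hRO hx))).differentiableAt hr0
  have hfε := norm_fderiv_sub_le_of_cbNormLE hρ₁ hρ₁R hb₁ hfM hfd hf.hasFDerivAt
  have hnorm : ∀ {U : Set X} {π : X → X₀} {O₀ : Set X₀} {g : X₀ → X₀} {C : X₀ ≃L[𝕜] X₀},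
      IsSolution X₀ X₁ k O f U π O₀ g C → (∀ y ∈ Metric.ball (0 : X₀) R, C y ∈ O₀) →
      CbNormLE 𝕜 N (fun y => C.symm (g (C y)) - (A₀ : X₀ →L[𝕜] X₀) y) (Metric.ball 0 R) M →
      IsNormalizedSolution k ρ ε f (A₀ : X₀ →L[𝕜] X₀) (X₀.projectionOntoL X₁ hX) U
        (fun x => C.symm (π x)) (fun y => C.symm (g (C y))) := by
    intro U π O₀ g C h hC hCM
    refine h.isNormalizedSolution h1k hX hL.semiconj hf.map_zero hf.hasFDerivAt
      (fun y hy => hC y (Metric.ball_subset_ball hρ₂R (hρ2 hy))) fun y hy => ?_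
    refine norm_fderiv_sub_le_of_cbNormLE hρ₂ hρ₂R hb₂ hCM (fun y hy => ?_)
      (h.hasFDerivAt_conj h1k hX hL.semiconj hf.map_zero hf.hasFDerivAt) y (hρ2 hy)
    have hg : DifferentiableAt 𝕜 g (C y) :=
      (h.isCb₀.1.contDiffAt (h.isOpen₀.mem_nhds (hC y hy))).differentiableAt hk0
    exact C.symm.differentiableAt.comp y (DifferentiableAt.comp (g := g) y hg C.differentiableAt)
  obtain ⟨θ, hθcb, hθU⟩ := hθ k f hk hf.map_zero hf.hasFDerivAt
    (fun x hx => hfd x (Metric.ball_subset_ball hρ₁R (hρ1 hx)))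
    (fun x hx => hfε x (hρ1 hx)) U U' _ _ _ _
    (hnorm h hC hCM) (hnorm h' hC' hCM')
  exact ⟨_, h.isTransition h' hδ hθcb hθU⟩

lemma HasLinearData.foliationAssertions (hL : HasLinearData hX A A₀ σA₀ ℓ) (hℓ : 1 ≤ ℓ)
    {N : WithTop ℕ∞} (hN : ((ℓ + 1 : ℕ) : WithTop ℕ∞) ≤ N) {ℛ : Set (WithTop ℕ∞)}
    (hℛ : ∀ r ∈ ℛ, ((ℓ + 1 : ℕ) : WithTop ℕ∞) ≤ r)
    (hbX : HasUniformDerivBound 𝕜 N X) (hbX₀ : HasUniformDerivBound 𝕜 N X₀) :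
    FoliationAssertions X₀ X₁ A (A₀ : X₀ →L[𝕜] X₀) σA₀ ℓ N ℛ := by
  refine ⟨fun r hr O f hf => ⟨?_, fun m hm hmℓ hσ => ?_, fun k hNk hkr => ?_⟩,
    hL.uniformNeighborhood hℓ hN hbX hbX₀⟩
  · exact hL.existsSolution hℓ (hℛ r hr) hf hℓ fun n hn hnℓ => absurd hn (by omega)
  · exact hL.existsSolution hℓ (hℛ r hr) hf (by omega) fun n hn hnℓ => hσ n (by omega) hnℓ
  · exact hL.uniqueUpToTransition hℓ (hN.trans hNk) hkr hf

end Splitting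

end InvFoliation

namespace InvFoliation
open Set Filter Topology Asymptotics

universe v

/-! ### Real and complex spaces -/

section DerivBounds

lemma hasUniformDerivBound_of_two_le {E : Type v} [NormedAddCommGroup E] [NormedSpace ℝ E] {n : ℕ}
    (hn : 2 ≤ n) : HasUniformDerivBound ℝ (n : WithTop ℕ∞) E := by
  intro R M ε hR hM hε
  refine ⟨min R (ε / M), lt_min hR (by positivity), min_le_left _ _, fun h hh h0 x hx => ?_⟩
  have hR' : (0 : E) ∈ Metric.ball (0 : E) R := Metric.mem_ball_self hR
  have hxR : x ∈ Metric.ball (0 : E) R := Metric.ball_subset_ball (min_le_left _ _) hx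
  have hd : ∀ y ∈ Metric.ball (0 : E) R, DifferentiableAt ℝ (fderiv ℝ h) y := fun y hy => by
    have h1 : ContDiffAt ℝ 2 h y := (hh.1.contDiffAt (Metric.isOpen_ball.mem_nhds hy)).of_le
      (by exact_mod_cast hn)
    exact (h1.fderiv_right (m := 1) (by norm_num)).differentiableAt one_ne_zero
  have hb : ∀ y ∈ Metric.ball (0 : E) R, ‖fderiv ℝ (fderiv ℝ h) y‖ ≤ M := fun y hy => by
    rw [← norm_iteratedFDeriv_one, norm_iteratedFDeriv_fderiv]
    exact hh.2 2 (by exact_mod_cast hn) (fun h => by simp at h) y hy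
  have := Convex.norm_image_sub_le_of_norm_fderiv_le hd hb (convex_ball 0 R) hR' hxR
  rw [h0, sub_zero, sub_zero] at this
  refine this.trans ?_
  have hx' : ‖x‖ < ε / M := by simpa using Metric.ball_subset_ball (min_le_right _ _) hx
  rw [lt_div_iff₀ hM] at hx'
  linarith

/-- The Cauchy estimate for the derivative of a holomorphic map between complex normed spaces. -/
lemma norm_fderiv_le_div {E : Type*} [NormedAddCommGroup E] [NormedSpace ℂ E] {F : Type*}
    [NormedAddCommGroup F] [NormedSpace ℂ F] {h : E → F} {R M s : ℝ} (hM : 0 ≤ M) (hs : 0 < s)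
    (hd : ∀ x ∈ Metric.ball (0 : E) R, DifferentiableAt ℂ h x)
    (hb : ∀ x ∈ Metric.ball (0 : E) R, ‖h x‖ ≤ M) {x : E} (hx : ‖x‖ + s < R) :
    ‖fderiv ℂ h x‖ ≤ M / s := by
  refine ContinuousLinearMap.opNorm_le_bound _ (by positivity) fun v => ?_
  rcases eq_or_ne v 0 with rfl | hv
  · simp
  have hv' : 0 < ‖v‖ := norm_pos_iff.2 hv
  have hmem : ∀ t : ℂ, ‖t‖ ≤ s / ‖v‖ → x + t • v ∈ Metric.ball (0 : E) R := by
    intro t ht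
    rw [mem_ball_zero_iff]
    refine lt_of_le_of_lt (norm_add_le _ _) (lt_of_le_of_lt ?_ hx)
    rw [norm_smul]
    rw [le_div_iff₀ hv'] at ht
    linarith
  have hline : ∀ t : ℂ, HasDerivAt (fun t : ℂ => x + t • v) v t := fun t => by
    simpa using ((hasDerivAt_id t).smul_const v).const_add x
  have hdt : ∀ t : ℂ, ‖t‖ ≤ s / ‖v‖ → DifferentiableAt ℂ (fun t : ℂ => h (x + t • v)) t :=
    fun t ht => DifferentiableAt.comp (g := h) t (hd _ (hmem t ht)) (hline t).differentiableAt
  have h0 : HasDerivAt (fun t : ℂ => h (x + t • v)) (fderiv ℂ h x v) 0 := by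
    have h1 : HasFDerivAt h (fderiv ℂ h x) (x + (0 : ℂ) • v) := by
      rw [zero_smul, add_zero]
      refine (hd x ?_).hasFDerivAt
      simpa using hmem 0 (by rw [norm_zero]; positivity)
    exact h1.comp_hasDerivAt (0 : ℂ) (hline 0)
  have := Complex.norm_deriv_le_of_forall_mem_sphere_norm_le (c := 0) (R := s / ‖v‖) (C := M)
    (f := fun t : ℂ => h (x + t • v)) (by positivity) ?_ ?_
  · rw [h0.deriv] at this
    rwa [div_div_eq_mul_div, mul_comm, mul_div_assoc, mul_comm] at this
  · refine DifferentiableOn.diffContOnCl fun t ht => (hdt t ?_).differentiableWithinAt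
    have := Metric.closure_ball_subset_closedBall ht
    simpa using this
  · intro t ht
    refine hb _ (hmem t ?_)
    simpa using (mem_sphere_zero_iff_norm.1 ht).le

lemma hasUniformDerivBound_omega {E : Type v} [NormedAddCommGroup E] [NormedSpace ℂ E] :
    HasUniformDerivBound ℂ ω E := by
  intro R M ε hR hM hε
  -- two Cauchy estimates bound the second derivative by `M₂` on the ball of radius `R / 4`
  set M₂ := M / (R / 4) / (R / 4) with hM₂
  have hM₂0 : 0 < M₂ := by positivity
  refine ⟨min (R / 4) (ε / M₂), lt_min (by positivity) (by positivity),
    (min_le_left _ _).trans (by linarith), fun h hh h0 x hx => ?_⟩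
  have hω : ∀ y ∈ Metric.ball (0 : E) R, ContDiffAt ℂ ω h y := fun y hy =>
    hh.1.contDiffAt (Metric.isOpen_ball.mem_nhds hy)
  have hb : ∀ y ∈ Metric.ball (0 : E) R, ‖h y‖ ≤ M := fun y hy => by
    simpa using hh.2 0 (by simp) (fun _ => rfl) y hy
  have hb1 : ∀ y ∈ Metric.ball (0 : E) (3 * R / 4), ‖fderiv ℂ h y‖ ≤ M / (R / 4) := fun y hy => by
    rw [mem_ball_zero_iff] at hy
    exact norm_fderiv_le_div hM.le (by positivity)
      (fun z hz => (hω z hz).differentiableAt (by simp)) hb (by linarith)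
  have hd1 : ∀ y ∈ Metric.ball (0 : E) (3 * R / 4), DifferentiableAt ℂ (fderiv ℂ h) y :=
    fun y hy => (((hω y (Metric.ball_subset_ball (by linarith) hy)).of_le
      (le_top : (2 : WithTop ℕ∞) ≤ ω)).fderiv_right (m := 1) (by norm_num)).differentiableAt
      one_ne_zero
  have hb2 : ∀ y ∈ Metric.ball (0 : E) (R / 4), ‖fderiv ℂ (fderiv ℂ h) y‖ ≤ M₂ := fun y hy => by
    rw [mem_ball_zero_iff] at hy
    exact norm_fderiv_le_div (by positivity) (by positivity) hd1 hb1 (by linarith)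
  let _ : NormedSpace ℝ E := NormedSpace.restrictScalars ℝ ℂ E
  have := Convex.norm_image_sub_le_of_norm_fderiv_le
    (fun y hy => hd1 y (Metric.ball_subset_ball (by linarith) hy)) hb2 (convex_ball 0 (R / 4))
    (Metric.mem_ball_self (by positivity)) (Metric.ball_subset_ball (min_le_left _ _) hx)
  rw [h0, sub_zero, sub_zero] at this
  refine this.trans ?_
  have hx' : ‖x‖ < ε / M₂ := by simpa using Metric.ball_subset_ball (min_le_right _ _) hx
  rw [lt_div_iff₀ hM₂0] at hx'
  linarith

end DerivBounds

section Spectral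

lemma succ_le_of_lt {ℓ : ℕ} {r : WithTop ℕ∞} (h : (ℓ : WithTop ℕ∞) < r) :
    ((ℓ + 1 : ℕ) : WithTop ℕ∞) ≤ r := by
  induction r using WithTop.recTopCoe with
  | top => exact le_top
  | coe r =>
    have h' : (ℓ : ℕ∞) < r := by exact_mod_cast h
    exact_mod_cast Order.add_one_le_of_lt h'

variable {𝕜 : Type*} [RCLike 𝕜] [NormedAlgebra 𝕜 ℂ] {X : Type v} [NormedAddCommGroup X]
  [NormedSpace 𝕜 X] [CompleteSpace X] {X₀ X₁ : Submodule 𝕜 X} [CompleteSpace X₀]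

/-- The spectral assumptions provide the linear data for which the conjugacy problem is solvable. -/
lemma exists_hasLinearData {hX : X₀.IsTopCompl X₁} {A : X →L[𝕜] X} {σA σA₀ σA₀inv σA₁ : Set ℂ}
    {ℓ : ℕ} (hLT : IsLowerTriangular hX A) (hσ : SpectralAssumptions σA σA₀ σA₀inv σA₁ ℓ)
    (hA : ContainsSpectrum (𝕜 := 𝕜) σA A) (hA₀ : ContainsSpectrum (𝕜 := 𝕜) σA₀ (block₀ hX A))
    (hA₀inv : ContainsSpectrum (𝕜 := 𝕜) σA₀inv (block₀ hX A).inverse)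
    (hA₁ : ContainsSpectrum (𝕜 := 𝕜) σA₁ (block₁ hX A)) :
    ∃ A₀ : X₀ ≃L[𝕜] X₀, (A₀ : X₀ →L[𝕜] X₀) = block₀ hX A ∧ HasLinearData hX A A₀ σA₀ ℓ := by
  obtain ⟨u, hu⟩ := hA₀.isUnit hσ.zero_notMem
  set A₀ := ContinuousLinearEquiv.unitsEquiv 𝕜 X₀ u with hA₀def
  have hA₀b : (A₀ : X₀ →L[𝕜] X₀) = block₀ hX A := by
    rw [← hu]
    ext; rfl
  have h00 := projectionOntoL_comp_subtypeL hX
  have h11 := projectionOntoL_comp_subtypeL hX.symm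
  have hsum : X₀.subtypeL.comp (X₀.projectionOntoL X₁ hX) +
      X₁.subtypeL.comp (X₁.projectionOntoL X₀ hX.symm) = 1 := by
    ext1 x
    have := DFunLike.congr_fun (Submodule.projectionL_add_projectionL_eq_id hX) x
    simpa using this
  have hsemi : (X₀.projectionOntoL X₁ hX).comp A =
      (A₀ : X₀ →L[𝕜] X₀).comp (X₀.projectionOntoL X₁ hX) := by
    rw [hA₀b]
    ext1 x
    have h1 := DFunLike.congr_fun hsum x
    have h2 := DFunLike.congr_fun hLT (X₁.projectionOntoL X₀ hX.symm x)
    have h3 : A x = A (X₀.projectionOntoL X₁ hX x) + A (X₁.projectionOntoL X₀ hX.symm x) := by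
      rw [← map_add]
      congr 1
      exact h1.symm
    change X₀.projectionOntoL X₁ hX (A x) =
      X₀.projectionOntoL X₁ hX (A (X₀.projectionOntoL X₁ hX x))
    rw [h3, map_add]
    have h4 : X₀.projectionOntoL X₁ hX (A (X₁.projectionOntoL X₀ hX.symm x)) = 0 := h2
    rw [h4, add_zero]
  have hinv : (block₀ hX A).inverse = (A₀.symm : X₀ →L[𝕜] X₀) := by
    rw [← hA₀b, ContinuousLinearMap.inverse_equiv]
  rw [hinv] at hA₀inv
  obtain ⟨a, ha0, ha1, N, N', hN, hN'⟩ := exists_power_bounds hA hA₀inv hσ.stable hσ.gap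
  obtain ⟨m, hgap⟩ := exists_hasGap ha0 ha1 hN hN'
  refine ⟨A₀, hA₀b, hsemi, ⟨a, m, hgap⟩, fun n hn hnℓ => ?_, fun n hn hnℓ hres => ?_⟩
  · rw [hA₀b]
    exact isUnit_homological h00 h11 hsum hLT hA₀ hA₁ hσ.zero_notMem (Or.inr rfl) (Or.inl rfl)
      fun j hj hjn => hσ.nonresonance n j hn hnℓ hj hjn
  · rw [hA₀b]
    exact isUnit_homological h00 h11 hsum hLT hA₀ hA₁ hσ.zero_notMem (Or.inl rfl) (Or.inr hres)
      fun j hj hjn => hσ.nonresonance n j hn hnℓ hj hjn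

end Spectral

end InvFoliation

/-- First part: real Banach spaces, smoothness `r ∈ ℕ ∪ {∞}` with `r > ℓ`, and solutions of class
`C^k_b` with `ℓ + 1 ≤ k ≤ r`. Second part: complex Banach spaces, `r = k = ω`.
The splitting `X₀.IsTopCompl X₁` says that `X` is the direct sum of the closed subspaces
`X₀` and `X₁`. -/
theorem theorem2p1 :
    (∀ (X : Type*) [NormedAddCommGroup X] [NormedSpace ℝ X] [CompleteSpace X]
      (X₀ X₁ : Submodule ℝ X) (hX : X₀.IsTopCompl X₁) (A : X →L[ℝ] X) (ℓ : ℕ),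
      1 ≤ ℓ →
      InvFoliation.IsLowerTriangular hX A →
      InvFoliation.SpectralAssumptions
        (InvFoliation.realSpectrum A)
        (InvFoliation.realSpectrum (InvFoliation.block₀ hX A))
        (InvFoliation.realSpectrum (InvFoliation.block₀ hX A).inverse)
        (InvFoliation.realSpectrum (InvFoliation.block₁ hX A)) ℓ →
      InvFoliation.FoliationAssertions X₀ X₁ A (InvFoliation.block₀ hX A)
        (InvFoliation.realSpectrum (InvFoliation.block₀ hX A)) ℓ
        ((ℓ + 1 : ℕ) : WithTop ℕ∞) {r | r ≠ ω ∧ (ℓ : WithTop ℕ∞) < r}) ∧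
    (∀ (X : Type*) [NormedAddCommGroup X] [NormedSpace ℂ X] [CompleteSpace X]
      (X₀ X₁ : Submodule ℂ X) (hX : X₀.IsTopCompl X₁) (A : X →L[ℂ] X) (ℓ : ℕ),
      1 ≤ ℓ →
      InvFoliation.IsLowerTriangular hX A →
      InvFoliation.SpectralAssumptions
        (InvFoliation.complexSpectrum A)
        (InvFoliation.complexSpectrum (InvFoliation.block₀ hX A))
        (InvFoliation.complexSpectrum (InvFoliation.block₀ hX A).inverse)
        (InvFoliation.complexSpectrum (InvFoliation.block₁ hX A)) ℓ →
      InvFoliation.FoliationAssertions X₀ X₁ A (InvFoliation.block₀ hX A)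
        (InvFoliation.complexSpectrum (InvFoliation.block₀ hX A)) ℓ ω {ω}) := by
  refine ⟨?_, ?_⟩
  · intro X _ _ _ X₀ X₁ hX A ℓ hℓ hLT hσ
    have : CompleteSpace X₀ := hX.isClosed.completeSpace_coe
    have : CompleteSpace X₁ := hX.symm.isClosed.completeSpace_coe
    obtain ⟨A₀, hA₀, hL⟩ := InvFoliation.exists_hasLinearData hLT hσ
      (InvFoliation.containsSpectrum_real A) (InvFoliation.containsSpectrum_real _)
      (InvFoliation.containsSpectrum_real _) (InvFoliation.containsSpectrum_real _)
    rw [← hA₀] at hL ⊢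
    exact hL.foliationAssertions hℓ le_rfl
      (fun r hr => InvFoliation.succ_le_of_lt hr.2)
      (InvFoliation.hasUniformDerivBound_of_two_le (by omega))
      (InvFoliation.hasUniformDerivBound_of_two_le (by omega))
  · intro X _ _ _ X₀ X₁ hX A ℓ hℓ hLT hσ
    have : CompleteSpace X₀ := hX.isClosed.completeSpace_coe
    have : CompleteSpace X₁ := hX.symm.isClosed.completeSpace_coe
    obtain ⟨A₀, hA₀, hL⟩ := InvFoliation.exists_hasLinearData hLT hσ
      (InvFoliation.containsSpectrum_complex A) (InvFoliation.containsSpectrum_complex _)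
      (InvFoliation.containsSpectrum_complex _) (InvFoliation.containsSpectrum_complex _)
    rw [← hA₀] at hL ⊢
    refine hL.foliationAssertions hℓ le_top (fun r hr => ?_)
      InvFoliation.hasUniformDerivBound_omega InvFoliation.hasUniformDerivBound_omega
    rw [Set.mem_singleton_iff.1 hr]
    exact le_top
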